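/- All manifolds are smooth, Hausdorff and second countable. Let $(M,g)$ be a Lorentzian manifold (signature $(-,+,\dots,+)$) with timelike boundary $\partial M$ and outward unit normal $\nu$; no analyticity, causality or convexity is assumed. Put $$LM=\{(x,v)\in TM: v\neq 0,\ g(v,v)=0\},\qquad JM=\{(x,v)\in TM: v\ne 0,\ g(v,v)\le 0\},$$ and, for $x\in\partial M$, call $(x,v)$ inward if $g(v,\nu)<0$ and inward-or-tangential if $g(v,\nu)\le 0$; let $\partial_-LM$ be the set of inward vectors of $LM$ at boundary points and $\overline{\partial_-LM}$ the set of inward-or-tangential ones. For $p=(x,v)$ with geodesic $\gamma$, $\gamma(0)=x$, $\dot\gamma(0)=v$, let $$\tau(p)=\sup\{t\ge 0:\gamma \text{ is defined and stays in } M \text{ on }[0,t]\},\quad S(p)=(\gamma(\tau(p)),\dot\gamma(\tau(p))),$$ $$\tau^{in}(p)=\sup\{t>0:\gamma((0,t))\subset M\setminus\partial M\},\quad S^{in}(p)=(\gamma(\tau^{in}(p)),\dot\gamma(\tau^{in}(p))).$$ The geodesic (or $p$) is non-trapping if it exits $M$ in finite time, i.e. the supremum $\tau(p)$ is finite and attained.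 An admissible set is a conic (invariant under $v\mapsto rv$, $r>0$) subset $\mathcal U'$ of $\partial TM=TM|_{\partial M}$, open in $\partial TM$, that contains every $(x,v)\in LM$ with $x\in\partial M$ and consists of non-trapping vectors. Write $\mathcal U_-$ for the inward vectors in $\mathcal U'\cap JM$, and $\overline{\mathcal U_-}$ for the inward-or-tangential vectors in $\mathcal U'\cap JM$. Let $(M_1,g_1)$ and $(M_2,g_2)$ be two Lorentzian manifolds with timelike boundary, of the same dimension, all of whose lightlike geodesics (those with initial data in $LM_j$) are non-trapping, and let $\mathcal U'_j\subset\partial TM_j$ be admissible sets. Suppose that $\varphi_0:U_1\to U_2$ is a diffeomorphism between open neighbourhoods $U_j\subset M_j$ of $\partial M_j$ with $\varphi_0^*g_2=g_1$. Assume that at least one of the following holds: 1. $(\varphi_0)_*(\mathcal U_{1,-})=\mathcal U_{2,-}$ and $(\varphi_0)_*\circ S^{in}_1=S^{in}_2\circ(\varphi_0)_*$ on $\mathcal U_{1,-}$; 2. $(\varphi_0)_*(\overline{\mathcal U_{1,-}})=\overline{\mathcal U_{2,-}}$ and $(\varphi_0)_*\circ S_1=S_2\circ(\varphi_0)_*$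 on $\overline{\mathcal U_{1,-}}$. Then $(\varphi_0)_*(\overline{\partial_-LM_1})=\overline{\partial_-LM_2}$, and on $\overline{\partial_-LM_1}$ $$(\varphi_0)_*\circ S_1=S_2\circ(\varphi_0)_*,\qquad \tau_1=\tau_2\circ(\varphi_0)_* .$$ That is, once $g$ is given near $\partial M$, the lightlike complete travel time data $(S,\tau)|_{\overline{\partial_-LM}}$ are determined by $S^{in}|_{\mathcal U_-}$, and also by $S|_{\overline{\mathcal U_-}}$. -/

import Mathlib

open Set Bundle
open scoped Manifold ContDiff Topology

noncomputable section

namespace LorentzScattering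

/-- A symmetric bilinear form has signature `(-,+,…,+)` on the subspace `V`. -/
def IsLorentzianOn {E : Type*} [AddCommGroup E] [Module ℝ E] [TopologicalSpace E]
    (B : E →L[ℝ] E →L[ℝ] ℝ) (V : Submodule ℝ E) : Prop :=
  ∃ u ∈ V, B u u < 0 ∧ ∀ w ∈ V, B u w = 0 → w ≠ 0 → 0 < B w w

/-- A smooth Lorentzian metric on a smooth `n`-dimensional manifold with boundary. -/
structure LorentzMetric (n : ℕ) [NeZero n] (M : Type*) [TopologicalSpace M]
    [ChartedSpace (EuclideanHalfSpace n) M] [IsManifold (𝓡∂ n) ∞ M] where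
  inner (x : M) : TangentSpace (𝓡∂ n) x →L[ℝ] TangentSpace (𝓡∂ n) x →L[ℝ] ℝ
  symm (x : M) (v w : TangentSpace (𝓡∂ n) x) : inner x v w = inner x w v
  lorentzian (x : M) : IsLorentzianOn (inner x) ⊤
  contMDiff : ContMDiff (𝓡∂ n)
    ((𝓡∂ n).prod 𝓘(ℝ, EuclideanSpace ℝ (Fin n) →L[ℝ] EuclideanSpace ℝ (Fin n) →L[ℝ] ℝ)) ∞
    (fun x ↦ TotalSpace.mk'
      (EuclideanSpace ℝ (Fin n) →L[ℝ] EuclideanSpace ℝ (Fin n) →L[ℝ] ℝ) x (inner x))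

section

variable {n : ℕ} [NeZero n] {M : Type*} [TopologicalSpace M]
  [ChartedSpace (EuclideanHalfSpace n) M] [IsManifold (𝓡∂ n) ∞ M]

/-! ### The boundary -/

/-- The differential at `x` of the first coordinate of the chart at `x`; at a boundary point this
coordinate is a boundary defining function that is nonnegative on the manifold. -/
def normalCoord (x : M) : TangentSpace (𝓡∂ n) x →L[ℝ] ℝ :=
  (EuclideanSpace.proj (0 : Fin n) : EuclideanSpace ℝ (Fin n) →L[ℝ] ℝ).comp
    (mfderiv (𝓡∂ n) 𝓘(ℝ, EuclideanSpace ℝ (Fin n)) (extChartAt (𝓡∂ n) x) x)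

/-- The tangent space of the boundary at a boundary point `x`, inside `T_x M`. -/
def boundaryTangent (x : M) : Submodule ℝ (TangentSpace (𝓡∂ n) x) :=
  LinearMap.ker (normalCoord x).toLinearMap

namespace LorentzMetric

variable (g : LorentzMetric n M)

/-- The boundary is timelike: the metric induced on it is Lorentzian. -/
def TimelikeBoundary : Prop :=
  ∀ x ∈ (𝓡∂ n).boundary M, IsLorentzianOn (g.inner x) (boundaryTangent x)

/-- `ν` is the outward unit normal at the boundary point `x`. -/
def IsOutwardUnitNormal (x : M) (ν : TangentSpace (𝓡∂ n) x) : Prop :=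
  normalCoord x ν < 0 ∧ g.inner x ν ν = 1 ∧ ∀ w ∈ boundaryTangent x, g.inner x ν w = 0

/-- `∂₋TM`: vectors at boundary points with `g(v, ν) < 0`. -/
def inward : Set (TangentBundle (𝓡∂ n) M) :=
  {p | p.proj ∈ (𝓡∂ n).boundary M ∧
    ∃ ν, g.IsOutwardUnitNormal p.proj ν ∧ g.inner p.proj p.snd ν < 0}

/-- The closure `∂₋TM ∪ T∂M` of `∂₋TM`: vectors at boundary points with `g(v, ν) ≤ 0`. -/
def inwardClosure : Set (TangentBundle (𝓡∂ n) M) :=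
  {p | p.proj ∈ (𝓡∂ n).boundary M ∧
    ∃ ν, g.IsOutwardUnitNormal p.proj ν ∧ g.inner p.proj p.snd ν ≤ 0}

/-- `LM`: the nonzero lightlike vectors. -/
def lightlike : Set (TangentBundle (𝓡∂ n) M) :=
  {p | p.snd ≠ 0 ∧ g.inner p.proj p.snd p.snd = 0}

/-- `JM`: the nonzero causal vectors. -/
def causal : Set (TangentBundle (𝓡∂ n) M) :=
  {p | p.snd ≠ 0 ∧ g.inner p.proj p.snd p.snd ≤ 0}

/-! ### Geodesics -/

/-- The function `y ↦ g_y(u, w)` for constant coordinate vectors `u`, `w`, in the coordinates of the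
chart at `q`. -/
def coordMetric (q : M) (u w : EuclideanSpace ℝ (Fin n)) (y : EuclideanSpace ℝ (Fin n)) : ℝ :=
  let z : M := (extChartAt (𝓡∂ n) q).symm y
  let A : EuclideanSpace ℝ (Fin n) →L[ℝ] TangentSpace (𝓡∂ n) z :=
    (trivializationAt (EuclideanSpace ℝ (Fin n)) (TangentSpace (𝓡∂ n)) q).symmL ℝ z
  g.inner z (A u) (A w)

/-- The Christoffel symbols of the first kind at `q`, in the coordinates of the chart at `q`:
`Γ(u, v; w) = (∂_u g(v, w) + ∂_v g(u, w) - ∂_w g(u, v)) / 2` for constant `u, v, w`. -/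
def christoffel (q : M) (u v w : EuclideanSpace ℝ (Fin n)) : ℝ :=
  let d (a b c : EuclideanSpace ℝ (Fin n)) : ℝ :=
    fderivWithin ℝ (g.coordMetric q b c) (range (𝓡∂ n)) (extChartAt (𝓡∂ n) q q) a
  (d u v w + d v u w - d w u v) / 2

/-- `c : [0, T] → TM` is the curve `t ↦ (γ t, γ' t)` of a geodesic `γ : [0, T] → M`. At each time
`t₀`, in the coordinates `(x, v)` of `TM` that come from the chart at `γ t₀`, it satisfies
`x' = v` and `g(v', w) + Γ(v, v; w) = 0` for all `w` (derivatives are one-sided at `0` and `T`). -/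
def IsGeodesicOn (c : ℝ → TangentBundle (𝓡∂ n) M) (T : ℝ) : Prop :=
  ContinuousOn c (Icc 0 T) ∧ ∀ t₀ ∈ Icc 0 T,
    let q : M := (c t₀).proj
    let x : ℝ → EuclideanSpace ℝ (Fin n) := fun t ↦ extChartAt (𝓡∂ n) q (c t).proj
    let v : ℝ → EuclideanSpace ℝ (Fin n) := fun t ↦
      (trivializationAt (EuclideanSpace ℝ (Fin n)) (TangentSpace (𝓡∂ n)) q (c t)).2
    HasDerivWithinAt x (v t₀) (Icc 0 T) t₀ ∧
    ∃ a : EuclideanSpace ℝ (Fin n), HasDerivWithinAt v a (Icc 0 T) t₀ ∧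
      ∀ w : EuclideanSpace ℝ (Fin n),
        g.coordMetric q a w (x t₀) + g.christoffel q (v t₀) (v t₀) w = 0

/-- The times `t ≥ 0` such that the geodesic with initial data `p` stays in `M` on `[0, t]`. -/
def stayTimes (p : TangentBundle (𝓡∂ n) M) : Set ℝ :=
  {t | 0 ≤ t ∧ ∃ c, g.IsGeodesicOn c t ∧ c 0 = p}

/-- The geodesic flow, for times in `stayTimes p` (and the value `p` for all other times). -/
def geodesicFlow (p : TangentBundle (𝓡∂ n) M) (t : ℝ) : TangentBundle (𝓡∂ n) M :=
  open Classical in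
  if h : ∃ c, g.IsGeodesicOn c t ∧ c 0 = p then h.choose t else p

/-- The geodesic with initial data `p` exits `M` in finite time: it stays in `M` up to and
including some time, and in no longer time interval. -/
def IsNonTrapping (p : TangentBundle (𝓡∂ n) M) : Prop :=
  ∃ T, IsGreatest (g.stayTimes p) T

/-! ### Travel times and scattering relations -/

/-- The complete travel time `τ`. -/
def completeTime (p : TangentBundle (𝓡∂ n) M) : ℝ :=
  sSup (g.stayTimes p)

/-- The complete scattering relation `S`. -/
def completeScattering (p : TangentBundle (𝓡∂ n) M) : TangentBundle (𝓡∂ n) M :=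
  g.geodesicFlow p (g.completeTime p)

/-- The interior travel time: the supremum of the `t > 0` such that the geodesic with initial
data `p` stays in the interior of `M` on `(0, t)`. -/
def interiorTime (p : TangentBundle (𝓡∂ n) M) : ℝ :=
  sSup {t | 0 < t ∧ ∃ c, g.IsGeodesicOn c t ∧ c 0 = p ∧
    ∀ s ∈ Ioo 0 t, (c s).proj ∈ (𝓡∂ n).interior M}

/-- The interior scattering relation. -/
def interiorScattering (p : TangentBundle (𝓡∂ n) M) : TangentBundle (𝓡∂ n) M :=
  g.geodesicFlow p (g.interiorTime p)

/-- `O` is a conic open neighbourhood in `∂TM` of the lightlike vectors at boundary points, all of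
whose elements have non-trapping geodesics. -/
structure IsConicNhd (O : Set (TangentBundle (𝓡∂ n) M)) : Prop where
  boundary : ∀ p ∈ O, p.proj ∈ (𝓡∂ n).boundary M
  isOpen : ∃ W : Set (TangentBundle (𝓡∂ n) M), IsOpen W ∧
    O = W ∩ {p | p.proj ∈ (𝓡∂ n).boundary M}
  conic : ∀ p ∈ O, ∀ r : ℝ, 0 < r → (⟨p.proj, r • p.snd⟩ : TangentBundle (𝓡∂ n) M) ∈ O
  lightlike : ∀ p ∈ g.lightlike, p.proj ∈ (𝓡∂ n).boundary M → p ∈ O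
  nonTrapping : ∀ p ∈ O, g.IsNonTrapping p

end LorentzMetric

end

/-- `φ : U₁ → U₂` is an isometry of open neighbourhoods `U₁`, `U₂` of the two boundaries. -/
structure IsBoundaryNhdIsometry {n : ℕ} [NeZero n]
    {M₁ : Type*} [TopologicalSpace M₁] [ChartedSpace (EuclideanHalfSpace n) M₁]
    [IsManifold (𝓡∂ n) ∞ M₁]
    {M₂ : Type*} [TopologicalSpace M₂] [ChartedSpace (EuclideanHalfSpace n) M₂]
    [IsManifold (𝓡∂ n) ∞ M₂]
    (g₁ : LorentzMetric n M₁) (g₂ : LorentzMetric n M₂)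
    (φ : PartialDiffeomorph (𝓡∂ n) (𝓡∂ n) M₁ M₂ ∞) : Prop where
  source : (𝓡∂ n).boundary M₁ ⊆ φ.source
  target : (𝓡∂ n).boundary M₂ ⊆ φ.target
  isometry : ∀ x ∈ φ.source, ∀ v w : TangentSpace (𝓡∂ n) x,
    g₂.inner (φ x) (mfderiv (𝓡∂ n) (𝓡∂ n) φ x v) (mfderiv (𝓡∂ n) (𝓡∂ n) φ x w) =
      g₁.inner x v w

end LorentzScattering

end

noncomputable section

namespace LorentzScattering

set_option linter.unusedSectionVars false

open Filter Asymptotics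
open scoped NNReal

/-! The scattering data see where geodesics leave, not when. The time is recovered by tilting a
lightlike vector to a timelike one and letting the first variation formula convert the change of
energy into a duration.

Let `q` be lightlike at the boundary, with a geodesic that stays in `M₁` for some positive time.
Since the boundary is timelike, there is a `ξ` pointing strictly inward with κ = g(q, ξ) < 0
(`exists_tilt_direction`), so that q + sξ is timelike and inward for small s > 0 and lies in the
domain of the data. Its geodesic stays in the interior for a time independent of s
(`exists_geodesic_tilt`). Either hypothesis then gives boundary points of the two tilted geodesics
that correspond under `φ`, at times T₁(s) and T₂(s) that may differ (`SameData.exists_match`).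
Non-trapping bounds these times as s → 0; along an ultrafilter they converge to t₁ and t₂, and the
limiting end points still correspond.

The equality t₁ = t₂ is `eq_time_of_tendsto`. Pair the velocity of the limit geodesic with the
displacement to the tilted one. The pairing vanishes at the start, where the base point is fixed,
and after time t equals half of the energy change times t, that is s·t·κ, up to O(s²)
(`first_variation`). Shortly before the ends, the geodesics in `M₁` and `M₂` correspond under `φ`
(`tail_eq`) up to a small time shift; since the limit is null, a shift changes the pairing only to
second order (`momentum_sub_isBigO`). Comparing the two pairings gives (t₁ - t₂)·κ·s = O(s²), hence
t₁ = t₂. Thus `SameData.exists_reach`: some later boundary point of the geodesic of `q` corresponds,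
at the same time.

These steps have no lower bound, and contacts with the boundary may accumulate, so they cannot just
be iterated forward. Instead the geodesic is followed back to where it entered `M₁`, which exists by
non-trapping, and real induction on the time shows that every boundary point on it corresponds: from
a boundary point at time s, the step applied to the reversed velocity leads to an earlier boundary
point, where the claim is known, and just after a boundary point the isometry itself carries the
geodesic over (`SameData.reach_of_maximal`). In particular the exit point in `M₁` is reached in `M₂`
at the same time, so τ₁ ≤ τ₂; exchanging the manifolds gives equality (`SameData.scattering`).

At the boundary, differentiability of the flow in the initial data is avoided. Differences of
geodesics with O(s²) errors replace Jacobi fields, and the spray is extended across the boundary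
only as a Lipschitz field (`LocalFlow`), which suffices for Picard-Lindelöf and Grönwall. -/

/-! ### Induction on real intervals -/

/-- If a property can be propagated to the right inside a neighbourhood of each point of `[0, T]`,
then it passes from `0` to `T`. -/
theorem real_induction_of_local {P : ℝ → Prop} {T : ℝ} (hT : 0 ≤ T) (h0 : P 0)
    (hstep : ∀ t ∈ Icc 0 T, ∃ ε > 0, ∀ a ∈ Icc 0 T, ∀ b ∈ Icc 0 T, |a - t| < ε → |b - t| < ε →
      a ≤ b → P a → P b) : P T := by
  set S : Set ℝ := {t | t ∈ Icc 0 T ∧ P t} with hS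
  have h0S : (0 : ℝ) ∈ S := ⟨⟨le_rfl, hT⟩, h0⟩
  have hbdd : BddAbove S := ⟨T, fun t ht ↦ ht.1.2⟩
  have hs : sSup S ∈ Icc 0 T := ⟨le_csSup hbdd h0S, csSup_le ⟨0, h0S⟩ fun t ht ↦ ht.1.2⟩
  obtain ⟨ε, hε, h⟩ := hstep _ hs
  obtain ⟨a, haS, ha⟩ := exists_lt_of_lt_csSup ⟨0, h0S⟩ (sub_lt_self (sSup S) hε)
  have ha' : a ≤ sSup S := le_csSup hbdd haS
  have haε : |a - sSup S| < ε := by rw [abs_lt]; constructor <;> linarith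
  set b := min T (sSup S + ε / 2) with hb
  have hsb : sSup S ≤ b := le_min hs.2 (by linarith)
  have hb' : b ≤ sSup S + ε / 2 := min_le_right _ _
  have hbI : b ∈ Icc 0 T := ⟨hs.1.trans hsb, min_le_left _ _⟩
  have hPb : P b := h a haS.1 b hbI haε (by rw [abs_lt]; constructor <;> linarith)
    (ha'.trans hsb) haS.2
  have : b ≤ sSup S := le_csSup hbdd ⟨hbI, hPb⟩
  rcases min_choice T (sSup S + ε / 2) with h1 | h1
  · rwa [hb, h1] at hPb
  · rw [hb, h1] at this; linarith

/-- Induction on `[0, T]`, in the form of a step to the right and a passage to the limit. -/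
theorem real_induction {P : ℝ → Prop} {T : ℝ} (h0 : P 0)
    (hlim : ∀ s ∈ Ioc 0 T, (∀ t ∈ Ico 0 s, P t) → P s)
    (hstep : ∀ s ∈ Ico 0 T, (∀ t ∈ Icc 0 s, P t) → ∃ s' > s, ∀ t ∈ Ioc s s', t ≤ T → P t) :
    ∀ t ∈ Icc 0 T, P t := by
  intro t₁ ht₁
  by_contra hcon
  set S : Set ℝ := {t | t ∈ Icc 0 T ∧ ¬ P t}
  have hne : S.Nonempty := ⟨t₁, ht₁, hcon⟩
  have hbdd : BddBelow S := ⟨0, fun t ht ↦ ht.1.1⟩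
  set s := sInf S
  have hs0 : 0 ≤ s := le_csInf hne fun t ht ↦ ht.1.1
  have hsT : s ≤ T := (csInf_le hbdd ⟨ht₁, hcon⟩).trans ht₁.2
  have hlt : ∀ t ∈ Ico 0 s, P t := fun t ht ↦ by
    by_contra h
    exact absurd (csInf_le hbdd (show t ∈ S from ⟨⟨ht.1, ht.2.le.trans hsT⟩, h⟩)) (not_le.2 ht.2)
  have hPs : P s := by
    rcases hs0.eq_or_lt with h | h
    · rwa [← h]
    · exact hlim s ⟨h, hsT⟩ hlt
  have hall : ∀ t ∈ Icc 0 s, P t := fun t ht ↦ by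
    rcases ht.2.eq_or_lt with h | h
    · rwa [h]
    · exact hlt t ⟨ht.1, h⟩
  have hsT' : s < T := by
    refine lt_of_le_of_ne hsT fun h ↦ hcon (hall t₁ ⟨ht₁.1, h ▸ ht₁.2⟩)
  obtain ⟨s', hs', h⟩ := hstep s ⟨hs0, hsT'⟩ hall
  obtain ⟨t, htS, ht⟩ := exists_lt_of_csInf_lt hne hs'
  have hst : s ≤ t := csInf_le hbdd htS
  rcases hst.eq_or_lt with h' | h'
  · exact htS.2 (h' ▸ hPs)
  · exact htS.2 (h t ⟨h', ht.le⟩ htS.1.2)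

/-! ### Calculus -/

section Calculus

variable {V : Type*} [NormedAddCommGroup V] [NormedSpace ℝ V]
  {W : Type*} [NormedAddCommGroup W] [NormedSpace ℝ W]

/-- Second order Taylor estimate with uniform constant near a point of a convex set. -/
theorem exists_taylor_bound {f : V → W} {s : Set V} {x : V} (hf : ContDiffWithinAt ℝ 2 f s x)
    (hs : Convex ℝ s) (hu : UniqueDiffOn ℝ s) (hx : x ∈ s) :
    ∃ C ≥ 0, ∃ r > 0, ∀ a ∈ Metric.ball x r ∩ s, ∀ b ∈ Metric.ball x r ∩ s,
      ‖f b - f a - fderivWithin ℝ f s a (b - a)‖ ≤ C * ‖b - a‖ ^ 2 := by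
  have h1 : ContDiffWithinAt ℝ 1 (fderivWithin ℝ f s) s x :=
    hf.fderivWithin_right hu (by norm_num) hx
  -- A C² function has a locally Lipschitz derivative; the mean value inequality on the segment from
  -- `a` to `b`, relative to the derivative at `a`, gives a constant that is uniform in both end
  -- points.
  obtain ⟨K, t, ht, hK⟩ := h1.exists_lipschitzOnWith hs
  obtain ⟨u, hu', hxu, hdiff⟩ := (hf.of_le (m := 1) (by norm_num)).contDiffOn' le_rfl (by simp)
  rw [insert_eq_of_mem hx] at hdiff
  obtain ⟨r, hr, hrt⟩ := Metric.mem_nhdsWithin_iff.1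
    (Filter.inter_mem ht (mem_nhdsWithin_of_mem_nhds (hu'.mem_nhds hxu)))
  refine ⟨K, K.2, r, hr, fun a ha b hb ↦ ?_⟩
  have hseg : segment ℝ a b ⊆ Metric.ball x r ∩ s :=
    ((convex_ball x r).inter hs).segment_subset ha hb
  have hder : ∀ y ∈ segment ℝ a b, HasFDerivWithinAt f (fderivWithin ℝ f s y) (segment ℝ a b) y := by
    intro y hy
    have hy' := hseg hy
    have h2 : DifferentiableWithinAt ℝ f (s ∩ u) y :=
      (hdiff y ⟨hy'.2, (hrt hy').2⟩).differentiableWithinAt (by norm_num)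
    have h3 : DifferentiableWithinAt ℝ f s y :=
      (differentiableWithinAt_inter (hu'.mem_nhds (hrt hy').2)).1 h2
    exact h3.hasFDerivWithinAt.mono (hseg.trans inter_subset_right)
  have := (convex_segment a b).norm_image_sub_le_of_norm_hasFDerivWithin_le' (f := f)
    (φ := fderivWithin ℝ f s a) (C := K * ‖b - a‖) hder ?_ (left_mem_segment ℝ a b)
    (right_mem_segment ℝ a b)
  · calc _ ≤ _ := this
      _ = _ := by ring
  · intro y hy
    calc _ ≤ K * ‖y - a‖ := by
          simpa [dist_eq_norm] using hK.dist_le_mul _ (hrt (hseg hy)).1 _ (hrt ha).1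
      _ ≤ K * ‖b - a‖ := by
          gcongr
          obtain ⟨θ, hθ, rfl⟩ := (segment_eq_image' ℝ a b) ▸ hy
          simp only [add_sub_cancel_left, norm_smul, Real.norm_eq_abs, abs_of_nonneg hθ.1]
          exact mul_le_of_le_one_left (norm_nonneg _) hθ.2

/-- Local solvability of an autonomous ODE with Lipschitz right-hand side, with uniform time of
existence and solutions that stay close. -/
theorem exists_local_solution [CompleteSpace V] {F : V → V} {K : ℝ≥0} (hF : LipschitzWith K F)
    (z₀ : V) {r : ℝ} (hr : 0 < r) :
    ∃ ε > 0, (∀ x ∈ Metric.ball z₀ (r / 2), ∃ z : ℝ → V, z 0 = x ∧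
      ∀ t ∈ Icc 0 ε, HasDerivWithinAt z (F (z t)) (Icc 0 ε) t ∧ z t ∈ Metric.ball z₀ r) := by
  set L : ℝ := K * r + ‖F z₀‖ + 1 with hL
  have hL0 : 0 < L := by positivity
  have hb : ∀ x ∈ Metric.closedBall z₀ r, ‖F x‖ ≤ L := fun x hx ↦ by
    have h1 : ‖F x - F z₀‖ ≤ K * ‖x - z₀‖ := by
      simpa [dist_eq_norm] using hF.dist_le_mul x z₀
    have h2 : ‖x - z₀‖ ≤ r := by simpa [dist_eq_norm] using hx
    have h3 : ‖F x‖ ≤ ‖F x - F z₀‖ + ‖F z₀‖ := norm_le_norm_sub_add _ _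
    have h4 : K * ‖x - z₀‖ ≤ K * r := by gcongr
    linarith
  -- solutions from Picard-Lindelöf, on a time interval so short that Grönwall keeps them close
  have hgr : Tendsto (fun t ↦ gronwallBound (r / 2) K (0 + ‖F z₀‖) t) (𝓝 0) (𝓝 (r / 2)) := by
    have : ContinuousAt (fun t ↦ gronwallBound (r / 2) K (0 + ‖F z₀‖) t) 0 :=
      (hasDerivAt_gronwallBound _ _ _ 0).continuousAt
    simpa [ContinuousAt, gronwallBound_x0] using this
  obtain ⟨ε₁, hε₁, hlt⟩ := Metric.eventually_nhds_iff.1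
    (hgr.eventually (gt_mem_nhds (half_lt_self hr)))
  set ε : ℝ := min (ε₁ / 2) (r / 2 / L) with hε
  have hε0 : 0 < ε := by positivity
  have hεL : L * ε ≤ r / 2 := by
    calc L * ε ≤ L * (r / 2 / L) := by gcongr; exact min_le_right _ _
      _ = r / 2 := by field_simp
  have hPL : IsPicardLindelof (fun _ ↦ F) (tmin := 0) (tmax := ε) ⟨0, le_rfl, hε0.le⟩ z₀
      ⟨r, hr.le⟩ ⟨r / 2, by positivity⟩ ⟨L, hL0.le⟩ K := by
    apply IsPicardLindelof.of_time_independent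
    · exact hb
    · exact hF.lipschitzOnWith
    · simp only [sub_zero, sub_self]
      rw [max_eq_left hε0.le]
      change L * ε ≤ r - r / 2
      linarith
  refine ⟨ε, hε0, fun x hx ↦ ?_⟩
  obtain ⟨z, hz0, hz⟩ := hPL.exists_eq_forall_mem_Icc_hasDerivWithinAt
    (x := x) (Metric.ball_subset_closedBall hx)
  refine ⟨z, hz0, fun t ht ↦ ⟨hz t ht, ?_⟩⟩
  have := dist_le_of_approx_trajectories_ODE (v := fun _ ↦ F) (f := z) (g := fun _ ↦ z₀)
    (f' := fun t ↦ F (z t)) (g' := fun _ ↦ 0) (a := 0) (b := ε) (εf := 0) (εg := ‖F z₀‖)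
    (δ := r / 2) (fun _ ↦ hF)
    (fun t ht ↦ (hz t ht).continuousWithinAt)
    (fun t ht ↦ (hz t (Ico_subset_Icc_self ht)).mono_of_mem_nhdsWithin (Icc_mem_nhdsGE_of_mem ht))
    (fun t _ ↦ by simp) continuousOn_const (fun t _ ↦ hasDerivWithinAt_const _ _ _)
    (fun t _ ↦ by simp) (by simpa [hz0] using (Metric.mem_ball.1 hx).le) t ht
  refine lt_of_le_of_lt this (hlt ?_)
  simp only [sub_zero, Real.dist_eq, abs_of_nonneg ht.1]
  have : ε ≤ ε₁ / 2 := min_le_left _ _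
  linarith [ht.2]

/-- Grönwall's inequality for two solutions on `[a, b]`. -/
theorem dist_le_of_solutions {F : V → V} {K : ℝ≥0} (hF : LipschitzWith K F) {a b : ℝ}
    {z w : ℝ → V} (hz : ∀ t ∈ Icc a b, HasDerivWithinAt z (F (z t)) (Icc a b) t)
    (hw : ∀ t ∈ Icc a b, HasDerivWithinAt w (F (w t)) (Icc a b) t) :
    ∀ t ∈ Icc a b, dist (z t) (w t) ≤ dist (z a) (w a) * Real.exp (K * (t - a)) :=
  dist_le_of_trajectories_ODE (v := fun _ ↦ F) (fun _ ↦ hF)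
    (fun t ht ↦ (hz t ht).continuousWithinAt)
    (fun t ht ↦ (hz t (Ico_subset_Icc_self ht)).mono_of_mem_nhdsWithin (Icc_mem_nhdsGE_of_mem ht))
    (fun t ht ↦ (hw t ht).continuousWithinAt)
    (fun t ht ↦ (hw t (Ico_subset_Icc_self ht)).mono_of_mem_nhdsWithin (Icc_mem_nhdsGE_of_mem ht))
    le_rfl

/-! ### The geodesic equation in coordinates -/

instance : NormedAddCommGroup (V →L[ℝ] ℝ) := inferInstance
instance : NormedSpace ℝ (V →L[ℝ] ℝ) := inferInstance
instance : NormedAddCommGroup (V →L[ℝ] V →L[ℝ] ℝ) := ContinuousLinearMap.toNormedAddCommGroup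
instance : NormedSpace ℝ (V →L[ℝ] V →L[ℝ] ℝ) := ContinuousLinearMap.toNormedSpace
instance : NormedAddCommGroup (V →L[ℝ] V →L[ℝ] V →L[ℝ] ℝ) :=
  ContinuousLinearMap.toNormedAddCommGroup
instance : NormedSpace ℝ (V →L[ℝ] V →L[ℝ] V →L[ℝ] ℝ) := ContinuousLinearMap.toNormedSpace

/-- The geodesic equation `g(a, w) + Γ(v, v; w) = 0` for the metric `G` on the domain `s`. -/
def GeodesicEq (G : V → V →L[ℝ] V →L[ℝ] ℝ) (s : Set V) (y v a : V) : Prop :=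
  ∀ w, G y a w + (fderivWithin ℝ G s y v v w - 1 / 2 * fderivWithin ℝ G s y w v v) = 0

/-- The Christoffel form `w ↦ Γ(v, v; w)`. -/
def christoffelForm (G : V → V →L[ℝ] V →L[ℝ] ℝ) (s : Set V) (y v : V) : V →L[ℝ] ℝ :=
  fderivWithin ℝ G s y v v - (1 / 2 : ℝ) • ((fderivWithin ℝ G s y).flip v).flip v

/-- The geodesic spray of `G`. -/
def spray (G : V → V →L[ℝ] V →L[ℝ] ℝ) (s : Set V) (z : V × V) : V × V :=
  (z.2, -(G z.1).inverse (christoffelForm G s z.1 z.2))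

theorem christoffelForm_apply (G : V → V →L[ℝ] V →L[ℝ] ℝ) (s : Set V) (y v w : V) :
    christoffelForm G s y v w =
      fderivWithin ℝ G s y v v w - 1 / 2 * fderivWithin ℝ G s y w v v := by
  simp [christoffelForm]

/-- Nondegeneracy of `G y` lets the tested equation be solved for the acceleration, which turns it
into a first order ODE on position and velocity. -/
theorem geodesicEq_iff {G : V → V →L[ℝ] V →L[ℝ] ℝ} {s : Set V} {y v a : V}
    (hG : (G y).IsInvertible) : GeodesicEq G s y v a ↔ a = (spray G s (y, v)).2 := by
  have h1 : GeodesicEq G s y v a ↔ G y a = -christoffelForm G s y v := by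
    rw [ContinuousLinearMap.ext_iff]
    refine forall_congr' fun w ↦ ?_
    rw [neg_apply, christoffelForm_apply, eq_neg_iff_add_eq_zero]
  rw [h1, spray, ← map_neg]
  obtain ⟨e, he⟩ := hG
  rw [← he, ContinuousLinearMap.inverse_equiv]
  simp only [ContinuousLinearEquiv.coe_coe]
  constructor
  · intro h; rw [← h]; simp
  · intro h; rw [h]; simp

/-- Inversion is smooth at invertible operators, so only the one derivative taken in the Christoffel
form is lost. C¹ is what makes the spray locally Lipschitz. -/
theorem contDiffWithinAt_spray [CompleteSpace V] {G : V → V →L[ℝ] V →L[ℝ] ℝ} {s : Set V} {z : V × V}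
    (hG : ContDiffWithinAt ℝ 2 G s z.1) (hs : UniqueDiffOn ℝ s) (hz : z.1 ∈ s)
    (hinv : (G z.1).IsInvertible) :
    ContDiffWithinAt ℝ 1 (spray G s) (s ×ˢ univ) z := by
  have hmaps : MapsTo (Prod.fst : V × V → V) (s ×ˢ univ) s := fun p hp ↦ hp.1
  have hfst : ContDiffWithinAt ℝ 1 (Prod.fst : V × V → V) (s ×ˢ univ) z := contDiffWithinAt_fst
  have hsnd : ContDiffWithinAt ℝ 1 (Prod.snd : V × V → V) (s ×ˢ univ) z := contDiffWithinAt_snd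
  have hG1 : ContDiffWithinAt ℝ 1 (fun p : V × V ↦ G p.1) (s ×ˢ univ) z :=
    (hG.of_le (by norm_num)).comp z hfst hmaps
  have hD1 : ContDiffWithinAt ℝ 1 (fun p : V × V ↦ fderivWithin ℝ G s p.1) (s ×ˢ univ) z :=
    (hG.fderivWithin_right (m := 1) hs (by norm_num) hz).comp z hfst hmaps
  have hinv' : ContDiffWithinAt ℝ 1 (fun p : V × V ↦ (G p.1).inverse) (s ×ˢ univ) z :=
    ContDiffAt.comp_contDiffWithinAt (g := ContinuousLinearMap.inverse) (f := fun p : V × V ↦ G p.1)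
      z hinv.contDiffAt_map_inverse hG1
  have hflip : ContDiffWithinAt ℝ 1 (fun p : V × V ↦
      ((fderivWithin ℝ G s p.1).flip p.2).flip p.2) (s ×ˢ univ) z := by
    have e1 : ContDiffWithinAt ℝ 1 (fun p : V × V ↦
        (ContinuousLinearMap.flipₗᵢ ℝ V V (V →L[ℝ] ℝ)) (fderivWithin ℝ G s p.1)) (s ×ˢ univ) z :=
      (ContinuousLinearMap.flipₗᵢ ℝ V V (V →L[ℝ] ℝ)).contDiff.contDiffAt.comp_contDiffWithinAt z hD1
    have e2 : ContDiffWithinAt ℝ 1 (fun p : V × V ↦ (ContinuousLinearMap.flipₗᵢ ℝ V V ℝ)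
        ((fderivWithin ℝ G s p.1).flip p.2)) (s ×ˢ univ) z :=
      (ContinuousLinearMap.flipₗᵢ ℝ V V ℝ).contDiff.contDiffAt.comp_contDiffWithinAt z
        (e1.clm_apply hsnd)
    exact e2.clm_apply hsnd
  have hchr : ContDiffWithinAt ℝ 1 (fun p : V × V ↦ christoffelForm G s p.1 p.2) (s ×ˢ univ) z :=
    ((hD1.clm_apply hsnd).clm_apply hsnd).sub (hflip.const_smul _)
  exact hsnd.prodMk (hinv'.clm_apply hchr).neg

/-- The relation between the differentials of a metric and of its pullback. -/
theorem fderivWithin_pullback {G₁ G₂ : V → V →L[ℝ] V →L[ℝ] ℝ} {Ψ : V → V} {s : Set V} {y : V}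
    (hs : UniqueDiffOn ℝ s) (hy : y ∈ s) (hΨ : ContDiffWithinAt ℝ 2 Ψ s y)
    (hmap : ∀ᶠ x in 𝓝[s] y, Ψ x ∈ s)
    (hG₁ : DifferentiableWithinAt ℝ G₁ s y) (hG₂ : DifferentiableWithinAt ℝ G₂ s (Ψ y))
    (hG : ∀ᶠ x in 𝓝[s] y, ∀ u w, G₁ x u w =
      G₂ (Ψ x) (fderivWithin ℝ Ψ s x u) (fderivWithin ℝ Ψ s x w)) (h u w : V) :
    fderivWithin ℝ G₁ s y h u w =
      fderivWithin ℝ G₂ s (Ψ y) (fderivWithin ℝ Ψ s y h) (fderivWithin ℝ Ψ s y u)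
        (fderivWithin ℝ Ψ s y w) +
      G₂ (Ψ y) (fderivWithin ℝ (fderivWithin ℝ Ψ s) s y h u) (fderivWithin ℝ Ψ s y w) +
      G₂ (Ψ y) (fderivWithin ℝ Ψ s y u) (fderivWithin ℝ (fderivWithin ℝ Ψ s) s y h w) := by
  have hD : HasFDerivWithinAt (fderivWithin ℝ Ψ s) (fderivWithin ℝ (fderivWithin ℝ Ψ s) s y) s y :=
    ((hΨ.fderivWithin_right (m := 1) hs (by norm_num) hy).differentiableWithinAt
      (by norm_num)).hasFDerivWithinAt
  have hΨ' : HasFDerivWithinAt Ψ (fderivWithin ℝ Ψ s y) s y :=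
    (hΨ.differentiableWithinAt (by norm_num)).hasFDerivWithinAt
  have h2 : HasFDerivWithinAt (fun x ↦ G₂ (Ψ x))
      ((fderivWithin ℝ G₂ s (Ψ y)).comp (fderivWithin ℝ Ψ s y)) s y := by
    have ht : Tendsto Ψ (𝓝[s] y) (𝓝[s] (Ψ y)) :=
      tendsto_nhdsWithin_iff.2 ⟨hΨ.continuousWithinAt, hmap⟩
    exact HasFDerivAtFilter.comp hG₂.hasFDerivWithinAt hΨ'
      (ht.prodMap (by simp))
  have hR := (h2.clm_apply (hD.clm_apply (hasFDerivWithinAt_const u y s))).clm_apply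
    (hD.clm_apply (hasFDerivWithinAt_const w y s))
  have hL := (hG₁.hasFDerivWithinAt.clm_apply (hasFDerivWithinAt_const u y s)).clm_apply
    (hasFDerivWithinAt_const w y s)
  have hR' := hR.congr_of_eventuallyEq (hG.mono fun x hx ↦ hx u w)
    (hG.self_of_nhdsWithin hy u w)
  have := (hs y hy).eq hL hR'
  have := congrArg (fun L ↦ L h) this
  simp at this
  rw [this]; ring

/-- The geodesic equation is invariant under isometries. -/
theorem GeodesicEq.map {G₁ G₂ : V → V →L[ℝ] V →L[ℝ] ℝ} {Ψ : V → V} {s : Set V} {y v a : V}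
    (h : GeodesicEq G₁ s y v a)
    (hs : UniqueDiffOn ℝ s) (hy : y ∈ s) (hy' : y ∈ closure (interior s))
    (hΨ : ContDiffWithinAt ℝ 2 Ψ s y)
    (hmap : ∀ᶠ x in 𝓝[s] y, Ψ x ∈ s)
    (hG₁ : DifferentiableWithinAt ℝ G₁ s y) (hG₂ : DifferentiableWithinAt ℝ G₂ s (Ψ y))
    (hG : ∀ᶠ x in 𝓝[s] y, ∀ u w, G₁ x u w =
      G₂ (Ψ x) (fderivWithin ℝ Ψ s x u) (fderivWithin ℝ Ψ s x w))
    (hsymm : ∀ u w, G₂ (Ψ y) u w = G₂ (Ψ y) w u)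
    (hsurj : Function.Surjective (fderivWithin ℝ Ψ s y)) :
    GeodesicEq G₂ s (Ψ y) (fderivWithin ℝ Ψ s y v)
      (fderivWithin ℝ (fderivWithin ℝ Ψ s) s y v v + fderivWithin ℝ Ψ s y a) := by
  intro w'
  obtain ⟨w, rfl⟩ := hsurj w'
  have h0 := h w
  rw [fderivWithin_pullback hs hy hΨ hmap hG₁ hG₂ hG, fderivWithin_pullback hs hy hΨ hmap hG₁ hG₂ hG,
    hG.self_of_nhdsWithin hy] at h0
  -- The pullback formula leaves D²Ψ(v, w) from one term and twice half of D²Ψ(w, v) from the other;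
  -- they cancel by symmetry of the second derivative. On a half space this symmetry uses that `y`
  -- lies in the closure of the interior.
  have hsy := (hΨ.isSymmSndFDerivWithinAt (by simp) hs hy' hy).eq w v
  rw [hsy] at h0
  have e := hsymm (fderivWithin ℝ (fderivWithin ℝ Ψ s) s y v w) (fderivWithin ℝ Ψ s y v)
  simp only [map_add, add_apply]
  linarith

end Calculus

/-! ### Coordinates on the tangent bundle -/

/-- The model vector space. -/
abbrev Coord (n : ℕ) := EuclideanSpace ℝ (Fin n)

section

variable {n : ℕ} [NeZero n] {M : Type*} [TopologicalSpace M]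
  [ChartedSpace (EuclideanHalfSpace n) M] [IsManifold (𝓡∂ n) ∞ M]

theorem range_convex : Convex ℝ (range (𝓡∂ n)) := by
  rw [range_modelWithCornersEuclideanHalfSpace]
  exact EuclideanHalfSpace.convex

theorem mem_range_iff {y : Coord n} : y ∈ range (𝓡∂ n) ↔ 0 ≤ y 0 := by
  rw [range_modelWithCornersEuclideanHalfSpace]; rfl

theorem range_subset_closure_interior :
    range (𝓡∂ n) ⊆ closure (interior (range (𝓡∂ n))) :=
  (𝓡∂ n).range_subset_closure_interior

theorem isClosed_range_model : IsClosed (range (𝓡∂ n)) := (𝓡∂ n).isClosed_range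

instance isManifold_one : IsManifold (𝓡∂ n) 1 M := .of_le (n := ∞) (by simp)

/-- The coordinates on `TM` that come from the chart at `q`. -/
def coord (q : M) (P : TangentBundle (𝓡∂ n) M) : Coord n × Coord n :=
  (extChartAt (𝓡∂ n) q P.proj, (trivializationAt (Coord n) (TangentSpace (𝓡∂ n)) q P).2)

/-- The tangent vector with given coordinates. -/
def ofCoord (q : M) (z : Coord n × Coord n) : TangentBundle (𝓡∂ n) M :=
  ⟨(extChartAt (𝓡∂ n) q).symm z.1,
    (trivializationAt (Coord n) (TangentSpace (𝓡∂ n)) q).symmL ℝ _ z.2⟩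

theorem coord_fst_mem_target {q : M} {P : TangentBundle (𝓡∂ n) M}
    (hP : P.proj ∈ (chartAt (EuclideanHalfSpace n) q).source) :
    (coord q P).1 ∈ (extChartAt (𝓡∂ n) q).target :=
  (extChartAt (𝓡∂ n) q).map_source (by rwa [extChartAt_source])

/-- Valid off the chart domain too, because the extended chart is a chart followed by the embedding
of the half space. This gives the sign of the first coordinate without any domain condition. -/
theorem coord_fst_mem_range (q : M) (P : TangentBundle (𝓡∂ n) M) :
    (coord q P).1 ∈ range (𝓡∂ n) := mem_range_self _

theorem coord_snd {q : M} {P : TangentBundle (𝓡∂ n) M}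
    (hP : P.proj ∈ (chartAt (EuclideanHalfSpace n) q).source) :
    (coord q P).2 = mfderiv (𝓡∂ n) 𝓘(ℝ, Coord n) (extChartAt (𝓡∂ n) q) P.proj P.snd := by
  have h1 := TangentBundle.continuousLinearMapAt_trivializationAt (I := 𝓡∂ n) hP
  have h2 : (trivializationAt (Coord n) (TangentSpace (𝓡∂ n)) q).continuousLinearMapAt ℝ P.proj
      P.snd = (coord q P).2 := by
    rw [Trivialization.continuousLinearMapAt_apply, Trivialization.coe_linearMapAt_of_mem _ hP]
    rfl
  rw [← h2]
  exact DFunLike.congr_fun h1 P.snd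

theorem symmL_coord_snd {q x : M} (hx : x ∈ (chartAt (EuclideanHalfSpace n) q).source)
    (v : TangentSpace (𝓡∂ n) x) :
    (trivializationAt (Coord n) (TangentSpace (𝓡∂ n)) q).symmL ℝ x
      (coord q (⟨x, v⟩ : TangentBundle (𝓡∂ n) M)).2 = v := by
  rw [Trivialization.symmL_apply _ hx]
  exact (trivializationAt (Coord n) (TangentSpace (𝓡∂ n)) q).symm_apply_apply_mk hx v

theorem ofCoord_coord {q : M} {P : TangentBundle (𝓡∂ n) M}
    (hP : P.proj ∈ (chartAt (EuclideanHalfSpace n) q).source) : ofCoord q (coord q P) = P := by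
  obtain ⟨x, v⟩ := P
  have h1 : (extChartAt (𝓡∂ n) q).symm (extChartAt (𝓡∂ n) q x) = x :=
    (extChartAt (𝓡∂ n) q).left_inv (by rwa [extChartAt_source])
  have key : ∀ y : M, y = x → (⟨y, (trivializationAt (Coord n) (TangentSpace (𝓡∂ n)) q).symmL ℝ y
      (coord q (⟨x, v⟩ : TangentBundle (𝓡∂ n) M)).2⟩ : TangentBundle (𝓡∂ n) M) = ⟨x, v⟩ := by
    rintro y rfl
    rw [symmL_coord_snd hP]
  exact key _ h1

theorem ofCoord_proj_mem {q : M} {z : Coord n × Coord n}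
    (hz : z.1 ∈ (extChartAt (𝓡∂ n) q).target) :
    (ofCoord q z).proj ∈ (chartAt (EuclideanHalfSpace n) q).source := by
  have := (extChartAt (𝓡∂ n) q).map_target hz
  rwa [extChartAt_source] at this

theorem coord_ofCoord {q : M} {z : Coord n × Coord n}
    (hz : z.1 ∈ (extChartAt (𝓡∂ n) q).target) : coord q (ofCoord q z) = z := by
  have hs := ofCoord_proj_mem hz
  refine Prod.ext ((extChartAt (𝓡∂ n) q).right_inv hz) ?_
  have := (trivializationAt (Coord n) (TangentSpace (𝓡∂ n)) q).apply_mk_symm hs z.2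
  have h3 := (trivializationAt (Coord n) (TangentSpace (𝓡∂ n)) q).symmL_apply (R := ℝ) hs z.2
  have h4 : ofCoord q z = ⟨(ofCoord q z).proj,
      (trivializationAt (Coord n) (TangentSpace (𝓡∂ n)) q).symm (ofCoord q z).proj z.2⟩ :=
    congrArg (TotalSpace.mk (ofCoord q z).proj) h3
  exact (congrArg (fun P ↦ (trivializationAt (Coord n) (TangentSpace (𝓡∂ n)) q P).2) h4).trans
    (congrArg Prod.snd this)

theorem coord_injOn {q : M} {P P' : TangentBundle (𝓡∂ n) M}
    (hP : P.proj ∈ (chartAt (EuclideanHalfSpace n) q).source)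
    (hP' : P'.proj ∈ (chartAt (EuclideanHalfSpace n) q).source)
    (h : coord q P = coord q P') : P = P' := by
  rw [← ofCoord_coord hP, ← ofCoord_coord hP', h]

theorem eventually_proj_mem {q : M} {P : TangentBundle (𝓡∂ n) M}
    (hP : P.proj ∈ (chartAt (EuclideanHalfSpace n) q).source) :
    ∀ᶠ P' in 𝓝 P, P'.proj ∈ (chartAt (EuclideanHalfSpace n) q).source :=
  (FiberBundle.continuous_proj (Coord n) (TangentSpace (𝓡∂ n))).continuousAt.eventually
    ((chartAt (EuclideanHalfSpace n) q).open_source.mem_nhds hP)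

theorem continuousAt_coord {q : M} {P : TangentBundle (𝓡∂ n) M}
    (hP : P.proj ∈ (chartAt (EuclideanHalfSpace n) q).source) : ContinuousAt (coord q) P := by
  have h := ((trivializationAt (Coord n) (TangentSpace (𝓡∂ n)) q).tendsto_nhds_iff
    (f := id) (l := 𝓝 P) (z := P) hP).1 tendsto_id
  refine Tendsto.prodMk_nhds ?_ h.2
  exact (continuousAt_extChartAt' (by rwa [extChartAt_source])).tendsto.comp h.1

/-- The inverse chart is continuous within the half space, where all coordinates lie. The points `f
a` must be assumed to lie in the chart domain, since coordinates do not determine points outside it.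
-/
theorem tendsto_of_coord {α : Type*} {l : Filter α} {f : α → TangentBundle (𝓡∂ n) M} {q : M}
    {P : TangentBundle (𝓡∂ n) M}
    (hP : P.proj ∈ (chartAt (EuclideanHalfSpace n) q).source)
    (hf : ∀ᶠ a in l, (f a).proj ∈ (chartAt (EuclideanHalfSpace n) q).source)
    (h : Tendsto (fun a ↦ coord q (f a)) l (𝓝 (coord q P))) : Tendsto f l (𝓝 P) := by
  refine ((trivializationAt (Coord n) (TangentSpace (𝓡∂ n)) q).tendsto_nhds_iff
    (f := f) (z := P) hP).2 ⟨?_, (continuous_snd.tendsto (coord q P)).comp h⟩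
  have h1 : Tendsto (fun a ↦ (coord q (f a)).1) l (𝓝[range (𝓡∂ n)] (coord q P).1) :=
    tendsto_nhdsWithin_iff.2 ⟨(continuous_fst.tendsto _).comp h,
      Eventually.of_forall fun a ↦ coord_fst_mem_range _ _⟩
  have h0 : ContinuousWithinAt (extChartAt (𝓡∂ n) q).symm (range (𝓡∂ n)) (coord q P).1 :=
    (contMDiffWithinAt_extChartAt_symm_range (n := ∞) q (coord_fst_mem_target hP)).continuousWithinAt
  have h2 : Tendsto (fun a ↦ (extChartAt (𝓡∂ n) q).symm (coord q (f a)).1) l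
      (𝓝 ((extChartAt (𝓡∂ n) q).symm (extChartAt (𝓡∂ n) q P.proj))) := h0.tendsto.comp h1
  rw [(extChartAt (𝓡∂ n) q).left_inv (by rwa [extChartAt_source])] at h2
  refine h2.congr' (hf.mono fun a ha ↦ ?_)
  exact (extChartAt (𝓡∂ n) q).left_inv (by rwa [extChartAt_source])

/-- The vector `r • P`, at the same base point. -/
def scale (r : ℝ) (P : TangentBundle (𝓡∂ n) M) : TangentBundle (𝓡∂ n) M := ⟨P.proj, r • P.snd⟩

theorem coord_scale {q : M} {P : TangentBundle (𝓡∂ n) M} (r : ℝ)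
    (hP : P.proj ∈ (chartAt (EuclideanHalfSpace n) q).source) :
    coord q (scale r P) = ((coord q P).1, r • (coord q P).2) := by
  refine Prod.ext rfl ?_
  change (coord q (scale r P)).2 = r • (coord q P).2
  rw [coord_snd (P := scale r P) hP, coord_snd hP]
  exact map_smul _ _ _

theorem coord_self (P : TangentBundle (𝓡∂ n) M) : (coord P.proj P).2 = P.snd := by
  rw [coord_snd (mem_chart_source _ _), mfderiv_extChartAt_self]
  rfl

end

/-! ### Maps in coordinates -/

section

variable {n : ℕ} [NeZero n] {M₁ : Type*} [TopologicalSpace M₁]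
  [ChartedSpace (EuclideanHalfSpace n) M₁] [IsManifold (𝓡∂ n) ∞ M₁]
  {M₂ : Type*} [TopologicalSpace M₂]
  [ChartedSpace (EuclideanHalfSpace n) M₂] [IsManifold (𝓡∂ n) ∞ M₂]

/-- The coordinate representation of a map. -/
def coordMap (φ : M₁ → M₂) (q₁ : M₁) (q₂ : M₂) : Coord n → Coord n :=
  extChartAt (𝓡∂ n) q₂ ∘ φ ∘ (extChartAt (𝓡∂ n) q₁).symm

variable (φ : PartialDiffeomorph (𝓡∂ n) (𝓡∂ n) M₁ M₂ ∞) {q₁ : M₁} {q₂ : M₂}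

/-- The set of coordinates of points at which the coordinate representation is defined. -/
def coordDomain (q₁ : M₁) (q₂ : M₂) : Set (Coord n) :=
  {y | y ∈ (extChartAt (𝓡∂ n) q₁).target ∧ (extChartAt (𝓡∂ n) q₁).symm y ∈ φ.source ∧
    φ ((extChartAt (𝓡∂ n) q₁).symm y) ∈ (chartAt (EuclideanHalfSpace n) q₂).source}

theorem coordDomain_mem {x : M₁} (h1 : x ∈ (chartAt (EuclideanHalfSpace n) q₁).source)
    (h2 : x ∈ φ.source) (h3 : φ x ∈ (chartAt (EuclideanHalfSpace n) q₂).source) :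
    extChartAt (𝓡∂ n) q₁ x ∈ coordDomain φ q₁ q₂ := by
  have h1' : x ∈ (extChartAt (𝓡∂ n) q₁).source := by rwa [extChartAt_source]
  refine ⟨(extChartAt (𝓡∂ n) q₁).map_source h1', ?_⟩
  rw [(extChartAt (𝓡∂ n) q₁).left_inv h1']
  exact ⟨h2, h3⟩

theorem contDiffWithinAt_coordMap {y : Coord n} (hy : y ∈ coordDomain φ q₁ q₂) :
    ContDiffWithinAt ℝ ∞ (coordMap φ q₁ q₂) (range (𝓡∂ n)) y := by
  rw [← contMDiffWithinAt_iff_contDiffWithinAt]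
  have hφ : ContMDiffAt (𝓡∂ n) (𝓡∂ n) ∞ φ ((extChartAt (𝓡∂ n) q₁).symm y) :=
    φ.contMDiffOn.contMDiffAt (φ.open_source.mem_nhds hy.2.1)
  have h1 : ContMDiffWithinAt 𝓘(ℝ, Coord n) (𝓡∂ n) ∞ (extChartAt (𝓡∂ n) q₁).symm
      (range (𝓡∂ n)) y := contMDiffWithinAt_extChartAt_symm_range q₁ hy.1
  have h2 : ContMDiffAt (𝓡∂ n) 𝓘(ℝ, Coord n) ∞ (extChartAt (𝓡∂ n) q₂)
      (φ ((extChartAt (𝓡∂ n) q₁).symm y)) := contMDiffAt_extChartAt' hy.2.2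
  exact (h2.comp _ hφ).comp_contMDiffWithinAt y h1

theorem eventually_coordDomain {y : Coord n} (hy : y ∈ coordDomain φ q₁ q₂) :
    ∀ᶠ y' in 𝓝[range (𝓡∂ n)] y, y' ∈ coordDomain φ q₁ q₂ := by
  have hsymm : ContinuousWithinAt (extChartAt (𝓡∂ n) q₁).symm (range (𝓡∂ n)) y :=
    (contMDiffWithinAt_extChartAt_symm_range (n := ∞) q₁ hy.1).continuousWithinAt
  have hφ : ContinuousAt φ ((extChartAt (𝓡∂ n) q₁).symm y) :=
    (φ.contMDiffOn.contMDiffAt (φ.open_source.mem_nhds hy.2.1)).continuousAt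
  exact Filter.Eventually.and (extChartAt_target_mem_nhdsWithin_of_mem hy.1) <| (hsymm.eventually (φ.open_source.mem_nhds hy.2.1)).and
    ((hφ.comp_continuousWithinAt hsymm).eventually
      ((chartAt (EuclideanHalfSpace n) q₂).open_source.mem_nhds hy.2.2))

theorem coordMap_mem_range (ψ : M₁ → M₂) (y : Coord n) : coordMap ψ q₁ q₂ y ∈ range (𝓡∂ n) :=
  mem_range_self _

theorem coord_tangentMap {P : TangentBundle (𝓡∂ n) M₁}
    (h1 : P.proj ∈ (chartAt (EuclideanHalfSpace n) q₁).source)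
    (h2 : P.proj ∈ φ.source) (h3 : φ P.proj ∈ (chartAt (EuclideanHalfSpace n) q₂).source) :
    coord q₂ (tangentMap (𝓡∂ n) (𝓡∂ n) φ P) =
      (coordMap φ q₁ q₂ (coord q₁ P).1,
        fderivWithin ℝ (coordMap φ q₁ q₂) (range (𝓡∂ n)) (coord q₁ P).1 (coord q₁ P).2) := by
  have h1' : P.proj ∈ (extChartAt (𝓡∂ n) q₁).source := by rwa [extChartAt_source]
  have hdom := coordDomain_mem φ h1 h2 h3
  refine Prod.ext ?_ ?_
  · change extChartAt (𝓡∂ n) q₂ (φ P.proj) = _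
    simp only [coordMap, coord, Function.comp_apply]
    rw [(extChartAt (𝓡∂ n) q₁).left_inv h1']
  · rw [coord_snd (P := tangentMap (𝓡∂ n) (𝓡∂ n) φ P) h3, coord_snd h1]
    have hφ : MDifferentiableAt (𝓡∂ n) (𝓡∂ n) φ P.proj := φ.mdifferentiableAt (by simp) h2
    have hq₂ : MDifferentiableAt (𝓡∂ n) 𝓘(ℝ, Coord n) (extChartAt (𝓡∂ n) q₂) (φ P.proj) :=
      mdifferentiableAt_extChartAt h3
    have hq₁ : MDifferentiableAt (𝓡∂ n) 𝓘(ℝ, Coord n) (extChartAt (𝓡∂ n) q₁) P.proj :=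
      mdifferentiableAt_extChartAt h1
    have hΨ : MDifferentiableWithinAt 𝓘(ℝ, Coord n) 𝓘(ℝ, Coord n) (coordMap φ q₁ q₂)
        (range (𝓡∂ n)) (extChartAt (𝓡∂ n) q₁ P.proj) :=
      ((contDiffWithinAt_coordMap φ hdom).differentiableWithinAt
        (by simp)).mdifferentiableWithinAt
    have hL := hq₂.hasMFDerivAt.comp P.proj hφ.hasMFDerivAt
    have hR := (hΨ.hasMFDerivWithinAt.comp P.proj (hq₁.hasMFDerivAt.hasMFDerivWithinAt (s := univ))
      (fun x _ ↦ mem_range_self _))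
    rw [hasMFDerivWithinAt_univ] at hR
    have hev : (extChartAt (𝓡∂ n) q₂ ∘ φ) =ᶠ[𝓝 P.proj]
        (coordMap φ q₁ q₂ ∘ extChartAt (𝓡∂ n) q₁) := by
      filter_upwards [extChartAt_source_mem_nhds' (I := 𝓡∂ n) h1'] with x hx
      simp only [coordMap, Function.comp_apply]
      rw [(extChartAt (𝓡∂ n) q₁).left_inv hx]
    have := hasMFDerivAt_unique hL (hR.congr_of_eventuallyEq hev)
    rw [mfderivWithin_eq_fderivWithin] at this
    exact DFunLike.congr_fun this P.snd

/-- `φ` preserves the metrics. -/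
def IsometricOn (g₁ : LorentzMetric n M₁) (g₂ : LorentzMetric n M₂)
    (φ : PartialDiffeomorph (𝓡∂ n) (𝓡∂ n) M₁ M₂ ∞) : Prop :=
  ∀ x ∈ φ.source, ∀ v w : TangentSpace (𝓡∂ n) x,
    g₂.inner (φ x) (mfderiv (𝓡∂ n) (𝓡∂ n) φ x v) (mfderiv (𝓡∂ n) (𝓡∂ n) φ x w) =
      g₁.inner x v w

end

/-! ### The metric in coordinates -/

section

variable {n : ℕ} [NeZero n] {M : Type*} [TopologicalSpace M]
  [ChartedSpace (EuclideanHalfSpace n) M] [IsManifold (𝓡∂ n) ∞ M]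
  (g : LorentzMetric n M)

/-- The metric in the coordinates of the chart at `q`. -/
def metricIn (q : M) (y : Coord n) : Coord n →L[ℝ] Coord n →L[ℝ] ℝ :=
  let z : M := (extChartAt (𝓡∂ n) q).symm y
  let B : Coord n →L[ℝ] Coord n →L[ℝ] ℝ := g.inner z
  let A : Coord n →L[ℝ] Coord n :=
    (trivializationAt (Coord n) (TangentSpace (𝓡∂ n)) q).symmL ℝ z
  B.bilinearComp A A

theorem coordMetric_eq (q : M) (u w y : Coord n) : g.coordMetric q u w y = metricIn g q y u w := rfl

theorem metricIn_symm (q : M) (y u w : Coord n) : metricIn g q y u w = metricIn g q y w u :=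
  g.symm _ _ _

theorem metricIn_apply {q : M} {x : M} (hx : x ∈ (chartAt (EuclideanHalfSpace n) q).source)
    (v w : TangentSpace (𝓡∂ n) x) :
    metricIn g q (extChartAt (𝓡∂ n) q x) (coord q ⟨x, v⟩).2 (coord q ⟨x, w⟩).2 =
      g.inner x v w := by
  have h1 : (extChartAt (𝓡∂ n) q).symm (extChartAt (𝓡∂ n) q x) = x :=
    (extChartAt (𝓡∂ n) q).left_inv (by rwa [extChartAt_source])
  have key : ∀ y : M, y = x → g.inner y
      ((trivializationAt (Coord n) (TangentSpace (𝓡∂ n)) q).symmL ℝ y (coord q ⟨x, v⟩).2)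
      ((trivializationAt (Coord n) (TangentSpace (𝓡∂ n)) q).symmL ℝ y (coord q ⟨x, w⟩).2) =
      g.inner x v w := by
    rintro y rfl
    rw [symmL_coord_snd hx, symmL_coord_snd hx]
  exact key _ h1

theorem contMDiffAt_frame {q x : M} (hx : x ∈ (chartAt (EuclideanHalfSpace n) q).source)
    (u : Coord n) :
    ContMDiffAt (𝓡∂ n) ((𝓡∂ n).prod 𝓘(ℝ, Coord n)) ∞
      (fun x ↦ TotalSpace.mk' (Coord n) (E := TangentSpace (𝓡∂ n)) x
        ((trivializationAt (Coord n) (TangentSpace (𝓡∂ n)) q).symmL ℝ x u)) x := by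
  rw [Trivialization.contMDiffAt_section_iff (e := trivializationAt (Coord n) (TangentSpace (𝓡∂ n)) q) hx]
  refine contMDiffAt_const (c := u) |>.congr_of_eventuallyEq ?_
  filter_upwards [(chartAt (EuclideanHalfSpace n) q).open_source.mem_nhds hx] with x' hx'
  rw [Trivialization.symmL_apply _ hx', Trivialization.apply_mk_symm _ hx']

/-- In finite dimension it suffices to treat the components at fixed `u`, `w`: each is the smooth
metric section applied to two smooth frame sections. -/
theorem contDiffWithinAt_metricIn {q : M} {y : Coord n} (hy : y ∈ (extChartAt (𝓡∂ n) q).target) :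
    ContDiffWithinAt ℝ ∞ (metricIn g q) (range (𝓡∂ n)) y := by
  suffices h : ContDiffOn ℝ ∞ (metricIn g q) (extChartAt (𝓡∂ n) q).target from
    (h y hy).mono_of_mem_nhdsWithin (extChartAt_target_mem_nhdsWithin_of_mem hy)
  rw [contDiffOn_clm_apply]
  intro u
  rw [contDiffOn_clm_apply]
  intro w
  rw [← contMDiffOn_iff_contDiffOn]
  have h1 : ContMDiffOn (𝓡∂ n) 𝓘(ℝ, ℝ) ∞ (fun x ↦ g.inner x
      ((trivializationAt (Coord n) (TangentSpace (𝓡∂ n)) q).symmL ℝ x u)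
      ((trivializationAt (Coord n) (TangentSpace (𝓡∂ n)) q).symmL ℝ x w))
      (extChartAt (𝓡∂ n) q).source := by
    intro x hx
    rw [extChartAt_source] at hx
    have : ContMDiffAt (𝓡∂ n) ((𝓡∂ n).prod 𝓘(ℝ)) ∞
        (fun x ↦ TotalSpace.mk' ℝ (E := Bundle.Trivial M ℝ) x (g.inner x
          ((trivializationAt (Coord n) (TangentSpace (𝓡∂ n)) q).symmL ℝ x u)
          ((trivializationAt (Coord n) (TangentSpace (𝓡∂ n)) q).symmL ℝ x w))) x := by
      apply ContMDiffAt.clm_bundle_apply₂ (F₁ := Coord n) (F₂ := Coord n)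
      · exact g.contMDiff.contMDiffAt
      · exact contMDiffAt_frame hx u
      · exact contMDiffAt_frame hx w
    simp only [contMDiffAt_totalSpace] at this
    exact this.2.contMDiffWithinAt
  exact h1.comp (contMDiffOn_extChartAt_symm q) fun y hy ↦ (extChartAt (𝓡∂ n) q).map_target hy

/-- A vector of the radical is orthogonal to the timelike `u`, and on the orthogonal complement of
`u` the form is positive definite. -/
theorem IsLorentzianOn.eq_zero {E : Type*} [AddCommGroup E] [Module ℝ E] [TopologicalSpace E]
    {B : E →L[ℝ] E →L[ℝ] ℝ} (hB : IsLorentzianOn B ⊤) (hsymm : ∀ v w, B v w = B w v) {m : E}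
    (hm : ∀ w, B m w = 0) : m = 0 := by
  obtain ⟨u, -, -, hu⟩ := hB
  by_contra h
  exact (hu m trivial (by rw [hsymm, hm]) h).ne' (hm m)

theorem metricIn_isInvertible {q : M} {y : Coord n} (hy : y ∈ (extChartAt (𝓡∂ n) q).target) :
    (metricIn g q y).IsInvertible := by
  have hinj : Function.Injective (metricIn g q y) := by
    rw [injective_iff_map_eq_zero]
    intro m hm
    have hz := ofCoord_proj_mem (z := (y, m)) hy
    have h0 : (ofCoord q (y, m)).snd = 0 := by
      refine (g.lorentzian (ofCoord q (y, m)).proj).eq_zero (g.symm _) fun w ↦ ?_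
      have h1 := metricIn_apply g hz (ofCoord q (y, m)).snd w
      rw [← h1]
      change metricIn g q (coord q (ofCoord q (y, m))).1 (coord q (ofCoord q (y, m))).2 _ = 0
      rw [coord_ofCoord (z := (y, m)) hy]
      simp [hm]
    have h2 : coord q (scale 0 (ofCoord q (y, m))) = coord q (ofCoord q (y, m)) := by
      have h3 : (0 : ℝ) • (ofCoord q (y, m)).snd = (ofCoord q (y, m)).snd := by rw [h0, smul_zero]
      exact congrArg (fun v ↦ coord q (TotalSpace.mk (ofCoord q (y, m)).proj v)) h3
    rw [coord_scale 0 hz, coord_ofCoord (z := (y, m)) hy] at h2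
    simpa using (congrArg Prod.snd h2).symm
  have hdim : Module.finrank ℝ (Coord n) = Module.finrank ℝ (Coord n →L[ℝ] ℝ) := by
    rw [← (LinearMap.toContinuousLinearMap (𝕜 := ℝ) (E := Coord n) (F' := ℝ)).finrank_eq]
    exact Subspace.dual_finrank_eq.symm
  refine ⟨(LinearMap.linearEquivOfInjective (metricIn g q y).toLinearMap hinj
    hdim).toContinuousLinearEquiv, ?_⟩
  ext u w
  rfl

end

/-! ### Isometries in coordinates -/

section

variable {n : ℕ} [NeZero n] {M₁ : Type*} [TopologicalSpace M₁]
  [ChartedSpace (EuclideanHalfSpace n) M₁] [IsManifold (𝓡∂ n) ∞ M₁]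
  {M₂ : Type*} [TopologicalSpace M₂]
  [ChartedSpace (EuclideanHalfSpace n) M₂] [IsManifold (𝓡∂ n) ∞ M₂]
  {g₁ : LorentzMetric n M₁} {g₂ : LorentzMetric n M₂}
  {φ : PartialDiffeomorph (𝓡∂ n) (𝓡∂ n) M₁ M₂ ∞}

theorem IsometricOn.metricIn (hφ : IsometricOn g₁ g₂ φ) {q₁ : M₁} {q₂ : M₂} {y : Coord n}
    (hy : y ∈ coordDomain φ q₁ q₂) (u w : Coord n) :
    metricIn g₁ q₁ y u w = metricIn g₂ q₂ (coordMap φ q₁ q₂ y)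
      (fderivWithin ℝ (coordMap φ q₁ q₂) (range (𝓡∂ n)) y u)
      (fderivWithin ℝ (coordMap φ q₁ q₂) (range (𝓡∂ n)) y w) := by
  have hs : ∀ u, (ofCoord q₁ (y, u)).proj ∈ (chartAt (EuclideanHalfSpace n) q₁).source :=
    fun u ↦ ofCoord_proj_mem (z := (y, u)) hy.1
  have hc : ∀ u, coord q₁ (ofCoord q₁ (y, u)) = (y, u) := fun u ↦ coord_ofCoord (z := (y, u)) hy.1
  have ht : ∀ u, coord q₂ (tangentMap (𝓡∂ n) (𝓡∂ n) φ (ofCoord q₁ (y, u))) =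
      (coordMap φ q₁ q₂ y, fderivWithin ℝ (coordMap φ q₁ q₂) (range (𝓡∂ n)) y u) := fun u ↦ by
    rw [coord_tangentMap φ (hs u) hy.2.1 hy.2.2, hc]
  have e1 := metricIn_apply g₁ (hs u) (ofCoord q₁ (y, u)).snd (ofCoord q₁ (y, w)).snd
  have e2 := metricIn_apply g₂ (x := φ (ofCoord q₁ (y, u)).proj) hy.2.2
    (mfderiv (𝓡∂ n) (𝓡∂ n) φ _ (ofCoord q₁ (y, u)).snd)
    (mfderiv (𝓡∂ n) (𝓡∂ n) φ _ (ofCoord q₁ (y, w)).snd)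
  have e3 := hφ (ofCoord q₁ (y, u)).proj hy.2.1 (ofCoord q₁ (y, u)).snd (ofCoord q₁ (y, w)).snd
  replace e2 := e2.trans (e3.trans e1.symm)
  have f1 := hc u
  have f2 := hc w
  have f3 := ht u
  have f4 := ht w
  change LorentzScattering.metricIn g₂ q₂
    (coord q₂ (tangentMap (𝓡∂ n) (𝓡∂ n) φ (ofCoord q₁ (y, u)))).1
    (coord q₂ (tangentMap (𝓡∂ n) (𝓡∂ n) φ (ofCoord q₁ (y, u)))).2
    (coord q₂ (tangentMap (𝓡∂ n) (𝓡∂ n) φ (ofCoord q₁ (y, w)))).2 =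
    LorentzScattering.metricIn g₁ q₁ (coord q₁ (ofCoord q₁ (y, u))).1
    (coord q₁ (ofCoord q₁ (y, u))).2 (coord q₁ (ofCoord q₁ (y, w))).2 at e2
  rw [f1, f2, f3, f4] at e2
  exact e2.symm

theorem tangentMap_symm_apply {P : TangentBundle (𝓡∂ n) M₁} (hP : P.proj ∈ φ.source) :
    tangentMap (𝓡∂ n) (𝓡∂ n) φ.symm (tangentMap (𝓡∂ n) (𝓡∂ n) φ P) = P := by
  have h1 : MDifferentiableAt (𝓡∂ n) (𝓡∂ n) φ P.proj := φ.mdifferentiableAt (by simp) hP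
  have h2 : MDifferentiableAt (𝓡∂ n) (𝓡∂ n) φ.symm (φ P.proj) :=
    φ.symm.mdifferentiableAt (by simp) (φ.map_source hP)
  rw [← tangentMap_comp_at P h2 h1]
  have hev : (φ.symm ∘ φ : M₁ → M₁) =ᶠ[𝓝 P.proj] id := by
    filter_upwards [φ.open_source.mem_nhds hP] with x hx
    exact φ.left_inv hx
  refine TotalSpace.ext (φ.left_inv hP) ?_
  simp only [tangentMap]
  rw [hev.mfderiv_eq, mfderiv_id]
  exact HEq.rfl

/-- The tangent map of `φ.symm` is a left inverse, so the derivative is injective; both sides have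
the same finite dimension. -/
theorem fderivWithin_coordMap_surjective {q₁ : M₁} {q₂ : M₂} {y : Coord n}
    (hy : y ∈ coordDomain φ q₁ q₂) :
    Function.Surjective (fderivWithin ℝ (coordMap φ q₁ q₂) (range (𝓡∂ n)) y) := by
  have hs : ∀ u, (ofCoord q₁ (y, u)).proj ∈ (chartAt (EuclideanHalfSpace n) q₁).source :=
    fun u ↦ ofCoord_proj_mem (z := (y, u)) hy.1
  have hc : ∀ u, coord q₁ (ofCoord q₁ (y, u)) = (y, u) := fun u ↦ coord_ofCoord (z := (y, u)) hy.1
  have ht : ∀ u, coord q₂ (tangentMap (𝓡∂ n) (𝓡∂ n) φ (ofCoord q₁ (y, u))) =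
      (coordMap φ q₁ q₂ y, fderivWithin ℝ (coordMap φ q₁ q₂) (range (𝓡∂ n)) y u) := fun u ↦ by
    rw [coord_tangentMap φ (hs u) hy.2.1 hy.2.2, hc]
  refine LinearMap.surjective_of_injective (f :=
    (fderivWithin ℝ (coordMap φ q₁ q₂) (range (𝓡∂ n)) y).toLinearMap) fun u w huw ↦ ?_
  have huw' : fderivWithin ℝ (coordMap φ q₁ q₂) (range (𝓡∂ n)) y u =
    fderivWithin ℝ (coordMap φ q₁ q₂) (range (𝓡∂ n)) y w := huw
  have h1 : tangentMap (𝓡∂ n) (𝓡∂ n) φ (ofCoord q₁ (y, u)) =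
      tangentMap (𝓡∂ n) (𝓡∂ n) φ (ofCoord q₁ (y, w)) :=
    coord_injOn (q := q₂) hy.2.2 hy.2.2 (by rw [ht, ht, huw'])
  have h2 := congrArg (tangentMap (𝓡∂ n) (𝓡∂ n) φ.symm) h1
  rw [tangentMap_symm_apply hy.2.1, tangentMap_symm_apply hy.2.1] at h2
  have := congrArg (coord q₁) h2
  rw [hc, hc] at this
  exact congrArg Prod.snd this

end

/-! ### The geodesic equation in arbitrary charts -/

theorem two_le_infty : (2 : WithTop ℕ∞) ≤ ∞ :=
  WithTop.coe_le_coe.2 (le_top (a := (2 : ℕ∞)))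

theorem hasDerivWithinAt_fst {V W : Type*} [NormedAddCommGroup V] [NormedSpace ℝ V]
    [NormedAddCommGroup W] [NormedSpace ℝ W] {f : ℝ → V × W} {f' : V × W} {S : Set ℝ} {t : ℝ}
    (h : HasDerivWithinAt f f' S t) : HasDerivWithinAt (fun s ↦ (f s).1) f'.1 S t :=
  (ContinuousLinearMap.fst ℝ V W).hasFDerivAt.comp_hasDerivWithinAt t h

theorem hasDerivWithinAt_snd {V W : Type*} [NormedAddCommGroup V] [NormedSpace ℝ V]
    [NormedAddCommGroup W] [NormedSpace ℝ W] {f : ℝ → V × W} {f' : V × W} {S : Set ℝ} {t : ℝ}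
    (h : HasDerivWithinAt f f' S t) : HasDerivWithinAt (fun s ↦ (f s).2) f'.2 S t :=
  (ContinuousLinearMap.snd ℝ V W).hasFDerivAt.comp_hasDerivWithinAt t h

section

variable {n : ℕ} [NeZero n] {M : Type*} [TopologicalSpace M]
  [ChartedSpace (EuclideanHalfSpace n) M] [IsManifold (𝓡∂ n) ∞ M]
  (g : LorentzMetric n M)

/-- The geodesic spray in the coordinates of the chart at `q`. -/
def sprayIn (q : M) : Coord n × Coord n → Coord n × Coord n :=
  spray (metricIn g q) (range (𝓡∂ n))

/-- The curve `c` in `TM` satisfies the geodesic equation at time `t₀`, within the set of times `S`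
and in the coordinates of the chart at `q`. -/
def GeodesicAt (c : ℝ → TangentBundle (𝓡∂ n) M) (S : Set ℝ) (q : M) (t₀ : ℝ) : Prop :=
  HasDerivWithinAt (fun t ↦ coord q (c t)) (sprayIn g q (coord q (c t₀))) S t₀

variable {g}

theorem uniqueDiffOn_range : UniqueDiffOn ℝ (range (𝓡∂ n)) := (𝓡∂ n).uniqueDiffOn

theorem sprayIn_eq_iff {q : M} {y v a : Coord n} (hy : y ∈ (extChartAt (𝓡∂ n) q).target) :
    GeodesicEq (metricIn g q) (range (𝓡∂ n)) y v a ↔ sprayIn g q (y, v) = (v, a) := by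
  rw [geodesicEq_iff (metricIn_isInvertible g hy), sprayIn]
  constructor
  · rintro rfl; rfl
  · intro h; rw [h]

/-- On the diagonal the first two terms of the symbol coincide. The rest is that differentiating a
component of the metric is the same as evaluating the derivative of the metric. -/
theorem christoffel_eq (q : M) (v w : Coord n) :
    g.christoffel q v v w =
      fderivWithin ℝ (metricIn g q) (range (𝓡∂ n)) (extChartAt (𝓡∂ n) q q) v v w -
      1 / 2 * fderivWithin ℝ (metricIn g q) (range (𝓡∂ n)) (extChartAt (𝓡∂ n) q q) w v v := by
  have key : ∀ a b c : Coord n,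
      fderivWithin ℝ (g.coordMetric q b c) (range (𝓡∂ n)) (extChartAt (𝓡∂ n) q q) a =
      fderivWithin ℝ (metricIn g q) (range (𝓡∂ n)) (extChartAt (𝓡∂ n) q q) a b c := by
    intro a b c
    have hd : HasFDerivWithinAt (metricIn g q)
        (fderivWithin ℝ (metricIn g q) (range (𝓡∂ n)) (extChartAt (𝓡∂ n) q q)) (range (𝓡∂ n))
        (extChartAt (𝓡∂ n) q q) :=
      ((contDiffWithinAt_metricIn g (mem_extChartAt_target q)).differentiableWithinAt
        (by simp)).hasFDerivWithinAt
    have h2 := (hd.clm_apply (hasFDerivWithinAt_const b _ _)).clm_apply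
      (hasFDerivWithinAt_const c _ _)
    have h3 := h2.fderivWithin (uniqueDiffOn_range _ (mem_range_self _))
    have h4 : g.coordMetric q b c = fun y ↦ metricIn g q y b c := rfl
    rw [h4, h3]
    simp
  simp only [LorentzMetric.christoffel, key]
  ring

/-- The existentially quantified acceleration is forced to be that of the spray, so the two
equations merge into one ODE for `coord`, accessible to Picard-Lindelöf and Grönwall. -/
theorem isGeodesicOn_iff {c : ℝ → TangentBundle (𝓡∂ n) M} {T : ℝ} :
    g.IsGeodesicOn c T ↔ ContinuousOn c (Icc 0 T) ∧
      ∀ t₀ ∈ Icc 0 T, GeodesicAt g c (Icc 0 T) (c t₀).proj t₀ := by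
  refine and_congr_right fun _ ↦ forall₂_congr fun t₀ _ ↦ ?_
  set q := (c t₀).proj
  have hy : (coord q (c t₀)).1 ∈ (extChartAt (𝓡∂ n) q).target :=
    coord_fst_mem_target (mem_chart_source _ _)
  have hEq : ∀ a, (∀ w, g.coordMetric q a w (coord q (c t₀)).1 +
      g.christoffel q (coord q (c t₀)).2 (coord q (c t₀)).2 w = 0) ↔
      sprayIn g q (coord q (c t₀)) = ((coord q (c t₀)).2, a) := fun a ↦ by
    have h := sprayIn_eq_iff (g := g) (v := (coord q (c t₀)).2) (a := a) hy
    rw [Prod.mk.eta] at h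
    rw [← h, GeodesicEq]
    refine forall_congr' fun w ↦ ?_
    rw [christoffel_eq, coordMetric_eq]
    rfl
  constructor
  · rintro ⟨hx, a, hv, ha⟩
    have h := hx.prodMk hv
    unfold GeodesicAt
    rw [(hEq a).1 ha]
    exact h
  · intro h
    have h1 : sprayIn g q (coord q (c t₀)) =
        ((coord q (c t₀)).2, (sprayIn g q (coord q (c t₀))).2) := rfl
    refine ⟨?_, (sprayIn g q (coord q (c t₀))).2, ?_, (hEq _).2 h1⟩
    · exact hasDerivWithinAt_fst h
    · exact hasDerivWithinAt_snd h

end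

/-! ### Invariance of the geodesic equation under local isometries -/

section

variable {n : ℕ} [NeZero n] {M₁ : Type*} [TopologicalSpace M₁]
  [ChartedSpace (EuclideanHalfSpace n) M₁] [IsManifold (𝓡∂ n) ∞ M₁]
  {M₂ : Type*} [TopologicalSpace M₂]
  [ChartedSpace (EuclideanHalfSpace n) M₂] [IsManifold (𝓡∂ n) ∞ M₂]
  {g₁ : LorentzMetric n M₁} {g₂ : LorentzMetric n M₂}
  {φ : PartialDiffeomorph (𝓡∂ n) (𝓡∂ n) M₁ M₂ ∞}

/-- Local isometries preserve the geodesic equation. -/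
theorem GeodesicAt.map (hφ : IsometricOn g₁ g₂ φ) {c : ℝ → TangentBundle (𝓡∂ n) M₁} {S : Set ℝ}
    {t₀ : ℝ} {q₁ : M₁} {q₂ : M₂} (hc : ContinuousWithinAt c S t₀)
    (h : GeodesicAt g₁ c S q₁ t₀) (h1 : (c t₀).proj ∈ (chartAt (EuclideanHalfSpace n) q₁).source)
    (h2 : (c t₀).proj ∈ φ.source)
    (h3 : φ (c t₀).proj ∈ (chartAt (EuclideanHalfSpace n) q₂).source) :
    GeodesicAt g₂ (fun t ↦ tangentMap (𝓡∂ n) (𝓡∂ n) φ (c t)) S q₂ t₀ := by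
  set H := range (𝓡∂ n) with hH
  set Ψ : Coord n → Coord n := coordMap φ q₁ q₂ with hΨdef
  set y := (coord q₁ (c t₀)).1 with hy
  set v := (coord q₁ (c t₀)).2 with hv
  set a := (sprayIn g₁ q₁ (coord q₁ (c t₀))).2 with ha
  have hdom : y ∈ coordDomain φ q₁ q₂ := coordDomain_mem φ h1 h2 h3
  have hyH : y ∈ H := coord_fst_mem_range _ _
  have hΨ : ContDiffWithinAt ℝ 2 Ψ H y :=
    (contDiffWithinAt_coordMap φ hdom).of_le two_le_infty
  have hx : HasDerivWithinAt (fun t ↦ (coord q₁ (c t)).1) v S t₀ :=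
    hasDerivWithinAt_fst h
  have hvd : HasDerivWithinAt (fun t ↦ (coord q₁ (c t)).2) a S t₀ :=
    hasDerivWithinAt_snd h
  have hmaps : MapsTo (fun t ↦ (coord q₁ (c t)).1) S H := fun t _ ↦ coord_fst_mem_range _ _
  have hDx : HasDerivWithinAt (fun t ↦ Ψ (coord q₁ (c t)).1) (fderivWithin ℝ Ψ H y v) S t₀ :=
    HasFDerivWithinAt.comp_hasDerivWithinAt (f := fun t ↦ (coord q₁ (c t)).1) t₀
      (hΨ.differentiableWithinAt (by norm_num)).hasFDerivWithinAt hx hmaps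
  have hD2 : HasDerivWithinAt (fun t ↦ fderivWithin ℝ Ψ H (coord q₁ (c t)).1)
      (fderivWithin ℝ (fderivWithin ℝ Ψ H) H y v) S t₀ :=
    HasFDerivWithinAt.comp_hasDerivWithinAt (f := fun t ↦ (coord q₁ (c t)).1) t₀
      ((hΨ.fderivWithin_right (m := 1) uniqueDiffOn_range (by norm_num)
        hyH).differentiableWithinAt (by norm_num)).hasFDerivWithinAt hx hmaps
  have hDv := hD2.clm_apply hvd
  have hEq : GeodesicEq (metricIn g₁ q₁) H y v a := (sprayIn_eq_iff hdom.1).2 rfl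
  have hdom₂ : Ψ y ∈ (extChartAt (𝓡∂ n) q₂).target :=
    (extChartAt (𝓡∂ n) q₂).map_source (by rw [extChartAt_source]; exact hdom.2.2)
  have hEq₂ := hEq.map (G₂ := metricIn g₂ q₂) uniqueDiffOn_range hyH
    (range_subset_closure_interior hyH) hΨ (Eventually.of_forall fun x ↦ coordMap_mem_range _ _)
    ((contDiffWithinAt_metricIn g₁ hdom.1).differentiableWithinAt (by simp))
    ((contDiffWithinAt_metricIn g₂ hdom₂).differentiableWithinAt (by simp))
    ((eventually_coordDomain φ hdom).mono fun x hx u w ↦ hφ.metricIn hx u w)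
    (metricIn_symm g₂ q₂ _) (fderivWithin_coordMap_surjective hdom)
  rw [sprayIn_eq_iff hdom₂] at hEq₂
  have hder := hDx.prodMk hDv
  rw [← hEq₂] at hder
  have hcoord : ∀ t, (c t).proj ∈ (chartAt (EuclideanHalfSpace n) q₁).source →
      (c t).proj ∈ φ.source → φ (c t).proj ∈ (chartAt (EuclideanHalfSpace n) q₂).source →
      coord q₂ (tangentMap (𝓡∂ n) (𝓡∂ n) φ (c t)) =
      (Ψ (coord q₁ (c t)).1, fderivWithin ℝ Ψ H (coord q₁ (c t)).1 (coord q₁ (c t)).2) :=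
    fun t a1 a2 a3 ↦ coord_tangentMap φ a1 a2 a3
  unfold GeodesicAt
  rw [hcoord t₀ h1 h2 h3]
  have hproj : ContinuousWithinAt (fun t ↦ (c t).proj) S t₀ :=
    (FiberBundle.continuous_proj (Coord n) (TangentSpace (𝓡∂ n))).continuousAt.comp_continuousWithinAt
      hc
  have hφc : ContinuousWithinAt (fun t ↦ φ (c t).proj) S t₀ :=
    ContinuousAt.comp_continuousWithinAt (f := fun t ↦ (c t).proj)
      (φ.contMDiffOn.contMDiffAt (φ.open_source.mem_nhds h2)).continuousAt hproj
  refine hder.congr_of_eventuallyEq ?_ (hcoord t₀ h1 h2 h3)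
  filter_upwards [hproj.eventually ((chartAt (EuclideanHalfSpace n) q₁).open_source.mem_nhds h1),
    hproj.eventually (φ.open_source.mem_nhds h2),
    hφc.eventually ((chartAt (EuclideanHalfSpace n) q₂).open_source.mem_nhds h3)] with t a1 a2 a3
  exact hcoord t a1 a2 a3

end

/-! ### Change of chart, and restriction, shift, reversal and concatenation of geodesics -/

section

variable {n : ℕ} [NeZero n] {M : Type*} [TopologicalSpace M]
  [ChartedSpace (EuclideanHalfSpace n) M] [IsManifold (𝓡∂ n) ∞ M]

/-- The identity, as a partial diffeomorphism. -/
def idDiffeo (n : ℕ) [NeZero n] (M : Type*) [TopologicalSpace M]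
    [ChartedSpace (EuclideanHalfSpace n) M] :
    PartialDiffeomorph (𝓡∂ n) (𝓡∂ n) M M ∞ :=
  (Diffeomorph.refl (𝓡∂ n) M ∞).toPartialDiffeomorph

theorem idDiffeo_coe : ((idDiffeo n M).toPartialEquiv : M → M) = id := rfl

theorem isometricOn_id (g : LorentzMetric n M) : IsometricOn g g (idDiffeo n M) := by
  intro x _ v w
  have h : mfderiv (𝓡∂ n) (𝓡∂ n) (idDiffeo n M).toPartialEquiv x =
    ContinuousLinearMap.id ℝ (TangentSpace (𝓡∂ n) x) := mfderiv_id
  have h2 : ∀ v : TangentSpace (𝓡∂ n) x,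
    mfderiv (𝓡∂ n) (𝓡∂ n) (idDiffeo n M).toPartialEquiv x v = v := fun v ↦
    DFunLike.congr_fun h v
  rw [h2, h2]
  rfl

theorem tangentMap_idDiffeo (P : TangentBundle (𝓡∂ n) M) :
    tangentMap (𝓡∂ n) (𝓡∂ n) (idDiffeo n M).toPartialEquiv P = P := by
  rw [idDiffeo_coe, tangentMap_id]
  rfl

variable {g : LorentzMetric n M}

/-- A change of chart is the identity isometry read in two different charts, so no separate
computation is needed. -/
theorem GeodesicAt.change_chart {c : ℝ → TangentBundle (𝓡∂ n) M} {S : Set ℝ}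
    {t₀ : ℝ} {q₁ q₂ : M} (hc : ContinuousWithinAt c S t₀)
    (h : GeodesicAt g c S q₁ t₀) (h1 : (c t₀).proj ∈ (chartAt (EuclideanHalfSpace n) q₁).source)
    (h2 : (c t₀).proj ∈ (chartAt (EuclideanHalfSpace n) q₂).source) :
    GeodesicAt g c S q₂ t₀ := by
  have := h.map (isometricOn_id g) (q₂ := q₂) hc h1 (mem_univ _) h2
  simpa only [tangentMap_idDiffeo] using this

theorem LorentzMetric.IsGeodesicOn.geodesicAt {c : ℝ → TangentBundle (𝓡∂ n) M} {T : ℝ} (h : g.IsGeodesicOn c T)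
    {t₀ : ℝ} (ht₀ : t₀ ∈ Icc 0 T) {q : M}
    (hq : (c t₀).proj ∈ (chartAt (EuclideanHalfSpace n) q).source) :
    GeodesicAt g c (Icc 0 T) q t₀ := by
  rw [isGeodesicOn_iff] at h
  exact (h.2 t₀ ht₀).change_chart (h.1 t₀ ht₀) (mem_chart_source _ _) hq

theorem isGeodesicOn_of_geodesicAt {c : ℝ → TangentBundle (𝓡∂ n) M} {T : ℝ}
    (hc : ContinuousOn c (Icc 0 T)) (h : ∀ t₀ ∈ Icc 0 T, ∃ q,
      (c t₀).proj ∈ (chartAt (EuclideanHalfSpace n) q).source ∧ GeodesicAt g c (Icc 0 T) q t₀) :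
    g.IsGeodesicOn c T := by
  rw [isGeodesicOn_iff]
  refine ⟨hc, fun t₀ ht₀ ↦ ?_⟩
  obtain ⟨q, hq, hd⟩ := h t₀ ht₀
  exact hd.change_chart (hc t₀ ht₀) hq (mem_chart_source _ _)

theorem LorentzMetric.IsGeodesicOn.mono {c : ℝ → TangentBundle (𝓡∂ n) M} {T T' : ℝ}
    (h : g.IsGeodesicOn c T) (hT : T' ≤ T) : g.IsGeodesicOn c T' := by
  have hsub : Icc 0 T' ⊆ Icc 0 T := Icc_subset_Icc_right hT
  refine isGeodesicOn_of_geodesicAt (h.1.mono hsub) fun t₀ ht₀ ↦ ⟨_, mem_chart_source _ _, ?_⟩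
  exact HasDerivWithinAt.mono (h.geodesicAt (hsub ht₀) (mem_chart_source _ _)) hsub

theorem LorentzMetric.IsGeodesicOn.congr {c c' : ℝ → TangentBundle (𝓡∂ n) M} {T : ℝ}
    (h : g.IsGeodesicOn c T) (hc : EqOn c' c (Icc 0 T)) : g.IsGeodesicOn c' T := by
  refine isGeodesicOn_of_geodesicAt (h.1.congr hc) fun t₀ ht₀ ↦
    ⟨_, mem_chart_source _ (c' t₀).proj, ?_⟩
  have h1 := h.geodesicAt ht₀ (q := (c' t₀).proj)
    (by rw [hc ht₀]; exact mem_chart_source _ _)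
  unfold GeodesicAt at h1 ⊢
  rw [← hc ht₀] at h1
  exact h1.congr (fun t ht ↦ by rw [hc ht]) (by rw [hc ht₀])

/-- Geodesics can be shifted in time. -/
theorem LorentzMetric.IsGeodesicOn.shift {c : ℝ → TangentBundle (𝓡∂ n) M} {T a : ℝ}
    (h : g.IsGeodesicOn c T) (ha : 0 ≤ a) : g.IsGeodesicOn (fun t ↦ c (t + a)) (T - a) := by
  have hmaps : MapsTo (fun t ↦ t + a) (Icc 0 (T - a)) (Icc 0 T) :=
    fun t ht ↦ ⟨by linarith [ht.1], by linarith [ht.2]⟩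
  refine isGeodesicOn_of_geodesicAt (h.1.comp (by fun_prop) hmaps)
    fun t₀ ht₀ ↦ ⟨_, mem_chart_source _ _, ?_⟩
  have h1 := h.geodesicAt (hmaps ht₀) (mem_chart_source _ _)
  have h2 : HasDerivWithinAt (fun t ↦ t + a) 1 (Icc 0 (T - a)) t₀ :=
    (hasDerivWithinAt_id _ _).add_const a
  unfold GeodesicAt at h1
  have := HasDerivWithinAt.scomp t₀ h1 h2 hmaps
  simpa [GeodesicAt, Function.comp_def] using this

/-- The Christoffel term is quadratic in the velocity, so the acceleration does not see the sign.
This is why geodesics are reversible. -/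
theorem sprayIn_neg {q : M} {z : Coord n × Coord n}
    (hz : z.1 ∈ (extChartAt (𝓡∂ n) q).target) :
    sprayIn g q (z.1, -z.2) = (-(sprayIn g q z).1, (sprayIn g q z).2) := by
  have h : GeodesicEq (metricIn g q) (range (𝓡∂ n)) z.1 z.2 (sprayIn g q z).2 :=
    (sprayIn_eq_iff hz).2 rfl
  refine (sprayIn_eq_iff hz).1 fun w ↦ ?_
  have := h w
  change _ + (fderivWithin ℝ (metricIn g q) (range (𝓡∂ n)) z.1 (-z.2) (-z.2) w -
    1 / 2 * fderivWithin ℝ (metricIn g q) (range (𝓡∂ n)) z.1 w (-z.2) (-z.2)) = 0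
  simpa using this

theorem coord_reverse {q : M} {P : TangentBundle (𝓡∂ n) M}
    (hP : P.proj ∈ (chartAt (EuclideanHalfSpace n) q).source) :
    coord q (scale (-1) P) = ((coord q P).1, -(coord q P).2) := by
  rw [coord_scale _ hP, neg_one_smul]

theorem scale_neg_one_scale (P : TangentBundle (𝓡∂ n) M) : scale (-1) (scale (-1) P) = P := by
  have : (-1 : ℝ) • (-1 : ℝ) • P.snd = P.snd := by simp
  exact congrArg (TotalSpace.mk P.proj) this

theorem tendsto_reverse (P : TangentBundle (𝓡∂ n) M) :
    Tendsto (scale (-1)) (𝓝 P) (𝓝 (scale (-1) P)) := by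
  have hP : P.proj ∈ (chartAt (EuclideanHalfSpace n) P.proj).source := mem_chart_source _ _
  refine tendsto_of_coord (q := P.proj) (P := scale (-1) P) hP (eventually_proj_mem hP) ?_
  rw [coord_reverse hP]
  have h := (continuousAt_coord hP).tendsto
  have h2 : Tendsto (fun P' ↦ ((coord P.proj P').1, -(coord P.proj P').2)) (𝓝 P)
    (𝓝 ((coord P.proj P).1, -(coord P.proj P).2)) :=
    ((continuous_fst.tendsto _).comp h).prodMk_nhds (((continuous_snd.tendsto _).comp h).neg)
  refine h2.congr' ?_
  filter_upwards [eventually_proj_mem hP] with P' hP'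
  rw [coord_reverse hP']

theorem continuous_reverse : Continuous (scale (-1) : TangentBundle (𝓡∂ n) M → _) :=
  continuous_iff_continuousAt.2 tendsto_reverse

/-- Geodesics can be run backwards. -/
theorem LorentzMetric.IsGeodesicOn.reverse {c : ℝ → TangentBundle (𝓡∂ n) M} {T : ℝ}
    (h : g.IsGeodesicOn c T) : g.IsGeodesicOn (fun t ↦ scale (-1) (c (T - t))) T := by
  have hmaps : MapsTo (fun t ↦ T - t) (Icc 0 T) (Icc 0 T) :=
    fun t ht ↦ ⟨by linarith [ht.2], by linarith [ht.1]⟩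
  have hcc : ContinuousOn (fun t ↦ c (T - t)) (Icc 0 T) := h.1.comp (by fun_prop) hmaps
  refine isGeodesicOn_of_geodesicAt (continuous_reverse.comp_continuousOn hcc)
    fun t₀ ht₀ ↦ ⟨(c (T - t₀)).proj, mem_chart_source _ _, ?_⟩
  set q := (c (T - t₀)).proj
  have hq : (c (T - t₀)).proj ∈ (chartAt (EuclideanHalfSpace n) q).source := mem_chart_source _ _
  have h1 := h.geodesicAt (hmaps ht₀) hq
  have h2 : HasDerivWithinAt (fun t ↦ T - t) (-1) (Icc 0 T) t₀ := by
    simpa using (hasDerivWithinAt_id t₀ (Icc 0 T)).const_sub T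
  have h3 := HasDerivWithinAt.scomp t₀ h1 h2 hmaps
  have hx := hasDerivWithinAt_fst h3
  have hv := (hasDerivWithinAt_snd h3).neg
  have h4 := hx.prodMk hv
  unfold GeodesicAt
  rw [coord_reverse hq, sprayIn_neg (coord_fst_mem_target hq)]
  refine (h4.congr_of_eventuallyEq ?_ ?_).congr_deriv ?_
  · filter_upwards [(hcc t₀ ht₀).eventually (eventually_proj_mem hq)] with t ht
    rw [coord_reverse ht]
    rfl
  · rw [coord_reverse hq]
    rfl
  · simp

/-- Geodesics can be concatenated. -/
theorem LorentzMetric.IsGeodesicOn.concat {c₁ c₂ : ℝ → TangentBundle (𝓡∂ n) M} {T₁ T₂ : ℝ}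
    (h₁ : g.IsGeodesicOn c₁ T₁) (h₂ : g.IsGeodesicOn c₂ T₂) (hT₁ : 0 ≤ T₁) (hT₂ : 0 ≤ T₂)
    (h : c₁ T₁ = c₂ 0) :
    g.IsGeodesicOn (fun t ↦ if t ≤ T₁ then c₁ t else c₂ (t - T₁)) (T₁ + T₂) := by
  set c : ℝ → TangentBundle (𝓡∂ n) M := fun t ↦ if t ≤ T₁ then c₁ t else c₂ (t - T₁) with hc
  have e1 : EqOn c c₁ (Icc 0 T₁) := fun t ht ↦ if_pos ht.2
  have e2 : EqOn c (fun t ↦ c₂ (t - T₁)) (Icc T₁ (T₁ + T₂)) := fun t ht ↦ by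
    rcases ht.1.eq_or_lt with h' | h'
    · simp [hc, ← h', h]
    · simp [hc, not_le.2 h']
  have hU : Icc 0 (T₁ + T₂) = Icc 0 T₁ ∪ Icc T₁ (T₁ + T₂) :=
    (Icc_union_Icc_eq_Icc hT₁ (by linarith)).symm
  have hmaps : MapsTo (fun t ↦ t - T₁) (Icc T₁ (T₁ + T₂)) (Icc 0 T₂) :=
    fun t ht ↦ ⟨by linarith [ht.1], by linarith [ht.2]⟩
  have hcont₂ : ContinuousOn c (Icc T₁ (T₁ + T₂)) :=
    ContinuousOn.congr (h₂.1.comp (by fun_prop) hmaps) e2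
  have hcont₁ : ContinuousOn c (Icc 0 T₁) := h₁.1.congr e1
  refine isGeodesicOn_of_geodesicAt ?_ fun t₀ ht₀ ↦ ⟨(c t₀).proj, mem_chart_source _ _, ?_⟩
  · rw [hU]
    exact hcont₁.union_of_isClosed hcont₂ isClosed_Icc isClosed_Icc
  · unfold GeodesicAt
    rw [hU]
    refine HasDerivWithinAt.union ?_ ?_
    · by_cases hmem : t₀ ∈ Icc 0 T₁
      · have h' := (h₁.congr e1).geodesicAt hmem (mem_chart_source _ (c t₀).proj)
        exact h'
      · exact HasFDerivWithinAt.of_notMem_closure (by rwa [isClosed_Icc.closure_eq])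
    · by_cases hmem : t₀ ∈ Icc T₁ (T₁ + T₂)
      · have h' := h₂.geodesicAt (hmaps hmem) (q := (c t₀).proj)
          (by rw [e2 hmem]; exact mem_chart_source _ _)
        have hd : HasDerivWithinAt (fun t ↦ t - T₁) 1 (Icc T₁ (T₁ + T₂)) t₀ :=
          (hasDerivWithinAt_id _ _).sub_const T₁
        unfold GeodesicAt at h'
        have h3 := HasDerivWithinAt.scomp t₀ h' hd hmaps
        rw [one_smul] at h3
        have h4 : sprayIn g (c t₀).proj (coord (c t₀).proj (c t₀)) =
          sprayIn g (c t₀).proj (coord (c t₀).proj (c₂ (t₀ - T₁))) := by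
          congr 2; exact e2 hmem
        rw [h4]
        refine h3.congr_of_mem (fun t ht ↦ ?_) hmem
        simp only [Function.comp_apply, e2 ht]
      · exact HasFDerivWithinAt.of_notMem_closure (by rwa [isClosed_Icc.closure_eq])

/-- Within a one-point set of times every derivative condition is vacuous. Hence 0 is always a stay
time, even for vectors that point out of the manifold. -/
theorem isGeodesicOn_zero (P : TangentBundle (𝓡∂ n) M) : g.IsGeodesicOn (fun _ ↦ P) 0 := by
  refine isGeodesicOn_of_geodesicAt continuousOn_const fun t₀ ht₀ ↦ ⟨_, mem_chart_source _ P.proj, ?_⟩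
  have : t₀ = 0 := le_antisymm ht₀.2 ht₀.1
  subst this
  rw [Icc_self]
  unfold GeodesicAt
  exact HasFDerivWithinAt.of_subsingleton subsingleton_singleton

end

/-! ### Geodesics under local isometries -/

section

variable {n : ℕ} [NeZero n] {M₁ : Type*} [TopologicalSpace M₁]
  [ChartedSpace (EuclideanHalfSpace n) M₁] [IsManifold (𝓡∂ n) ∞ M₁]
  {M₂ : Type*} [TopologicalSpace M₂]
  [ChartedSpace (EuclideanHalfSpace n) M₂] [IsManifold (𝓡∂ n) ∞ M₂]
  {g₁ : LorentzMetric n M₁} {g₂ : LorentzMetric n M₂}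
  {φ : PartialDiffeomorph (𝓡∂ n) (𝓡∂ n) M₁ M₂ ∞}

theorem tendsto_tangentMap {P : TangentBundle (𝓡∂ n) M₁} (hP : P.proj ∈ φ.source) :
    ContinuousAt (tangentMap (𝓡∂ n) (𝓡∂ n) φ) P := by
  have h1 : P.proj ∈ (chartAt (EuclideanHalfSpace n) P.proj).source := mem_chart_source _ _
  have h3 : φ P.proj ∈ (chartAt (EuclideanHalfSpace n) (φ P.proj)).source := mem_chart_source _ _
  have hproj : Tendsto (fun P : TangentBundle (𝓡∂ n) M₁ ↦ P.proj) (𝓝 P) (𝓝 P.proj) :=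
    (FiberBundle.continuous_proj (Coord n) (TangentSpace (𝓡∂ n))).continuousAt
  have e2 := hproj.eventually (φ.open_source.mem_nhds hP)
  have e3 := ((φ.contMDiffOn.contMDiffAt
    (φ.open_source.mem_nhds hP)).continuousAt.tendsto.comp hproj).eventually
    ((chartAt (EuclideanHalfSpace n) (φ P.proj)).open_source.mem_nhds h3)
  refine tendsto_of_coord (q := φ P.proj) h3 e3 ?_
  have hdom := coordDomain_mem φ h1 hP h3
  have hΨ := contDiffWithinAt_coordMap φ hdom
  have ht := (continuousAt_coord h1).tendsto
  have hfst : Tendsto (fun P' ↦ (coord P.proj P').1) (𝓝 P) (𝓝[range (𝓡∂ n)] (coord P.proj P).1) :=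
    tendsto_nhdsWithin_iff.2 ⟨(continuous_fst.tendsto _).comp ht,
      Eventually.of_forall fun _ ↦ coord_fst_mem_range _ _⟩
  have hD : ContinuousWithinAt (fderivWithin ℝ (coordMap φ P.proj (φ P.proj)) (range (𝓡∂ n)))
      (range (𝓡∂ n)) (coord P.proj P).1 :=
    (hΨ.fderivWithin_right (m := 0) uniqueDiffOn_range (by simp)
      (coord_fst_mem_range _ _)).continuousWithinAt
  have key := (hΨ.continuousWithinAt.tendsto.comp hfst).prodMk_nhds
    ((isBoundedBilinearMap_apply.continuous.tendsto _).comp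
      ((hD.tendsto.comp hfst).prodMk_nhds ((continuous_snd.tendsto _).comp ht)))
  rw [coord_tangentMap φ h1 hP h3]
  refine key.congr' ?_
  filter_upwards [eventually_proj_mem h1, e2, e3] with P' a1 a2 a3
  rw [coord_tangentMap φ a1 a2 a3]
  rfl

/-- Local isometries map geodesics to geodesics. -/
theorem LorentzMetric.IsGeodesicOn.map (hφ : IsometricOn g₁ g₂ φ) {c : ℝ → TangentBundle (𝓡∂ n) M₁} {T : ℝ}
    (h : g₁.IsGeodesicOn c T) (hc : ∀ t ∈ Icc 0 T, (c t).proj ∈ φ.source) :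
    g₂.IsGeodesicOn (fun t ↦ tangentMap (𝓡∂ n) (𝓡∂ n) φ (c t)) T := by
  refine isGeodesicOn_of_geodesicAt (fun t ht ↦
    (tendsto_tangentMap (hc t ht)).comp_continuousWithinAt (h.1 t ht)) fun t₀ ht₀ ↦
    ⟨_, mem_chart_source _ (φ (c t₀).proj), ?_⟩
  exact (h.geodesicAt ht₀ (mem_chart_source _ _)).map hφ (h.1 t₀ ht₀)
    (mem_chart_source _ _) (hc t₀ ht₀) (mem_chart_source _ _)

end

/-! ### Local existence and uniqueness of geodesics -/

section

variable {n : ℕ} [NeZero n] {M : Type*} [TopologicalSpace M]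
  [ChartedSpace (EuclideanHalfSpace n) M] [IsManifold (𝓡∂ n) ∞ M]

/-- A Lipschitz extension of the geodesic spray near the coordinates `z₀`, with local solutions. -/
structure LocalFlow (g : LorentzMetric n M) (q : M) (z₀ : Coord n × Coord n) where
  F : Coord n × Coord n → Coord n × Coord n
  K : ℝ≥0
  r : ℝ
  ε : ℝ
  lip : LipschitzWith K F
  fst_eq : ∀ z, (F z).1 = z.2
  r_pos : 0 < r
  ε_pos : 0 < ε
  mem_target : ∀ z ∈ Metric.ball z₀ r, z.1 ∈ range (𝓡∂ n) → z.1 ∈ (extChartAt (𝓡∂ n) q).target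
  eq_spray : ∀ z ∈ Metric.ball z₀ r, z.1 ∈ range (𝓡∂ n) → F z = sprayIn g q z
  exists_sol : ∀ x ∈ Metric.ball z₀ (r / 2), ∃ z : ℝ → Coord n × Coord n, z 0 = x ∧
      ∀ t ∈ Icc 0 ε, HasDerivWithinAt z (F (z t)) (Icc 0 ε) t ∧ z t ∈ Metric.ball z₀ r

theorem exists_localFlow (g : LorentzMetric n M) {q : M} {z₀ : Coord n × Coord n}
    (hz₀ : z₀.1 ∈ (extChartAt (𝓡∂ n) q).target) {R : ℝ} (hR : 0 < R) :
    ∃ L : LocalFlow g q z₀, L.r ≤ R := by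
  have hrange : z₀.1 ∈ range (𝓡∂ n) := extChartAt_target_subset_range q hz₀
  have hsmooth : ContDiffWithinAt ℝ 1 (sprayIn g q) (range (𝓡∂ n) ×ˢ univ) z₀ :=
    contDiffWithinAt_spray ((contDiffWithinAt_metricIn g hz₀).of_le two_le_infty)
      uniqueDiffOn_range hrange (metricIn_isInvertible g hz₀)
  obtain ⟨K, t, ht, hK⟩ := hsmooth.exists_lipschitzOnWith (range_convex.prod convex_univ)
  obtain ⟨F₀, hF₀, hF₀eq⟩ := hK.extend_finite_dimension
  -- Only the acceleration is taken from the Lipschitz extension. The first component remains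
  -- exactly the velocity, so x' = v also holds for solutions that leave the half space.
  set F : Coord n × Coord n → Coord n × Coord n := fun z ↦ (z.2, (F₀ z).2)
  have hF := LipschitzWith.prod_snd.prodMk (LipschitzWith.prod_snd.comp hF₀)
  have hFeq : EqOn (sprayIn g q) F t := fun z hz ↦ by
    refine Prod.ext rfl ?_
    rw [hF₀eq hz]
  have htarget : ∀ᶠ z in 𝓝[range (𝓡∂ n) ×ˢ univ] z₀, z.1 ∈ (extChartAt (𝓡∂ n) q).target := by
    have h1 : Tendsto (Prod.fst : Coord n × Coord n → Coord n) (𝓝[range (𝓡∂ n) ×ˢ univ] z₀)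
        (𝓝[range (𝓡∂ n)] z₀.1) :=
      continuous_fst.continuousWithinAt.tendsto_nhdsWithin fun z hz ↦ hz.1
    exact h1.eventually (extChartAt_target_mem_nhdsWithin_of_mem hz₀)
  obtain ⟨r₀, hr₀, hsub⟩ := Metric.mem_nhdsWithin_iff.1 (inter_mem ht htarget)
  set r := min r₀ R with hr
  have hrpos : 0 < r := lt_min hr₀ hR
  obtain ⟨ε, hε, hsol⟩ := exists_local_solution hF z₀ hrpos
  have hball : ∀ z ∈ Metric.ball z₀ r, z.1 ∈ range (𝓡∂ n) →
      z ∈ t ∩ {z | z.1 ∈ (extChartAt (𝓡∂ n) q).target} := fun z hz hz1 ↦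
    hsub ⟨Metric.ball_subset_ball (min_le_left _ _) hz, hz1, mem_univ _⟩
  exact ⟨⟨F, _, r, ε, hF, fun _ ↦ rfl, hrpos, hε, fun z hz h1 ↦ (hball z hz h1).2,
    fun z hz h1 ↦ (hFeq (hball z hz h1).1).symm, hsol⟩, min_le_right _ _⟩

variable {g : LorentzMetric n M} {q : M} {z₀ : Coord n × Coord n}

/-- As long as a geodesic stays in the domain of a local flow, it is a solution. -/
theorem LocalFlow.hasDerivWithinAt (L : LocalFlow g q z₀) {c : ℝ → TangentBundle (𝓡∂ n) M} {T : ℝ}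
    (hc : g.IsGeodesicOn c T) {t : ℝ} (ht : t ∈ Icc 0 T)
    (h1 : (c t).proj ∈ (chartAt (EuclideanHalfSpace n) q).source)
    (h2 : coord q (c t) ∈ Metric.ball z₀ L.r) :
    HasDerivWithinAt (fun t ↦ coord q (c t)) (L.F (coord q (c t))) (Icc 0 T) t := by
  rw [L.eq_spray _ h2 (coord_fst_mem_range _ _)]
  exact hc.geodesicAt ht h1

/-- Solutions of a local flow that stay in the half space are geodesics. -/
theorem LocalFlow.isGeodesicOn (L : LocalFlow g q z₀) {z : ℝ → Coord n × Coord n} {h : ℝ}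
    (hz : ∀ t ∈ Icc 0 h, HasDerivWithinAt z (L.F (z t)) (Icc 0 h) t ∧ z t ∈ Metric.ball z₀ L.r)
    (hH : ∀ t ∈ Icc 0 h, (z t).1 ∈ range (𝓡∂ n)) :
    g.IsGeodesicOn (fun t ↦ ofCoord q (z t)) h := by
  have hmem : ∀ t ∈ Icc 0 h, (z t).1 ∈ (extChartAt (𝓡∂ n) q).target := fun t ht ↦
    L.mem_target _ (hz t ht).2 (hH t ht)
  have hcoord : ∀ t ∈ Icc 0 h, coord q (ofCoord q (z t)) = z t := fun t ht ↦
    coord_ofCoord (hmem t ht)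
  refine isGeodesicOn_of_geodesicAt ?_ fun t ht ↦ ⟨q, ofCoord_proj_mem (hmem t ht), ?_⟩
  · intro t ht
    refine tendsto_of_coord (ofCoord_proj_mem (hmem t ht)) ?_ ?_
    · filter_upwards [self_mem_nhdsWithin] with s hs using ofCoord_proj_mem (hmem s hs)
    · rw [hcoord t ht]
      refine (hz t ht).1.continuousWithinAt.tendsto.congr' ?_
      filter_upwards [self_mem_nhdsWithin] with s hs using (hcoord s hs).symm
  · unfold GeodesicAt
    rw [hcoord t ht, ← L.eq_spray _ (hz t ht).2 (hH t ht)]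
    exact (hz t ht).1.congr (fun s hs ↦ hcoord s hs) (hcoord t ht)

/-- A geodesic that starts near `z₀` coincides with the solution of the local flow. -/
theorem LocalFlow.coord_eq [T2Space M] (L : LocalFlow g q z₀) {c : ℝ → TangentBundle (𝓡∂ n) M}
    {h : ℝ} (hc : g.IsGeodesicOn c h)
    (h1 : (c 0).proj ∈ (chartAt (EuclideanHalfSpace n) q).source)
    {z : ℝ → Coord n × Coord n} (hz0 : z 0 = coord q (c 0))
    (hz : ∀ t ∈ Icc 0 h, HasDerivWithinAt z (L.F (z t)) (Icc 0 h) t ∧ z t ∈ Metric.ball z₀ L.r) :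
    ∀ t ∈ Icc 0 h, (c t).proj ∈ (chartAt (EuclideanHalfSpace n) q).source ∧ coord q (c t) = z t := by
  refine real_induction ⟨h1, hz0.symm⟩ ?_ ?_
  · intro s hs hP
    have hsI : s ∈ Icc 0 h := ⟨hs.1.le, hs.2⟩
    have hsub : Ico 0 s ⊆ Icc 0 h := fun t ht ↦ ⟨ht.1, ht.2.le.trans hs.2⟩
    have : (𝓝[Ico 0 s] s).NeBot := by
      rw [← mem_closure_iff_nhdsWithin_neBot, closure_Ico hs.1.ne]
      exact ⟨hs.1.le, le_rfl⟩
    have hzs : Tendsto z (𝓝[Ico 0 s] s) (𝓝 (z s)) :=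
      ((hz s hsI).1.continuousWithinAt.mono hsub).tendsto
    have hcs : Tendsto c (𝓝[Ico 0 s] s) (𝓝 (c s)) := ((hc.1 s hsI).mono hsub).tendsto
    have hsrc : ∀ᶠ t in 𝓝[Ico 0 s] s, (c t).proj ∈ (chartAt (EuclideanHalfSpace n) q).source := by
      filter_upwards [self_mem_nhdsWithin] with t ht using (hP t ht).1
    have hceq : Tendsto (fun t ↦ coord q (c t)) (𝓝[Ico 0 s] s) (𝓝 (z s)) := by
      refine hzs.congr' ?_
      filter_upwards [self_mem_nhdsWithin] with t ht using (hP t ht).2.symm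
    -- The curve might leave the chart domain at time `s`. But `z s` is a limit of coordinates of
    -- points of `M`, hence lies in the closed half space and so in the chart target; since `M` is
    -- Hausdorff, the point it represents is the base point of `c s`.
    have hrange : (z s).1 ∈ range (𝓡∂ n) :=
      isClosed_range_model.mem_of_tendsto ((continuous_fst.tendsto _).comp hceq)
        (Eventually.of_forall fun t ↦ coord_fst_mem_range _ _)
    have hmem := L.mem_target _ (hz s hsI).2 hrange
    have hlim : Tendsto c (𝓝[Ico 0 s] s) (𝓝 (ofCoord q (z s))) :=
      tendsto_of_coord (ofCoord_proj_mem hmem) hsrc (by rwa [coord_ofCoord hmem])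
    have hproj := (FiberBundle.continuous_proj (Coord n) (TangentSpace (𝓡∂ n) (M := M)))
    have hpe : (c s).proj = (ofCoord q (z s)).proj :=
      tendsto_nhds_unique ((hproj.tendsto _).comp hcs) ((hproj.tendsto _).comp hlim)
    have hcsrc : (c s).proj ∈ (chartAt (EuclideanHalfSpace n) q).source := by
      rw [hpe]; exact ofCoord_proj_mem hmem
    exact ⟨hcsrc, tendsto_nhds_unique ((continuousAt_coord hcsrc).tendsto.comp hcs) hceq⟩
  · intro s hs hP
    have hsI : s ∈ Icc 0 h := ⟨hs.1, hs.2.le⟩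
    have hPs := hP s ⟨hs.1, le_rfl⟩
    have hball : coord q (c s) ∈ Metric.ball z₀ L.r := by rw [hPs.2]; exact (hz s hsI).2
    have hev : ∀ᶠ t in 𝓝[Icc 0 h] s, (c t).proj ∈ (chartAt (EuclideanHalfSpace n) q).source ∧
        coord q (c t) ∈ Metric.ball z₀ L.r := by
      refine ((hc.1 s hsI).eventually (eventually_proj_mem hPs.1)).and ?_
      exact ((continuousAt_coord hPs.1).comp_continuousWithinAt (hc.1 s hsI)).eventually
        (Metric.isOpen_ball.mem_nhds hball)
    obtain ⟨δ, hδ, hδ'⟩ := Metric.mem_nhdsWithin_iff.1 hev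
    refine ⟨min h (s + δ / 2), lt_min hs.2 (by linarith), fun t ht _ ↦ ?_⟩
    set s' := min h (s + δ / 2)
    have hsub : Icc s s' ⊆ Icc 0 h := fun t ht ↦ ⟨hs.1.trans ht.1, ht.2.trans (min_le_left _ _)⟩
    have hgood : ∀ t ∈ Icc s s', (c t).proj ∈ (chartAt (EuclideanHalfSpace n) q).source ∧
        coord q (c t) ∈ Metric.ball z₀ L.r := fun t ht ↦ by
      refine hδ' ⟨?_, hsub ht⟩
      rw [Metric.mem_ball, Real.dist_eq, abs_of_nonneg (by linarith [ht.1])]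
      have := ht.2.trans (min_le_right h (s + δ / 2))
      linarith
    have htI : t ∈ Icc s s' := ⟨ht.1.le, ht.2⟩
    refine ⟨(hgood t htI).1, ?_⟩
    have := dist_le_of_solutions L.lip (a := s) (b := s') (z := fun t ↦ coord q (c t)) (w := z)
      (fun t ht ↦ (L.hasDerivWithinAt hc (hsub ht) (hgood t ht).1 (hgood t ht).2).mono hsub)
      (fun t ht ↦ (hz t (hsub ht)).1.mono hsub) t htI
    simpa [hPs.2] using this

/-- A geodesic that starts near `z₀` solves the equation of the local flow for a uniform time. -/
theorem LocalFlow.solves [T2Space M] (L : LocalFlow g q z₀) {c : ℝ → TangentBundle (𝓡∂ n) M}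
    {h : ℝ} (hc : g.IsGeodesicOn c h) (hh : h ≤ L.ε)
    (h1 : (c 0).proj ∈ (chartAt (EuclideanHalfSpace n) q).source)
    (h2 : coord q (c 0) ∈ Metric.ball z₀ (L.r / 2)) :
    ∀ t ∈ Icc 0 h, (c t).proj ∈ (chartAt (EuclideanHalfSpace n) q).source ∧
      coord q (c t) ∈ Metric.ball z₀ L.r ∧
      HasDerivWithinAt (fun t ↦ coord q (c t)) (L.F (coord q (c t))) (Icc 0 h) t := by
  obtain ⟨z, hz0, hz⟩ := L.exists_sol _ h2
  have hsub : Icc 0 h ⊆ Icc 0 L.ε := Icc_subset_Icc_right hh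
  have key := L.coord_eq hc h1 hz0 fun t ht ↦ ⟨(hz t (hsub ht)).1.mono hsub, (hz t (hsub ht)).2⟩
  intro t ht
  have hb : coord q (c t) ∈ Metric.ball z₀ L.r := by rw [(key t ht).2]; exact (hz t (hsub ht)).2
  exact ⟨(key t ht).1, hb, L.hasDerivWithinAt hc ht (key t ht).1 hb⟩

theorem half_ball_mem {q : M} {P : TangentBundle (𝓡∂ n) M} (L : LocalFlow g q (coord q P)) :
    coord q P ∈ Metric.ball (coord q P) (L.r / 2) := Metric.mem_ball_self (half_pos L.r_pos)

/-- Geodesics are determined by their initial data. -/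
theorem LorentzMetric.IsGeodesicOn.eqOn [T2Space M] {c c' : ℝ → TangentBundle (𝓡∂ n) M} {T : ℝ}
    (hc : g.IsGeodesicOn c T) (hc' : g.IsGeodesicOn c' T) (h0 : c 0 = c' 0) :
    EqOn c c' (Icc 0 T) := by
  refine real_induction h0 ?_ ?_
  · intro s hs hP
    have hsI : s ∈ Icc 0 T := ⟨hs.1.le, hs.2⟩
    have hsub : Ico 0 s ⊆ Icc 0 T := fun t ht ↦ ⟨ht.1, ht.2.le.trans hs.2⟩
    have : (𝓝[Ico 0 s] s).NeBot := by
      rw [← mem_closure_iff_nhdsWithin_neBot, closure_Ico hs.1.ne]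
      exact ⟨hs.1.le, le_rfl⟩
    have h1 : Tendsto c (𝓝[Ico 0 s] s) (𝓝 (c s)) := ((hc.1 s hsI).mono hsub).tendsto
    have h2 : Tendsto c (𝓝[Ico 0 s] s) (𝓝 (c' s)) := by
      refine ((hc'.1 s hsI).mono hsub).tendsto.congr' ?_
      filter_upwards [self_mem_nhdsWithin] with t ht using (hP t ht).symm
    have hproj := (FiberBundle.continuous_proj (Coord n) (TangentSpace (𝓡∂ n) (M := M)))
    have hpe : (c s).proj = (c' s).proj :=
      tendsto_nhds_unique ((hproj.tendsto _).comp h1) ((hproj.tendsto _).comp h2)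
    have hs1 : (c s).proj ∈ (chartAt (EuclideanHalfSpace n) (c s).proj).source := mem_chart_source _ _
    have hs2 : (c' s).proj ∈ (chartAt (EuclideanHalfSpace n) (c s).proj).source := hpe ▸ hs1
    exact coord_injOn hs1 hs2 (tendsto_nhds_unique ((continuousAt_coord hs1).tendsto.comp h1)
      ((continuousAt_coord hs2).tendsto.comp h2))
  · intro s hs hP
    have hPs : c s = c' s := hP s ⟨hs.1, le_rfl⟩
    set q := (c s).proj with hq
    have hsrc : (c s).proj ∈ (chartAt (EuclideanHalfSpace n) q).source := mem_chart_source _ _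
    obtain ⟨L, -⟩ := exists_localFlow g (z₀ := coord q (c s)) (coord_fst_mem_target hsrc) one_pos
    set h := min (T - s) L.ε with hh
    have hs1 : g.IsGeodesicOn (fun t ↦ c (t + s)) h := (hc.shift hs.1).mono (min_le_left _ _)
    have hs2 : g.IsGeodesicOn (fun t ↦ c' (t + s)) h := (hc'.shift hs.1).mono (min_le_left _ _)
    have k1 := L.solves hs1 (min_le_right _ _) (by simpa using hsrc) (by simpa using half_ball_mem L)
    have k2 := L.solves hs2 (min_le_right _ _) (by simpa [← hPs] using hsrc)
      (by simpa [← hPs] using half_ball_mem L)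
    refine ⟨s + h, by simp [hh, L.ε_pos, hs.2], fun t ht _ ↦ ?_⟩
    have htI : t - s ∈ Icc 0 h := ⟨by linarith [ht.1], by linarith [ht.2]⟩
    have := dist_le_of_solutions L.lip (fun t ht ↦ (k1 t ht).2.2) (fun t ht ↦ (k2 t ht).2.2) _ htI
    simp only [zero_add, hPs, dist_self, zero_mul, sub_add_cancel] at this
    have e := dist_le_zero.1 this
    have a1 := (k1 _ htI).1
    have a2 := (k2 _ htI).1
    simp only [sub_add_cancel] at a1 a2
    exact coord_injOn a1 a2 e

/-- The geodesic flow is given by any geodesic with the right initial data. -/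
theorem LorentzMetric.IsGeodesicOn.geodesicFlow_eq [T2Space M] {c : ℝ → TangentBundle (𝓡∂ n) M}
    {T t : ℝ} (hc : g.IsGeodesicOn c T) (ht : t ∈ Icc 0 T) : g.geodesicFlow (c 0) t = c t := by
  have h : ∃ c', g.IsGeodesicOn c' t ∧ c' 0 = c 0 := ⟨c, hc.mono ht.2, rfl⟩
  rw [LorentzMetric.geodesicFlow, dif_pos h]
  exact h.choose_spec.1.eqOn (hc.mono ht.2) h.choose_spec.2 ⟨ht.1, le_rfl⟩

theorem LorentzMetric.IsGeodesicOn.mem_stayTimes {c : ℝ → TangentBundle (𝓡∂ n) M}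
    {T t : ℝ} (hc : g.IsGeodesicOn c T) (ht : t ∈ Icc 0 T) : t ∈ g.stayTimes (c 0) :=
  ⟨ht.1, c, hc.mono ht.2, rfl⟩

/-- In any chart, the interior is given by positivity of the first coordinate. -/
theorem mem_interior_iff_coord {P : TangentBundle (𝓡∂ n) M}
    (hP : P.proj ∈ (chartAt (EuclideanHalfSpace n) q).source) :
    P.proj ∈ (𝓡∂ n).interior M ↔ 0 < (coord q P).1 0 := by
  have hr : interior (range (𝓡∂ n)) = {y : EuclideanSpace ℝ (Fin n) | 0 < y 0} :=
    interior_range_modelWithCornersEuclideanHalfSpace n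
  have h : (coord q P).1 ∈ interior (range (𝓡∂ n)) ↔ 0 < (coord q P).1 0 := by rw [hr]; rfl
  rw [← h]
  refine ((𝓡∂ n).isInteriorPoint_iff_of_mem_atlas (n := ∞) (by simp) (chart_mem_atlas _ q)
    hP).trans ⟨fun h ↦ ?_, fun h ↦ ?_⟩
  · refine interior_mono ?_ h
    exact extChartAt_target_subset_range (I := 𝓡∂ n) q
  · exact (chartAt (EuclideanHalfSpace n) q).mem_interior_extend_target
      ((chartAt (EuclideanHalfSpace n) q).map_source hP) h

/-- From an interior point, a geodesic can be continued in the interior. -/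
theorem exists_geodesic_interior (g : LorentzMetric n M) {P : TangentBundle (𝓡∂ n) M}
    (hP : P.proj ∈ (𝓡∂ n).interior M) :
    ∃ ε > 0, ∃ c, g.IsGeodesicOn c ε ∧ c 0 = P ∧
      ∀ t ∈ Icc 0 ε, (c t).proj ∈ (𝓡∂ n).interior M := by
  set q := P.proj
  have hsrc : P.proj ∈ (chartAt (EuclideanHalfSpace n) q).source := mem_chart_source _ _
  obtain ⟨L, -⟩ := exists_localFlow g (z₀ := coord q P) (coord_fst_mem_target hsrc) one_pos
  obtain ⟨z, hz0, hz⟩ := L.exists_sol _ (half_ball_mem L)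
  have hinterior : (z 0).1 ∈ interior (range (𝓡∂ n)) := by rw [hz0]; exact hP
  have hcont : ContinuousWithinAt (fun t ↦ (z t).1) (Icc 0 L.ε) 0 :=
    continuous_fst.continuousAt.comp_continuousWithinAt
      (hz 0 ⟨le_rfl, L.ε_pos.le⟩).1.continuousWithinAt
  obtain ⟨δ, hδ, hδ'⟩ := Metric.mem_nhdsWithin_iff.1
    (hcont.eventually (isOpen_interior.mem_nhds hinterior))
  set h := min L.ε (δ / 2) with hh
  have hpos : 0 < h := lt_min L.ε_pos (half_pos hδ)
  have hsub : Icc 0 h ⊆ Icc 0 L.ε := Icc_subset_Icc_right (min_le_left _ _)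
  have hI : ∀ t ∈ Icc 0 h, (z t).1 ∈ interior (range (𝓡∂ n)) := fun t ht ↦ by
    refine hδ' ⟨?_, hsub ht⟩
    rw [Metric.mem_ball, Real.dist_eq, sub_zero, abs_of_nonneg ht.1]
    linarith [ht.2.trans (min_le_right L.ε (δ / 2))]
  have hgeo := L.isGeodesicOn (z := z) (h := h)
    (fun t ht ↦ ⟨(hz t (hsub ht)).1.mono hsub, (hz t (hsub ht)).2⟩)
    (fun t ht ↦ interior_subset (hI t ht))
  refine ⟨h, hpos, _, hgeo, ?_, fun t ht ↦ ?_⟩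
  · rw [hz0, ofCoord_coord hsrc]
  · have hm := L.mem_target _ (hz t (hsub ht)).2 (interior_subset (hI t ht))
    have hs := ofCoord_proj_mem (q := q) hm
    rw [mem_interior_iff_coord hs, coord_ofCoord hm]
    have := hI t ht
    rw [interior_range_modelWithCornersEuclideanHalfSpace] at this
    exact this

/-! ### Conservation of energy, zero velocity -/

theorem metricIn_coord {P : TangentBundle (𝓡∂ n) M}
    (hP : P.proj ∈ (chartAt (EuclideanHalfSpace n) q).source) :
    metricIn g q (coord q P).1 (coord q P).2 (coord q P).2 = g.inner P.proj P.snd P.snd :=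
  metricIn_apply g hP P.snd P.snd

/-- The derivative of `G(x)(v, δ)` along a geodesic. -/
theorem hasDerivWithinAt_momentum {z : ℝ → Coord n × Coord n} {S : Set ℝ} {t : ℝ}
    (hz : HasDerivWithinAt z (sprayIn g q (z t)) S t)
    (hmem : (z t).1 ∈ (extChartAt (𝓡∂ n) q).target) (hH : ∀ s ∈ S, (z s).1 ∈ range (𝓡∂ n))
    {δ : ℝ → Coord n} {δ' : Coord n} (hδ : HasDerivWithinAt δ δ' S t) :
    HasDerivWithinAt (fun s ↦ metricIn g q (z s).1 (z s).2 (δ s))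
      (1 / 2 * fderivWithin ℝ (metricIn g q) (range (𝓡∂ n)) (z t).1 (δ t) (z t).2 (z t).2 +
        metricIn g q (z t).1 (z t).2 δ') S t := by
  have hG : HasFDerivWithinAt (metricIn g q)
      (fderivWithin ℝ (metricIn g q) (range (𝓡∂ n)) (z t).1) (range (𝓡∂ n)) (z t).1 :=
    ((contDiffWithinAt_metricIn g hmem).differentiableWithinAt (by simp)).hasFDerivWithinAt
  have hx := hasDerivWithinAt_fst hz
  have hv := hasDerivWithinAt_snd hz
  have hGx : HasDerivWithinAt (fun s ↦ metricIn g q (z s).1) _ S t :=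
    HasFDerivWithinAt.comp_hasDerivWithinAt (f := fun s ↦ (z s).1) t hG hx hH
  have h := (hGx.clm_apply hv).clm_apply hδ
  refine h.congr_deriv ?_
  have hEq : GeodesicEq (metricIn g q) (range (𝓡∂ n)) (z t).1 (z t).2 (sprayIn g q (z t)).2 :=
    (sprayIn_eq_iff hmem).2 rfl
  -- The geodesic equation tested against δ replaces g(a, δ) + D_v g(v, δ) by half of D_δ g(v, v),
  -- which is the Euler-Lagrange form of the equation.
  have h1 := hEq (δ t)
  have h2 : (sprayIn g q (z t)).1 = (z t).2 := rfl
  rw [add_apply, h2]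
  linarith

/-- The energy is conserved along geodesics. -/
theorem LorentzMetric.IsGeodesicOn.energy_eq {c : ℝ → TangentBundle (𝓡∂ n) M} {T : ℝ}
    (hc : g.IsGeodesicOn c T) {t : ℝ} (ht : t ∈ Icc 0 T) :
    g.inner (c t).proj (c t).snd (c t).snd = g.inner (c 0).proj (c 0).snd (c 0).snd := by
  have hder : ∀ t ∈ Icc 0 T, HasDerivWithinAt
      (fun t ↦ g.inner (c t).proj (c t).snd (c t).snd) 0 (Icc 0 T) t := by
    intro t ht
    set q := (c t).proj
    have hsrc : (c t).proj ∈ (chartAt (EuclideanHalfSpace n) q).source := mem_chart_source _ _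
    have hz : HasDerivWithinAt (fun t ↦ coord q (c t)) (sprayIn g q (coord q (c t))) (Icc 0 T) t :=
      hc.geodesicAt ht hsrc
    have hmem := coord_fst_mem_target hsrc
    have h := hasDerivWithinAt_momentum hz hmem (fun s _ ↦ coord_fst_mem_range _ _)
      (hasDerivWithinAt_snd hz)
    have hEq : GeodesicEq (metricIn g q) (range (𝓡∂ n)) (coord q (c t)).1 (coord q (c t)).2
      (sprayIn g q (coord q (c t))).2 := (sprayIn_eq_iff hmem).2 rfl
    -- Tested against the velocity itself, the geodesic equation reads g(a, v) + D_v g(v, v)/2 = 0,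
    -- which is half of the derivative of the energy.
    have h1 := hEq (coord q (c t)).2
    rw [metricIn_symm] at h1
    refine (h.congr_deriv (by linarith)).congr_of_eventuallyEq ?_ (metricIn_coord hsrc).symm
    filter_upwards [(hc.1 t ht).eventually (eventually_proj_mem hsrc)] with s hs
    exact (metricIn_coord hs).symm
  have := (convex_Icc 0 T).norm_image_sub_le_of_norm_hasDerivWithin_le (C := 0) hder
    (fun _ _ ↦ by simp) (show (0 : ℝ) ∈ Icc 0 T from ⟨le_rfl, ht.1.trans ht.2⟩) ht
  simp only [zero_mul, norm_le_zero_iff, sub_eq_zero] at this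
  exact this

theorem isGeodesicOn_const {P : TangentBundle (𝓡∂ n) M} (hP : P.snd = 0) (T : ℝ) :
    g.IsGeodesicOn (fun _ ↦ P) T := by
  refine isGeodesicOn_of_geodesicAt continuousOn_const fun t₀ _ ↦ ⟨_, mem_chart_source _ P.proj, ?_⟩
  have h2 : (coord P.proj P).2 = 0 := by rw [coord_self, hP]; rfl
  have hmem := coord_fst_mem_target (mem_chart_source (EuclideanHalfSpace n) P.proj)
  have h3 : sprayIn g P.proj (coord P.proj P) = 0 := by
    have : GeodesicEq (metricIn g P.proj) (range (𝓡∂ n)) (coord P.proj P).1 0 0 := by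
      intro w; simp
    rw [sprayIn_eq_iff hmem, ← h2, Prod.mk.eta, h2] at this
    exact this
  unfold GeodesicAt
  rw [h3]
  exact hasDerivWithinAt_const _ _ _

/-- Run backwards from a time of zero velocity, the geodesic would be constant by uniqueness. Energy
conservation could not exclude this for null vectors. -/
theorem LorentzMetric.IsGeodesicOn.snd_ne_zero [T2Space M] {c : ℝ → TangentBundle (𝓡∂ n) M} {T : ℝ}
    (hc : g.IsGeodesicOn c T) (h0 : (c 0).snd ≠ 0) {t : ℝ} (ht : t ∈ Icc 0 T) :
    (c t).snd ≠ 0 := by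
  intro hzero
  have h1 := (hc.mono ht.2).reverse
  have hz : (scale (-1) (c t)).snd = 0 := by
    change (-1 : ℝ) • (c t).snd = 0
    rw [hzero, smul_zero]
  have h2 := h1.eqOn (isGeodesicOn_const (g := g) hz t) (by simp) (show t ∈ Icc 0 t from ⟨ht.1, le_rfl⟩)
  simp only [sub_self] at h2
  have h3 := congrArg (scale (-1)) h2
  rw [scale_neg_one_scale, scale_neg_one_scale] at h3
  exact h0 (h3 ▸ hzero)

end

/-! ### Limits of geodesics -/

section

variable {n : ℕ} [NeZero n] {M : Type*} [TopologicalSpace M]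
  [ChartedSpace (EuclideanHalfSpace n) M] [IsManifold (𝓡∂ n) ∞ M]
  {g : LorentzMetric n M} {q : M} {z₀ : Coord n × Coord n} {α : Type*} {l : Filter α}

/-- Grönwall for the extended field. The limit `z` is not assumed to stay in the half space; it may
be used to find out that it does. -/
theorem LocalFlow.tendsto_coord [T2Space M] [l.NeBot] (L : LocalFlow g q z₀)
    {z : ℝ → Coord n × Coord n} (hz0 : z 0 ∈ Metric.ball z₀ (L.r / 2))
    (hz : ∀ t ∈ Icc 0 L.ε, HasDerivWithinAt z (L.F (z t)) (Icc 0 L.ε) t ∧ z t ∈ Metric.ball z₀ L.r)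
    {c : α → ℝ → TangentBundle (𝓡∂ n) M} {T : α → ℝ} {h : ℝ}
    (hc : ∀ᶠ s in l, g.IsGeodesicOn (c s) (T s)) (hT0 : ∀ᶠ s in l, 0 ≤ T s)
    (hT1 : ∀ᶠ s in l, T s ≤ L.ε) (hT : Tendsto T l (𝓝 h))
    (hsrc : ∀ᶠ s in l, (c s 0).proj ∈ (chartAt (EuclideanHalfSpace n) q).source)
    (hc0 : Tendsto (fun s ↦ coord q (c s 0)) l (𝓝 (z 0))) :
    Tendsto (fun s ↦ coord q (c s (T s))) l (𝓝 (z h)) ∧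
      ∀ᶠ s in l, (c s (T s)).proj ∈ (chartAt (EuclideanHalfSpace n) q).source := by
  have hh : h ∈ Icc 0 L.ε := ⟨ge_of_tendsto hT hT0, le_of_tendsto hT hT1⟩
  have hball : ∀ᶠ s in l, coord q (c s 0) ∈ Metric.ball z₀ (L.r / 2) :=
    hc0.eventually (Metric.isOpen_ball.mem_nhds hz0)
  have hzT : Tendsto (fun s ↦ z (T s)) l (𝓝 (z h)) := by
    refine (hz h hh).1.continuousWithinAt.tendsto.comp (tendsto_nhdsWithin_iff.2 ⟨hT, ?_⟩)
    filter_upwards [hT0, hT1] with s h0 h1 using ⟨h0, h1⟩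
  have hd : Tendsto (fun s ↦ dist (coord q (c s 0)) (z 0) * Real.exp (L.K * L.ε)) l (𝓝 0) := by
    simpa using (tendsto_iff_dist_tendsto_zero.1 hc0).mul_const (Real.exp (L.K * L.ε))
  have hmain : ∀ᶠ s in l, dist (coord q (c s (T s))) (z (T s)) ≤
      dist (coord q (c s 0)) (z 0) * Real.exp (L.K * L.ε) ∧
      (c s (T s)).proj ∈ (chartAt (EuclideanHalfSpace n) q).source := by
    filter_upwards [hc, hT0, hT1, hsrc, hball] with s hcs h0 h1 hs hb
    have hsol := L.solves hcs h1 hs hb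
    have hmem : T s ∈ Icc 0 (T s) := ⟨h0, le_rfl⟩
    have hsub : Icc 0 (T s) ⊆ Icc 0 L.ε := Icc_subset_Icc_right h1
    refine ⟨(dist_le_of_solutions L.lip (fun t ht ↦ (hsol t ht).2.2)
      (fun t ht ↦ (hz t (hsub ht)).1.mono hsub) _ hmem).trans ?_, (hsol _ hmem).1⟩
    gcongr
    linarith
  refine ⟨?_, hmain.mono fun s hs ↦ hs.2⟩
  have h2 : Tendsto (fun s ↦ dist (coord q (c s (T s))) (z (T s))) l (𝓝 0) :=
    squeeze_zero' (Eventually.of_forall fun _ ↦ dist_nonneg) (hmain.mono fun s hs ↦ hs.1) hd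
  exact (tendsto_iff_of_dist h2).2 hzT

/-- Geodesics depend continuously on initial data and time, as far as the limit is defined. -/
theorem LorentzMetric.IsGeodesicOn.tendsto [T2Space M] [l.NeBot] {γ : ℝ → TangentBundle (𝓡∂ n) M}
    {τ : ℝ} (hγ : g.IsGeodesicOn γ τ) {c : α → ℝ → TangentBundle (𝓡∂ n) M} {T : α → ℝ} {t : ℝ}
    (hc : ∀ᶠ s in l, g.IsGeodesicOn (c s) (T s)) (hc0 : Tendsto (fun s ↦ c s 0) l (𝓝 (γ 0)))
    (hT0 : ∀ᶠ s in l, 0 ≤ T s) (hT : Tendsto T l (𝓝 t)) (ht : t ≤ τ) :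
    Tendsto (fun s ↦ c s (T s)) l (𝓝 (γ t)) := by
  have ht0 : 0 ≤ t := ge_of_tendsto hT hT0
  -- The induction runs over the limit time, so the statement has to cover all converging times `u`
  -- below `T`; the step from `a` to `b` uses it for `min (u s) a`.
  suffices H : ∀ u : α → ℝ, Tendsto u l (𝓝 t) → (∀ᶠ s in l, 0 ≤ u s) → (∀ᶠ s in l, u s ≤ T s) →
      Tendsto (fun s ↦ c s (u s)) l (𝓝 (γ t)) from
    H T hT hT0 (Eventually.of_forall fun _ ↦ le_rfl)
  refine real_induction_of_local (P := fun t ↦ ∀ u : α → ℝ, Tendsto u l (𝓝 t) →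
    (∀ᶠ s in l, 0 ≤ u s) → (∀ᶠ s in l, u s ≤ T s) →
      Tendsto (fun s ↦ c s (u s)) l (𝓝 (γ t))) ht0 ?_ ?_
  · intro u hu hu0 huT
    set q := (γ 0).proj
    have hsrc : (γ 0).proj ∈ (chartAt (EuclideanHalfSpace n) q).source := mem_chart_source _ _
    obtain ⟨L, -⟩ := exists_localFlow g (z₀ := coord q (γ 0)) (coord_fst_mem_target hsrc) one_pos
    obtain ⟨z, hz0, hz⟩ := L.exists_sol _ (half_ball_mem L)
    have h := L.tendsto_coord (c := c) (T := u) (by rw [hz0]; exact half_ball_mem L) hz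
      (by filter_upwards [hc, huT] with s h1 h2 using h1.mono h2) hu0
      ((hu.eventually (gt_mem_nhds L.ε_pos)).mono fun _ h ↦ le_of_lt h) hu
      (hc0.eventually (eventually_proj_mem hsrc))
      (by rw [hz0]; exact (continuousAt_coord hsrc).tendsto.comp hc0)
    exact tendsto_of_coord hsrc h.2 (by rw [← hz0]; exact h.1)
  · intro t₀ ht₀
    have ht₀τ : t₀ ∈ Icc 0 τ := ⟨ht₀.1, ht₀.2.trans ht⟩
    set q := (γ t₀).proj
    have hsrc : (γ t₀).proj ∈ (chartAt (EuclideanHalfSpace n) q).source := mem_chart_source _ _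
    obtain ⟨L, -⟩ := exists_localFlow g (z₀ := coord q (γ t₀)) (coord_fst_mem_target hsrc) one_pos
    have hev : ∀ᶠ a in 𝓝[Icc 0 τ] t₀, (γ a).proj ∈ (chartAt (EuclideanHalfSpace n) q).source ∧
        coord q (γ a) ∈ Metric.ball (coord q (γ t₀)) (L.r / 2) :=
      ((hγ.1 t₀ ht₀τ).eventually (eventually_proj_mem hsrc)).and
        (((continuousAt_coord hsrc).comp_continuousWithinAt (hγ.1 t₀ ht₀τ)).eventually
          (Metric.isOpen_ball.mem_nhds (half_ball_mem L)))
    obtain ⟨δ, hδ, hδ'⟩ := Metric.mem_nhdsWithin_iff.1 hev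
    refine ⟨min δ (L.ε / 2), lt_min hδ (half_pos L.ε_pos), ?_⟩
    intro a ha b hb hat hbt hab hPa u hu hu0 huT
    have haτ : a ∈ Icc 0 τ := ⟨ha.1, ha.2.trans ht⟩
    have hbτ : b ∈ Icc 0 τ := ⟨hb.1, hb.2.trans ht⟩
    obtain ⟨hasrc, haball⟩ := hδ' ⟨show dist a t₀ < δ from hat.trans_le (min_le_left _ _), haτ⟩
    have hba : b - a < L.ε := by
      have h1 := abs_lt.1 (hat.trans_le (min_le_right _ _))
      have h2 := abs_lt.1 (hbt.trans_le (min_le_right _ _))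
      linarith
    have hma : Tendsto (fun s ↦ min (u s) a) l (𝓝 a) := by
      simpa [min_eq_right hab] using hu.min (tendsto_const_nhds (x := a))
    have hm0 : ∀ᶠ s in l, 0 ≤ min (u s) a := hu0.mono fun s hs ↦ le_min hs ha.1
    have hlim := hPa _ hma hm0 (huT.mono fun s hs ↦ (min_le_left _ _).trans hs)
    obtain ⟨z, hz0, hz⟩ := L.exists_sol _ haball
    have hdiff : Tendsto (fun s ↦ u s - min (u s) a) l (𝓝 (b - a)) := hu.sub hma
    have h := L.tendsto_coord (c := fun s t ↦ c s (t + min (u s) a))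
      (T := fun s ↦ u s - min (u s) a) (by rw [hz0]; exact haball) hz
      (by filter_upwards [hc, huT, hm0] with s h1 h2 h3
          exact (h1.mono h2).shift h3)
      (Eventually.of_forall fun s ↦ by simp)
      ((hdiff.eventually (gt_mem_nhds hba)).mono fun _ h ↦ le_of_lt h) hdiff
      (by simpa using hlim.eventually (eventually_proj_mem hasrc))
      (by rw [hz0]; simpa [Function.comp_def] using (continuousAt_coord hasrc).tendsto.comp hlim)
    have hshift := (hγ.mono hbτ.2).shift ha.1
    have hsub : Icc 0 (b - a) ⊆ Icc 0 L.ε := Icc_subset_Icc_right hba.le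
    have heq := L.coord_eq hshift (by simpa using hasrc) (by simpa using hz0)
      (fun t ht ↦ ⟨(hz t (hsub ht)).1.mono hsub, (hz t (hsub ht)).2⟩) (b - a)
      ⟨by linarith, le_rfl⟩
    simp only [sub_add_cancel] at heq h
    exact tendsto_of_coord heq.1 h.2 (by rw [heq.2]; exact h.1)

/-- The times up to which nearby geodesics exist cannot exceed the maximal time in the limit. -/
theorem le_of_isGreatest_stayTimes [T2Space M] [l.NeBot] {p : TangentBundle (𝓡∂ n) M} {τ : ℝ}
    (hp : IsGreatest (g.stayTimes p) τ) {c : α → ℝ → TangentBundle (𝓡∂ n) M} {T : ℝ}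
    (hc : ∀ᶠ s in l, g.IsGeodesicOn (c s) T) (hc0 : Tendsto (fun s ↦ c s 0) l (𝓝 p)) : T ≤ τ := by
  by_contra! hlt
  obtain ⟨⟨hτ0, γ, hγ, hγ0⟩, hmax⟩ := hp
  subst hγ0
  set q := (γ τ).proj
  have hsrc : (γ τ).proj ∈ (chartAt (EuclideanHalfSpace n) q).source := mem_chart_source _ _
  obtain ⟨L, -⟩ := exists_localFlow g (z₀ := coord q (γ τ)) (coord_fst_mem_target hsrc) one_pos
  obtain ⟨z, hz0, hz⟩ := L.exists_sol _ (half_ball_mem L)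
  have hlim : Tendsto (fun s ↦ c s τ) l (𝓝 (γ τ)) :=
    hγ.tendsto (T := fun _ ↦ τ) (hc.mono fun s hs ↦ hs.mono hlt.le) hc0
      (Eventually.of_forall fun _ ↦ hτ0) tendsto_const_nhds le_rfl
  set h := min L.ε (T - τ)
  have hh : 0 < h := lt_min L.ε_pos (sub_pos.2 hlt)
  -- The solution of the extended field through γ(τ) is a limit of coordinates of points of `M`, and
  -- the half space is closed. It is therefore a geodesic that continues γ past the maximal time.
  have hrange : ∀ t ∈ Icc 0 h, (z t).1 ∈ range (𝓡∂ n) := by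
    intro t ht
    have htT : t ≤ T - τ := ht.2.trans (min_le_right _ _)
    have := L.tendsto_coord (c := fun s t ↦ c s (t + τ)) (T := fun _ ↦ t)
      (by rw [hz0]; exact half_ball_mem L) hz
      (hc.mono fun s hs ↦ (hs.shift hτ0).mono htT) (Eventually.of_forall fun _ ↦ ht.1)
      (Eventually.of_forall fun _ ↦ ht.2.trans (min_le_left _ _)) tendsto_const_nhds
      (by simpa using hlim.eventually (eventually_proj_mem hsrc))
      (by rw [hz0]; simpa [Function.comp_def] using (continuousAt_coord hsrc).tendsto.comp hlim)
    exact isClosed_range_model.mem_of_tendsto ((continuous_fst.tendsto _).comp this.1)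
      (Eventually.of_forall fun s ↦ coord_fst_mem_range _ _)
  have hsub : Icc 0 h ⊆ Icc 0 L.ε := Icc_subset_Icc_right (min_le_left _ _)
  have hgeo := L.isGeodesicOn (fun t ht ↦ ⟨(hz t (hsub ht)).1.mono hsub, (hz t (hsub ht)).2⟩)
    hrange
  have hcc := hγ.concat hgeo hτ0 hh.le (by rw [hz0, ofCoord_coord hsrc])
  have := hmax ⟨by linarith, _, hcc, by simp [hτ0]⟩
  linarith

/-- Otherwise the filter could be restricted to indices whose geodesics all exist up to the fixed
time τ + δ, and the limit would exist that long. -/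
theorem eventually_le_of_isGreatest_stayTimes [T2Space M] {p : TangentBundle (𝓡∂ n) M}
    {τ δ : ℝ} (hδ : 0 < δ) (hp : IsGreatest (g.stayTimes p) τ)
    {c : α → ℝ → TangentBundle (𝓡∂ n) M} {T : α → ℝ}
    (hc : ∀ᶠ s in l, g.IsGeodesicOn (c s) (T s)) (hc0 : Tendsto (fun s ↦ c s 0) l (𝓝 p)) :
    ∀ᶠ s in l, T s < τ + δ := by
  by_contra hcon
  have hfr : ∃ᶠ s in l, τ + δ ≤ T s := fun h ↦ hcon (h.mono fun s hs ↦ not_le.1 hs)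
  have : (l ⊓ 𝓟 {s | τ + δ ≤ T s}).NeBot := frequently_mem_iff_neBot.1 hfr
  have h1 : ∀ᶠ s in l ⊓ 𝓟 {s | τ + δ ≤ T s}, g.IsGeodesicOn (c s) (τ + δ) := by
    filter_upwards [hc.filter_mono inf_le_left, mem_inf_of_right (mem_principal_self _)]
      with s h1 h2 using h1.mono h2
  have := le_of_isGreatest_stayTimes hp h1 (hc0.mono_left inf_le_left)
  linarith

/-- A limit of geodesics is a geodesic. -/
theorem tendsto_geodesicFlow [T2Space M] [l.NeBot] {p : TangentBundle (𝓡∂ n) M} {τ : ℝ}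
    (hp : IsGreatest (g.stayTimes p) τ) {c : α → ℝ → TangentBundle (𝓡∂ n) M} {T : α → ℝ} {t : ℝ}
    (hc : ∀ᶠ s in l, g.IsGeodesicOn (c s) (T s)) (hc0 : Tendsto (fun s ↦ c s 0) l (𝓝 p))
    (hT0 : ∀ᶠ s in l, 0 ≤ T s) (hT : Tendsto T l (𝓝 t)) :
    t ∈ g.stayTimes p ∧ Tendsto (fun s ↦ c s (T s)) l (𝓝 (g.geodesicFlow p t)) := by
  have ht0 : 0 ≤ t := ge_of_tendsto hT hT0
  have htτ : t ≤ τ := by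
    refine le_of_forall_pos_le_add fun δ hδ ↦ le_of_tendsto hT ?_
    exact (eventually_le_of_isGreatest_stayTimes hδ hp hc hc0).mono fun s hs ↦ le_of_lt hs
  obtain ⟨⟨hτ0, γ, hγ, rfl⟩, -⟩ := hp
  refine ⟨hγ.mem_stayTimes ⟨ht0, htτ⟩, ?_⟩
  rw [hγ.geodesicFlow_eq ⟨ht0, htτ⟩]
  exact hγ.tendsto hc hc0 hT0 hT htτ

/-- Geodesics that start near a given point stay in a given open set for a uniform time. -/
theorem exists_uniform_stay [T2Space M] (g : LorentzMetric n M) {P : TangentBundle (𝓡∂ n) M}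
    {U : Set M} (hU : IsOpen U) (hP : P.proj ∈ U) :
    ∃ ε > 0, ∀ᶠ P' in 𝓝 P, ∀ (c : ℝ → TangentBundle (𝓡∂ n) M) (h : ℝ), g.IsGeodesicOn c h → h ≤ ε →
      c 0 = P' → ∀ t ∈ Icc 0 h, (c t).proj ∈ U := by
  set q := P.proj
  have hsrc : P.proj ∈ (chartAt (EuclideanHalfSpace n) q).source := mem_chart_source _ _
  have hpre : (extChartAt (𝓡∂ n) q).symm ⁻¹' U ∈ 𝓝 (coord q P).1 :=
    (continuousAt_extChartAt_symm (I := 𝓡∂ n) q).preimage_mem_nhds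
      (by rw [extChartAt_to_inv]; exact hU.mem_nhds hP)
  obtain ⟨R, hR, hRU⟩ := Metric.mem_nhds_iff.1 hpre
  -- Solutions stay in the ball of radius `L.r`, which is chosen at most `R` so that the ball lies
  -- over `U`.
  obtain ⟨L, hLR⟩ := exists_localFlow g (z₀ := coord q P) (coord_fst_mem_target hsrc) hR
  refine ⟨L.ε, L.ε_pos, ?_⟩
  filter_upwards [eventually_proj_mem hsrc, (continuousAt_coord hsrc).eventually
    (Metric.isOpen_ball.mem_nhds (half_ball_mem L))] with P' h1 h2 c h hc hh hc0 t ht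
  subst hc0
  obtain ⟨h3, h4, -⟩ := L.solves hc hh h1 h2 t ht
  have h5 : (coord q (c t)).1 ∈ Metric.ball (coord q P).1 R := by
    refine lt_of_le_of_lt ?_ ((Metric.mem_ball.1 h4).trans_le hLR)
    rw [Prod.dist_eq]
    exact le_max_left _ _
  have h6 : (extChartAt (𝓡∂ n) q).symm (coord q (c t)).1 ∈ U := hRU h5
  have h7 : (extChartAt (𝓡∂ n) q).symm (coord q (c t)).1 = (c t).proj :=
    (extChartAt (𝓡∂ n) q).left_inv (by rw [extChartAt_source]; exact h3)
  rwa [h7] at h6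

end

/-! ### The first variation formula -/

section

variable {n : ℕ} [NeZero n]
  {M : Type*} [TopologicalSpace M] [ChartedSpace (EuclideanHalfSpace n) M] [IsManifold (𝓡∂ n) ∞ M]
  {g : LorentzMetric n M} {q : M} {α : Type*} {l : Filter α} {e : α → ℝ}

/-- The momentum at `P` paired with the coordinate displacement from `P` to `P'`. -/
def momentum (g : LorentzMetric n M) (q : M) (P P' : TangentBundle (𝓡∂ n) M) : ℝ :=
  metricIn g q (coord q P).1 (coord q P).2 ((coord q P').1 - (coord q P).1)

/-- `f` tends to `P`, with an error `O(e)` in the coordinates at `q`. -/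
structure NearIn (l : Filter α) (e : α → ℝ) (q : M) (P : TangentBundle (𝓡∂ n) M)
    (f : α → TangentBundle (𝓡∂ n) M) : Prop where
  tendsto : Tendsto f l (𝓝 P)
  isBigO : (fun s ↦ coord q (f s) - coord q P) =O[l] e

/-- The Lagrangian in coordinates. -/
def lagrangian (g : LorentzMetric n M) (q : M) (z : Coord n × Coord n) : ℝ :=
  1 / 2 * metricIn g q z.1 z.2 z.2

theorem contDiffWithinAt_lagrangian {z : Coord n × Coord n}
    (hz : z.1 ∈ (extChartAt (𝓡∂ n) q).target) :
    ContDiffWithinAt ℝ 2 (lagrangian g q) (range (𝓡∂ n) ×ˢ univ) z := by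
  have h1 : ContDiffWithinAt ℝ 2 (fun z : Coord n × Coord n ↦ metricIn g q z.1)
      (range (𝓡∂ n) ×ˢ univ) z :=
    ((contDiffWithinAt_metricIn g hz).of_le two_le_infty).comp z contDiffWithinAt_fst
      (fun w hw ↦ hw.1)
  exact contDiffWithinAt_const.mul ((h1.clm_apply contDiffWithinAt_snd).clm_apply
    contDiffWithinAt_snd)

theorem uniqueDiffOn_range_prod : UniqueDiffOn ℝ (range (𝓡∂ n) ×ˢ (univ : Set (Coord n))) :=
  uniqueDiffOn_range.prod uniqueDiffOn_univ

/-- This is the same expression as in `hasDerivWithinAt_momentum`: for the displacement between two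
geodesics, the time derivative of the momentum pairing is the differential of the Lagrangian in the
direction of the displacement. -/
theorem fderivWithin_lagrangian {z : Coord n × Coord n}
    (hz : z.1 ∈ (extChartAt (𝓡∂ n) q).target) (δ : Coord n × Coord n) :
    fderivWithin ℝ (lagrangian g q) (range (𝓡∂ n) ×ˢ univ) z δ =
      1 / 2 * fderivWithin ℝ (metricIn g q) (range (𝓡∂ n)) z.1 δ.1 z.2 z.2 +
        metricIn g q z.1 z.2 δ.2 := by
  have hG : HasFDerivWithinAt (metricIn g q)
      (fderivWithin ℝ (metricIn g q) (range (𝓡∂ n)) z.1) (range (𝓡∂ n)) z.1 :=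
    ((contDiffWithinAt_metricIn g hz).differentiableWithinAt (by simp)).hasFDerivWithinAt
  have hGx : HasFDerivWithinAt (fun z : Coord n × Coord n ↦ metricIn g q z.1) _
      (range (𝓡∂ n) ×ˢ univ) z :=
    HasFDerivWithinAt.comp (f := fun z : Coord n × Coord n ↦ z.1) z hG hasFDerivWithinAt_fst
      (fun w hw ↦ hw.1)
  have h := ((hGx.clm_apply hasFDerivWithinAt_snd).clm_apply hasFDerivWithinAt_snd).const_mul
    (1 / 2 : ℝ)
  have hu : UniqueDiffWithinAt ℝ (range (𝓡∂ n) ×ˢ (univ : Set (Coord n))) z :=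
    uniqueDiffOn_range_prod z ⟨extChartAt_target_subset_range q hz, mem_univ _⟩
  have h2 : fderivWithin ℝ (lagrangian g q) (range (𝓡∂ n) ×ˢ univ) z = _ := h.fderivWithin hu
  rw [h2]
  simp [metricIn_symm g q z.1 δ.2 z.2]
  ring

end

/-! ### Displacements and momenta under local isometries -/

section

variable {n : ℕ} [NeZero n]
  {M₁ : Type*} [TopologicalSpace M₁] [ChartedSpace (EuclideanHalfSpace n) M₁]
  [IsManifold (𝓡∂ n) ∞ M₁]
  {M₂ : Type*} [TopologicalSpace M₂] [ChartedSpace (EuclideanHalfSpace n) M₂]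
  [IsManifold (𝓡∂ n) ∞ M₂]
  {g₁ : LorentzMetric n M₁} {g₂ : LorentzMetric n M₂}
  {φ : PartialDiffeomorph (𝓡∂ n) (𝓡∂ n) M₁ M₂ ∞} {q₁ : M₁} {q₂ : M₂}
  {α : Type*} {l : Filter α} {e : α → ℝ}

theorem eventually_tangentMap_good {P : TangentBundle (𝓡∂ n) M₁}
    (h1 : P.proj ∈ (chartAt (EuclideanHalfSpace n) q₁).source)
    (h2 : P.proj ∈ φ.source) (h3 : φ P.proj ∈ (chartAt (EuclideanHalfSpace n) q₂).source) :
    ∀ᶠ P' in 𝓝 P, P'.proj ∈ (chartAt (EuclideanHalfSpace n) q₁).source ∧ P'.proj ∈ φ.source ∧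
      φ P'.proj ∈ (chartAt (EuclideanHalfSpace n) q₂).source := by
  have hproj := (FiberBundle.continuous_proj (Coord n) (TangentSpace (𝓡∂ n) (M := M₁)))
  refine (eventually_proj_mem h1).and ((hproj.continuousAt.eventually
    (φ.open_source.mem_nhds h2)).and ?_)
  exact (tendsto_tangentMap h2).eventually
    (eventually_proj_mem (P := tangentMap (𝓡∂ n) (𝓡∂ n) φ P) h3)

/-- Invariance of first order displacements under local diffeomorphisms. -/
theorem NearIn.map {P : TangentBundle (𝓡∂ n) M₁} {f : α → TangentBundle (𝓡∂ n) M₁}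
    (hf : NearIn l e q₁ P f) (h1 : P.proj ∈ (chartAt (EuclideanHalfSpace n) q₁).source)
    (h2 : P.proj ∈ φ.source) (h3 : φ P.proj ∈ (chartAt (EuclideanHalfSpace n) q₂).source) :
    NearIn l e q₂ (tangentMap (𝓡∂ n) (𝓡∂ n) φ P)
      (fun s ↦ tangentMap (𝓡∂ n) (𝓡∂ n) φ (f s)) := by
  refine ⟨(tendsto_tangentMap h2).tendsto.comp hf.tendsto, ?_⟩
  have hdom : (coord q₁ P).1 ∈ coordDomain φ q₁ q₂ := coordDomain_mem φ h1 h2 h3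
  set Φ : Coord n × Coord n → Coord n × Coord n := fun z ↦
    (coordMap φ q₁ q₂ z.1, fderivWithin ℝ (coordMap φ q₁ q₂) (range (𝓡∂ n)) z.1 z.2)
  have hΨ : ContDiffWithinAt ℝ 2 (coordMap φ q₁ q₂) (range (𝓡∂ n)) (coord q₁ P).1 :=
    (contDiffWithinAt_coordMap φ hdom).of_le two_le_infty
  have hfst : ContDiffWithinAt ℝ 1 (fun z : Coord n × Coord n ↦ z.1) (range (𝓡∂ n) ×ˢ univ)
      (coord q₁ P) := contDiffWithinAt_fst
  have hd1 : ContDiffWithinAt ℝ 1 (fun z : Coord n × Coord n ↦ coordMap φ q₁ q₂ z.1)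
      (range (𝓡∂ n) ×ˢ univ) (coord q₁ P) :=
    ContDiffWithinAt.comp (f := fun z : Coord n × Coord n ↦ z.1) (coord q₁ P)
      (hΨ.of_le (by norm_num)) hfst (fun w hw ↦ hw.1)
  have hd2 : ContDiffWithinAt ℝ 1 (fun z : Coord n × Coord n ↦
      fderivWithin ℝ (coordMap φ q₁ q₂) (range (𝓡∂ n)) z.1)
      (range (𝓡∂ n) ×ˢ univ) (coord q₁ P) :=
    ContDiffWithinAt.comp (f := fun z : Coord n × Coord n ↦ z.1) (coord q₁ P)
      (hΨ.fderivWithin_right uniqueDiffOn_range (by norm_num) (coord_fst_mem_range _ _)) hfst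
      (fun w hw ↦ hw.1)
  have hΦ : DifferentiableWithinAt ℝ Φ (range (𝓡∂ n) ×ˢ univ) (coord q₁ P) :=
    (hd1.prodMk (hd2.clm_apply contDiffWithinAt_snd)).differentiableWithinAt (by norm_num)
  have htend : Tendsto (fun s ↦ coord q₁ (f s)) l (𝓝[range (𝓡∂ n) ×ˢ univ] (coord q₁ P)) :=
    tendsto_nhdsWithin_iff.2 ⟨(continuousAt_coord h1).tendsto.comp hf.tendsto,
      Eventually.of_forall fun s ↦ ⟨coord_fst_mem_range _ _, mem_univ _⟩⟩
  have hO := (hΦ.hasFDerivWithinAt.isBigO_sub.comp_tendsto htend).trans hf.isBigO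
  refine hO.congr' ?_ EventuallyEq.rfl
  filter_upwards [hf.tendsto.eventually (eventually_tangentMap_good h1 h2 h3)] with s hs
  simp only [Function.comp_apply, Φ]
  rw [coord_tangentMap φ h1 h2 h3, coord_tangentMap φ hs.1 hs.2.1 hs.2.2]

/-- A coordinate difference transforms by the derivative of the coordinate map up to a quadratic
Taylor error, and the isometry makes the linear part of the pairing invariant. Momentum pairings
thus behave like invariant quantities modulo O(e²). -/
theorem NearIn.momentum_map (hφ : IsometricOn g₁ g₂ φ) {P : TangentBundle (𝓡∂ n) M₁}
    {f : α → TangentBundle (𝓡∂ n) M₁}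
    (hf : NearIn l e q₁ P f) (h1 : P.proj ∈ (chartAt (EuclideanHalfSpace n) q₁).source)
    (h2 : P.proj ∈ φ.source) (h3 : φ P.proj ∈ (chartAt (EuclideanHalfSpace n) q₂).source) :
    (fun s ↦ momentum g₂ q₂ (tangentMap (𝓡∂ n) (𝓡∂ n) φ P) (tangentMap (𝓡∂ n) (𝓡∂ n) φ (f s)) -
      momentum g₁ q₁ P (f s)) =O[l] fun s ↦ e s ^ 2 := by
  have hdom : (coord q₁ P).1 ∈ coordDomain φ q₁ q₂ := coordDomain_mem φ h1 h2 h3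
  have hΨ : ContDiffWithinAt ℝ 2 (coordMap φ q₁ q₂) (range (𝓡∂ n)) (coord q₁ P).1 :=
    (contDiffWithinAt_coordMap φ hdom).of_le two_le_infty
  obtain ⟨C, hC, r, hr, hT⟩ := exists_taylor_bound hΨ range_convex uniqueDiffOn_range
    (coord_fst_mem_range _ _)
  set G := metricIn g₂ q₂ (coordMap φ q₁ q₂ (coord q₁ P).1)
    (fderivWithin ℝ (coordMap φ q₁ q₂) (range (𝓡∂ n)) (coord q₁ P).1 (coord q₁ P).2) with hG
  have htend : Tendsto (fun s ↦ (coord q₁ (f s)).1) l (𝓝 (coord q₁ P).1) :=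
    (continuous_fst.tendsto _).comp ((continuousAt_coord h1).tendsto.comp hf.tendsto)
  have hsq : (fun s ↦ ‖(coord q₁ (f s)).1 - (coord q₁ P).1‖ ^ 2) =O[l] fun s ↦ e s ^ 2 := by
    refine IsBigO.pow ?_ 2
    exact (IsBigO.of_bound 1 (Eventually.of_forall fun s ↦ by
      simpa using norm_fst_le (coord q₁ (f s) - coord q₁ P))).trans hf.isBigO
  refine IsBigO.trans (IsBigO.of_bound (‖G‖ * C) ?_) hsq
  filter_upwards [hf.tendsto.eventually (eventually_tangentMap_good h1 h2 h3),
    htend.eventually (Metric.ball_mem_nhds _ hr)] with s hs hball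
  have hb := hT (coord q₁ P).1 ⟨Metric.mem_ball_self hr, coord_fst_mem_range _ _⟩
    (coord q₁ (f s)).1 ⟨hball, coord_fst_mem_range _ _⟩
  unfold momentum
  rw [coord_tangentMap φ h1 h2 h3, coord_tangentMap φ hs.1 hs.2.1 hs.2.2,
    hφ.metricIn (q₂ := q₂) hdom]
  simp only [← hG]
  rw [← map_sub]
  refine (G.le_opNorm _).trans ?_
  rw [norm_pow, norm_norm, mul_assoc]
  gcongr

end

/-! ### The first variation formula along a whole geodesic -/

section

variable {n : ℕ} [NeZero n]
  {M : Type*} [TopologicalSpace M] [ChartedSpace (EuclideanHalfSpace n) M] [IsManifold (𝓡∂ n) ∞ M]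
  {g : LorentzMetric n M} {q q' : M} {α : Type*} {l : Filter α} {e : α → ℝ}

theorem NearIn.change_chart {P : TangentBundle (𝓡∂ n) M} {f : α → TangentBundle (𝓡∂ n) M}
    (hf : NearIn l e q P f) (h1 : P.proj ∈ (chartAt (EuclideanHalfSpace n) q).source)
    (h2 : P.proj ∈ (chartAt (EuclideanHalfSpace n) q').source) : NearIn l e q' P f := by
  have := hf.map (φ := idDiffeo n M) h1 (mem_univ _) h2
  simpa only [tangentMap_idDiffeo] using this

theorem NearIn.momentum_change_chart {P : TangentBundle (𝓡∂ n) M}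
    {f : α → TangentBundle (𝓡∂ n) M}
    (hf : NearIn l e q P f) (h1 : P.proj ∈ (chartAt (EuclideanHalfSpace n) q).source)
    (h2 : P.proj ∈ (chartAt (EuclideanHalfSpace n) q').source) :
    (fun s ↦ momentum g q' P (f s) - momentum g q P (f s)) =O[l] fun s ↦ e s ^ 2 := by
  have := hf.momentum_map (isometricOn_id g) h1 (mem_univ _) h2
  simpa only [tangentMap_idDiffeo] using this

/-- The energy of a tangent vector. -/
def energy (g : LorentzMetric n M) (P : TangentBundle (𝓡∂ n) M) : ℝ := g.inner P.proj P.snd P.snd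

theorem lagrangian_coord {P : TangentBundle (𝓡∂ n) M}
    (hP : P.proj ∈ (chartAt (EuclideanHalfSpace n) q).source) :
    lagrangian g q (coord q P) = 1 / 2 * energy g P := by
  rw [lagrangian, metricIn_coord hP, energy]

/-- The first variation formula on a short interval. -/
theorem first_variation_local [T2Space M] {P : TangentBundle (𝓡∂ n) M}
    (hP : P.proj ∈ (chartAt (EuclideanHalfSpace n) q).source) :
    ∃ ε > 0, ∀ᶠ P₀ in 𝓝 P, ∀ (γ : ℝ → TangentBundle (𝓡∂ n) M) (h : ℝ)
      (c : α → ℝ → TangentBundle (𝓡∂ n) M), γ 0 = P₀ → g.IsGeodesicOn γ h → 0 ≤ h → h ≤ ε →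
      (∀ᶠ s in l, g.IsGeodesicOn (c s) h) → NearIn l e q (γ 0) (fun s ↦ c s 0) →
      (fun s ↦ coord q (c s h) - coord q (γ h)) =O[l] e ∧
      (fun s ↦ momentum g q (γ h) (c s h) - momentum g q (γ 0) (c s 0) -
        h * ((energy g (c s 0) - energy g (γ 0)) / 2)) =O[l] fun s ↦ e s ^ 2 := by
  obtain ⟨C, hC, r, hr, hT⟩ := exists_taylor_bound
    (contDiffWithinAt_lagrangian (g := g) (coord_fst_mem_target hP))
    (range_convex.prod convex_univ) uniqueDiffOn_range_prod
    ⟨coord_fst_mem_range _ _, mem_univ _⟩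
  obtain ⟨L, hLr⟩ := exists_localFlow g (coord_fst_mem_target hP) hr
  refine ⟨L.ε, L.ε_pos, ?_⟩
  filter_upwards [eventually_proj_mem hP, (continuousAt_coord hP).eventually
    (Metric.isOpen_ball.mem_nhds (half_ball_mem L))] with P₀ hsrc hball γ h c hγ0 hγ hh0 hh hc hnear
  subst hγ0
  have hsolγ := L.solves hγ hh hsrc hball
  have hgood : ∀ᶠ s in l, (c s 0).proj ∈ (chartAt (EuclideanHalfSpace n) q).source ∧
      coord q (c s 0) ∈ Metric.ball (coord q P) (L.r / 2) :=
    (hnear.tendsto.eventually (eventually_proj_mem hsrc)).and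
      (((continuousAt_coord hsrc).tendsto.comp hnear.tendsto).eventually
        (Metric.isOpen_ball.mem_nhds hball))
  set D : ℝ := Real.exp (L.K * h) with hD
  have hdist : ∀ᶠ s in l, ∀ t ∈ Icc 0 h, ‖coord q (c s t) - coord q (γ t)‖ ≤
      D * ‖coord q (c s 0) - coord q (γ 0)‖ := by
    filter_upwards [hgood, hc] with s hs hcs t ht
    have hsol := L.solves hcs hh hs.1 hs.2
    have := dist_le_of_solutions L.lip (fun t ht ↦ (hsol t ht).2.2)
      (fun t ht ↦ (hsolγ t ht).2.2) t ht
    rw [dist_eq_norm, dist_eq_norm, mul_comm] at this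
    refine this.trans ?_
    rw [hD]
    gcongr
    linarith [ht.2]
  refine ⟨(IsBigO.of_bound D (hdist.mono fun s hs ↦ hs h ⟨hh0, le_rfl⟩)).trans hnear.isBigO, ?_⟩
  refine IsBigO.trans (IsBigO.of_bound (C * D ^ 2 * h) ?_) (hnear.isBigO.norm_left.pow 2)
  filter_upwards [hgood, hc, hdist] with s hs hcs hds
  have hsol := L.solves hcs hh hs.1 hs.2
  -- By conservation of energy, `lam` is the difference of the two Lagrangians at every time. The
  -- derivative of the pairing is the linear part of this difference, so the derivative of `b` is
  -- just a second order Taylor remainder.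
  set lam := (energy g (c s 0) - energy g (γ 0)) / 2 with hlam
  set b : ℝ → ℝ := fun t ↦ momentum g q (γ t) (c s t) - t * lam with hb
  have hder : ∀ t ∈ Icc 0 h, HasDerivWithinAt b
      (fderivWithin ℝ (lagrangian g q) (range (𝓡∂ n) ×ˢ univ) (coord q (γ t))
        (coord q (c s t) - coord q (γ t)) - 1 * lam) (Icc 0 h) t := by
    intro t ht
    have hz : HasDerivWithinAt (fun t ↦ coord q (γ t)) (sprayIn g q (coord q (γ t))) (Icc 0 h) t :=
      hγ.geodesicAt ht (hsolγ t ht).1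
    have hw : HasDerivWithinAt (fun t ↦ coord q (c s t)) (sprayIn g q (coord q (c s t)))
        (Icc 0 h) t := hcs.geodesicAt ht (hsol t ht).1
    have hmem := coord_fst_mem_target (hsolγ t ht).1
    have hm := hasDerivWithinAt_momentum hz hmem (fun s _ ↦ coord_fst_mem_range _ _)
      ((hasDerivWithinAt_fst hw).sub (hasDerivWithinAt_fst hz))
    refine HasDerivWithinAt.sub (hm.congr_deriv ?_) ((hasDerivWithinAt_id t _).mul_const lam)
    rw [fderivWithin_lagrangian hmem]
    rfl
  have hbound : ∀ t ∈ Icc 0 h, ‖fderivWithin ℝ (lagrangian g q) (range (𝓡∂ n) ×ˢ univ)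
      (coord q (γ t)) (coord q (c s t) - coord q (γ t)) - 1 * lam‖ ≤
      C * D ^ 2 * ‖coord q (c s 0) - coord q (γ 0)‖ ^ 2 := by
    intro t ht
    have hsub := Metric.ball_subset_ball hLr (x := coord q P)
    have h1 := hT (coord q (γ t)) ⟨hsub (hsolγ t ht).2.1, coord_fst_mem_range _ _, mem_univ _⟩
      (coord q (c s t)) ⟨hsub (hsol t ht).2.1, coord_fst_mem_range _ _, mem_univ _⟩
    rw [lagrangian_coord (hsol t ht).1, lagrangian_coord (hsolγ t ht).1] at h1
    have e1 : energy g (c s t) = energy g (c s 0) := hcs.energy_eq ht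
    have e2 : energy g (γ t) = energy g (γ 0) := hγ.energy_eq ht
    rw [e1, e2, norm_sub_rev] at h1
    refine (le_of_eq ?_).trans (h1.trans ?_)
    · congr 1; rw [hlam]; ring
    · have := hds t ht
      rw [mul_assoc, ← mul_pow]
      gcongr
  have hmv := (convex_Icc 0 h).norm_image_sub_le_of_norm_hasDerivWithin_le hder hbound
    (show (0 : ℝ) ∈ Icc 0 h from ⟨le_rfl, hh0⟩) (show h ∈ Icc 0 h from ⟨hh0, le_rfl⟩)
  rw [sub_zero, Real.norm_of_nonneg hh0] at hmv
  refine (le_of_eq ?_).trans (hmv.trans (le_of_eq ?_))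
  · congr 1; simp only [hb]; ring
  · rw [norm_pow, norm_norm]; ring

/-- The first variation formula: along a variation of geodesics, the momentum paired with the
variation field grows with half the variation of the energy. -/
theorem first_variation [T2Space M] [l.NeBot] {γ : ℝ → TangentBundle (𝓡∂ n) M} {T : ℝ} (hT : 0 ≤ T)
    (hγ : g.IsGeodesicOn γ T) {c : α → ℝ → TangentBundle (𝓡∂ n) M}
    (hc : ∀ᶠ s in l, g.IsGeodesicOn (c s) T)
    (hnear : NearIn l e (γ 0).proj (γ 0) (fun s ↦ c s 0)) :
    NearIn l e (γ T).proj (γ T) (fun s ↦ c s T) ∧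
    (fun s ↦ momentum g (γ T).proj (γ T) (c s T) - momentum g (γ 0).proj (γ 0) (c s 0) -
        T * ((energy g (c s 0) - energy g (γ 0)) / 2)) =O[l] fun s ↦ e s ^ 2 := by
  have hsrc : ∀ P : TangentBundle (𝓡∂ n) M, P.proj ∈ (chartAt (EuclideanHalfSpace n) P.proj).source :=
    fun P ↦ mem_chart_source _ _
  refine real_induction_of_local (P := fun T ↦ NearIn l e (γ T).proj (γ T) (fun s ↦ c s T) ∧
    (fun s ↦ momentum g (γ T).proj (γ T) (c s T) - momentum g (γ 0).proj (γ 0) (c s 0) -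
        T * ((energy g (c s 0) - energy g (γ 0)) / 2)) =O[l] fun s ↦ e s ^ 2) hT ?_ ?_
  · refine ⟨hnear, ?_⟩
    simp only [sub_self, zero_mul]
    exact isBigO_zero _ _
  intro t₀ ht₀
  set q := (γ t₀).proj
  obtain ⟨ε, hε, hloc⟩ := first_variation_local (g := g) (l := l) (e := e) (hsrc (γ t₀))
  have hev : ∀ᶠ a in 𝓝[Icc 0 T] t₀, (γ a).proj ∈ (chartAt (EuclideanHalfSpace n) q).source ∧ _ :=
    ((hγ.1 t₀ ht₀).eventually (eventually_proj_mem (hsrc _))).and ((hγ.1 t₀ ht₀).eventually hloc)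
  obtain ⟨δ, hδ, hδ'⟩ := Metric.mem_nhdsWithin_iff.1 hev
  refine ⟨min δ (ε / 2), lt_min hδ (half_pos hε), ?_⟩
  intro a ha b hb hat hbt hab hPa
  obtain ⟨hasrc, haloc⟩ := hδ' ⟨show dist a t₀ < δ from hat.trans_le (min_le_left _ _), ha⟩
  obtain ⟨hbsrc, -⟩ := hδ' ⟨show dist b t₀ < δ from hbt.trans_le (min_le_left _ _), hb⟩
  have hba : b - a ≤ ε := by
    have h1 := abs_lt.1 (hat.trans_le (min_le_right _ _))
    have h2 := abs_lt.1 (hbt.trans_le (min_le_right _ _))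
    linarith
  have hna := hPa.1.change_chart (hsrc _) hasrc
  obtain ⟨h1, h2⟩ := haloc (fun t ↦ γ (t + a)) (b - a) (fun s t ↦ c s (t + a)) (by simp)
    ((hγ.mono hb.2).shift ha.1) (by linarith) hba
    (hc.mono fun s hs ↦ (hs.mono hb.2).shift ha.1) (by simpa using hna)
  simp only [sub_add_cancel, zero_add] at h1 h2
  have htend : Tendsto (fun s ↦ c s b) l (𝓝 (γ b)) :=
    hγ.tendsto (T := fun _ ↦ b) (hc.mono fun s hs ↦ hs.mono hb.2) hnear.tendsto
      (Eventually.of_forall fun _ ↦ hb.1) tendsto_const_nhds hb.2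
  have hnb : NearIn l e q (γ b) (fun s ↦ c s b) := ⟨htend, h1⟩
  refine ⟨hnb.change_chart hbsrc (hsrc _), ?_⟩
  -- The local formula lives in the chart at γ(t₀), the claim in the charts at γ(a) and γ(b). Both
  -- changes of chart cost O(e²), and the energy terms add up because energies are constant in time.
  have hmb := hnb.momentum_change_chart (g := g) hbsrc (hsrc (γ b))
  have hma := hPa.1.momentum_change_chart (g := g) (hsrc (γ a)) hasrc
  refine (((hmb.add h2).add hma).add hPa.2).congr' ?_ EventuallyEq.rfl
  filter_upwards [hc] with s hs
  have e1 : energy g (c s a) = energy g (c s 0) := hs.energy_eq ha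
  have e2 : energy g (γ a) = energy g (γ 0) := hγ.energy_eq ha
  rw [e1, e2]
  ring

end

/-! ### Estimates for short times -/

section

variable {n : ℕ} [NeZero n]
  {M : Type*} [TopologicalSpace M] [ChartedSpace (EuclideanHalfSpace n) M] [IsManifold (𝓡∂ n) ∞ M]
  {g : LorentzMetric n M} {q : M} {α : Type*} {l : Filter α} {e : α → ℝ}

/-- If `x` has velocity `v` with acceleration bounded by `B`, then `x` is linear up to a
quadratic error. -/
theorem norm_sub_sub_smul_le {V : Type*} [NormedAddCommGroup V] [NormedSpace ℝ V]
    {x v a : ℝ → V} {h B : ℝ}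
    (hx : ∀ t ∈ Icc 0 h, HasDerivWithinAt x (v t) (Icc 0 h) t)
    (hv : ∀ t ∈ Icc 0 h, HasDerivWithinAt v (a t) (Icc 0 h) t)
    (hB : ∀ t ∈ Icc 0 h, ‖a t‖ ≤ B) {t : ℝ} (ht : t ∈ Icc 0 h) :
    ‖x t - x 0 - t • v 0‖ ≤ B * t ^ 2 := by
  have h0 : (0 : ℝ) ∈ Icc 0 h := ⟨le_rfl, ht.1.trans ht.2⟩
  have hB0 : 0 ≤ B := (norm_nonneg _).trans (hB 0 h0)
  have hvb : ∀ s ∈ Icc 0 t, ‖v s - v 0‖ ≤ B * t := fun s hs ↦ by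
    have := (convex_Icc 0 h).norm_image_sub_le_of_norm_hasDerivWithin_le hv hB h0
      (show s ∈ Icc 0 h from ⟨hs.1, hs.2.trans ht.2⟩)
    rw [sub_zero, Real.norm_of_nonneg hs.1] at this
    exact this.trans (by gcongr; exact hs.2)
  have hsub : Icc 0 t ⊆ Icc 0 h := Icc_subset_Icc_right ht.2
  have hder : ∀ s ∈ Icc 0 t, HasDerivWithinAt (fun s ↦ x s - s • v 0) (v s - (1 : ℝ) • v 0)
      (Icc 0 t) s := fun s hs ↦
    ((hx s (hsub hs)).mono hsub).sub ((hasDerivWithinAt_id s _).smul_const (v 0))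
  have := (convex_Icc 0 t).norm_image_sub_le_of_norm_hasDerivWithin_le hder
    (fun s hs ↦ by rw [one_smul]; exact hvb s hs) (show (0 : ℝ) ∈ Icc 0 t from ⟨le_rfl, ht.1⟩)
    (show t ∈ Icc 0 t from ⟨ht.1, le_rfl⟩)
  rw [sub_zero, Real.norm_of_nonneg ht.1] at this
  refine (le_of_eq ?_).trans (this.trans (le_of_eq (by ring)))
  congr 1
  simp only [zero_smul, sub_zero]
  abel

/-- Near `P` the Lipschitz field is bounded, which bounds the acceleration uniformly for all
geodesics starting nearby. -/
theorem exists_short_time_bound [T2Space M] (g : LorentzMetric n M) {P : TangentBundle (𝓡∂ n) M}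
    (hP : P.proj ∈ (chartAt (EuclideanHalfSpace n) q).source) :
    ∃ ε > 0, ∃ C ≥ 0, ∀ᶠ P' in 𝓝 P, ∀ (c : ℝ → TangentBundle (𝓡∂ n) M) (h : ℝ), c 0 = P' →
      g.IsGeodesicOn c h → 0 ≤ h → h ≤ ε →
      ‖(coord q (c h)).1 - (coord q (c 0)).1 - h • (coord q (c 0)).2‖ ≤ C * h ^ 2 := by
  obtain ⟨L, -⟩ := exists_localFlow g (coord_fst_mem_target hP) one_pos
  refine ⟨L.ε, L.ε_pos, L.K * L.r + ‖L.F (coord q P)‖,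
    add_nonneg (mul_nonneg L.K.2 L.r_pos.le) (norm_nonneg _), ?_⟩
  filter_upwards [eventually_proj_mem hP, (continuousAt_coord hP).eventually
    (Metric.isOpen_ball.mem_nhds (half_ball_mem L))] with P' h1 h2 c h hc0 hc hh0 hh
  subst hc0
  have hsol := L.solves hc hh h1 h2
  refine norm_sub_sub_smul_le (x := fun t ↦ (coord q (c t)).1) (v := fun t ↦ (coord q (c t)).2)
    (a := fun t ↦ (L.F (coord q (c t))).2)
    (fun t ht ↦ ?_) (fun t ht ↦ hasDerivWithinAt_snd (hsol t ht).2.2) (fun t ht ↦ ?_)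
    (show h ∈ Icc 0 h from ⟨hh0, le_rfl⟩)
  · have := hasDerivWithinAt_fst (hsol t ht).2.2
    rwa [L.fst_eq] at this
  · have h3 := L.lip.dist_le_mul (coord q (c t)) (coord q P)
    have h4 := (Metric.mem_ball.1 (hsol t ht).2.1).le
    refine (norm_snd_le _).trans ?_
    have h5 := norm_le_norm_add_norm_sub' (L.F (coord q (c t))) (L.F (coord q P))
    rw [← dist_eq_norm] at h5
    have h6 : (L.K : ℝ) * dist (coord q (c t)) (coord q P) ≤ L.K * L.r := by gcongr
    linarith

/-- Moving along a null geodesic for a time `d → 0` changes the momentum only to second order. -/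
theorem momentum_sub_isBigO [T2Space M] {R : TangentBundle (𝓡∂ n) M}
    (hR : R.proj ∈ (chartAt (EuclideanHalfSpace n) q).source) (hne : R.snd ≠ 0)
    (hnull : energy g R = 0) (he : Tendsto e l (𝓝 0)) {a b : α → TangentBundle (𝓡∂ n) M}
    (ha : NearIn l e q R a) (hb : NearIn l e q R b) {d : α → ℝ} (hd : Tendsto d l (𝓝 0))
    (hconn : ∀ᶠ s in l, (0 ≤ d s ∧ ∃ k, g.IsGeodesicOn k (d s) ∧ k 0 = a s ∧ k (d s) = b s) ∨
      (d s ≤ 0 ∧ ∃ k, g.IsGeodesicOn k (-d s) ∧ k 0 = b s ∧ k (-d s) = a s)) :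
    (fun s ↦ momentum g q R (b s) - momentum g q R (a s)) =O[l] fun s ↦ e s ^ 2 := by
  obtain ⟨ε, hε, C, hC, hbound⟩ := exists_short_time_bound g hR
  set v := (coord q R).2 with hv
  have hv0 : 0 < ‖v‖ := by
    refine norm_pos_iff.2 fun h ↦ hne ?_
    have := symmL_coord_snd hR R.snd
    rw [show (coord q (⟨R.proj, R.snd⟩ : TangentBundle (𝓡∂ n) M)).2 = 0 from h, map_zero] at this
    exact this.symm
  set w : α → Coord n := fun s ↦ (coord q (b s)).1 - (coord q (a s)).1 with hw
  set ρ : α → ℝ := fun s ↦ ‖coord q (a s) - coord q R‖ + ‖coord q (b s) - coord q R‖ with hρ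
  have hρO : ρ =O[l] e := ha.isBigO.norm_left.add hb.isBigO.norm_left
  have hρ0 : Tendsto ρ l (𝓝 0) := hρO.trans_tendsto he
  have hwO : w =O[l] e := by
    refine (IsBigO.of_bound 1 (Eventually.of_forall fun s ↦ ?_)).trans
      (hb.isBigO.sub ha.isBigO)
    simpa [hw] using norm_fst_le (coord q (b s) - coord q R - (coord q (a s) - coord q R))
  have hest : ∀ᶠ s in l, ‖w s - d s • v‖ ≤ C * |d s| ^ 2 + |d s| * ρ s := by
    have hsmall : ∀ᶠ s in l, |d s| ≤ ε := by
      have := hd.abs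
      rw [abs_zero] at this
      exact (this.eventually (gt_mem_nhds hε)).mono fun _ h ↦ le_of_lt h
    filter_upwards [hconn, hsmall, ha.tendsto.eventually hbound, hb.tendsto.eventually hbound]
      with s hs hsε hba hbb
    have hva : ‖(coord q (a s)).2 - v‖ ≤ ρ s := by
      have := norm_snd_le (coord q (a s) - coord q R)
      simp only [Prod.snd_sub] at this
      exact this.trans (le_add_of_nonneg_right (norm_nonneg _))
    have hvb : ‖(coord q (b s)).2 - v‖ ≤ ρ s := by
      have := norm_snd_le (coord q (b s) - coord q R)
      simp only [Prod.snd_sub] at this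
      exact this.trans (le_add_of_nonneg_left (norm_nonneg _))
    have key : ∀ (u : Coord n), ‖w s - d s • u‖ ≤ C * |d s| ^ 2 → ‖u - v‖ ≤ ρ s →
        ‖w s - d s • v‖ ≤ C * |d s| ^ 2 + |d s| * ρ s := by
      intro u h1 h2
      have : w s - d s • v = (w s - d s • u) + d s • (u - v) := by rw [smul_sub]; abel
      rw [this]
      refine (norm_add_le _ _).trans (add_le_add h1 ?_)
      rw [norm_smul, Real.norm_eq_abs]
      gcongr
    rcases hs with ⟨hd0, k, hk, hk0, hk1⟩ | ⟨hd0, k, hk, hk0, hk1⟩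
    · have h1 := hba k (d s) hk0 hk hd0 ((le_abs_self _).trans hsε)
      rw [hk1, hk0] at h1
      exact key _ (by rw [sq_abs]; exact h1) hva
    · have h1 := hbb k (-d s) hk0 hk (by linarith) ((neg_le_abs _).trans hsε)
      rw [hk1, hk0] at h1
      refine key _ ?_ hvb
      rw [sq_abs, ← neg_sq, ← norm_neg]
      refine (le_of_eq ?_).trans h1
      congr 1
      simp only [neg_smul, hw]
      abel
  -- Because the velocity `v` is nonzero, the displacement `w` of size O(e) controls the elapsed
  -- time: the error terms are eventually at most |d|‖v‖/2 and can be absorbed.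
  have hdO : d =O[l] e := by
    refine (IsBigO.of_bound (2 / ‖v‖) ?_).trans hwO
    have hlim : Tendsto (fun s ↦ C * |d s| + ρ s) l (𝓝 0) := by
      simpa using (hd.abs.const_mul C).add hρ0
    filter_upwards [hest, hlim.eventually (gt_mem_nhds (half_pos hv0))] with s h1 h2
    have h3 : |d s| * ‖v‖ ≤ ‖w s‖ + |d s| * (‖v‖ / 2) := by
      rw [← Real.norm_eq_abs, ← norm_smul]
      have h4 : d s • v = w s - (w s - d s • v) := by abel
      rw [h4]
      refine (norm_sub_le _ _).trans ?_
      gcongr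
      refine h1.trans ?_
      rw [Real.norm_eq_abs]
      nlinarith [abs_nonneg (d s)]
    rw [Real.norm_eq_abs, div_mul_eq_mul_div, le_div_iff₀ hv0]
    linarith
  have hfin : (fun s ↦ w s - d s • v) =O[l] fun s ↦ e s ^ 2 := by
    refine (IsBigO.of_bound 1 (g := fun s ↦ C * d s ^ 2 + |d s| * ρ s) ?_).trans
      (((hdO.pow 2).const_mul_left C).add
        ((hdO.norm_left.mul hρO).congr_right fun s ↦ (sq (e s)).symm))
    filter_upwards [hest] with s hs
    rw [one_mul]
    refine hs.trans ((le_of_eq ?_).trans (le_abs_self _))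
    rw [sq_abs]
  refine (((metricIn g q (coord q R).1 v).isBigO_comp _ _).trans hfin).congr_left fun s ↦ ?_
  -- The first order part of the displacement is d·v, and its pairing with the null vector `v`
  -- vanishes; only the O(e²) part survives.
  have h1 : metricIn g q (coord q R).1 v v = 0 := by rw [hv, metricIn_coord hR]; exact hnull
  rw [map_sub, map_smul, h1, smul_zero, sub_zero, momentum, momentum, ← map_sub]
  congr 1
  simp only [hw]
  abel

/-! ### Tilting the initial velocity -/

/-- The tangent vector at `x` with coordinates `ξ` in the chart at `x`. -/
def tangentOf (x : M) (ξ : Coord n) : TangentSpace (𝓡∂ n) x := ξ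

/-- The vector `p + s ξ`. -/
def tilt (p : TangentBundle (𝓡∂ n) M) (ξ : Coord n) (s : ℝ) :
    TangentBundle (𝓡∂ n) M := ⟨p.proj, p.snd + s • tangentOf p.proj ξ⟩

theorem coord_tilt (p : TangentBundle (𝓡∂ n) M) (ξ : Coord n) (s : ℝ) :
    coord p.proj (tilt p ξ s) = coord p.proj p + s • ((0 : Coord n), ξ) := by
  refine Prod.ext ?_ ?_
  · have : (coord p.proj (tilt p ξ s)).1 = (coord p.proj p).1 := rfl
    rw [this]
    simp
  · have h1 := coord_self (tilt p ξ s)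
    have h2 := coord_self p
    rw [Prod.snd_add, h2]
    exact h1

theorem nearIn_tilt (p : TangentBundle (𝓡∂ n) M) (ξ : Coord n) :
    NearIn (𝓝[>] 0) (fun s ↦ s) p.proj p (tilt p ξ) := by
  refine ⟨tendsto_of_coord (q := p.proj) (mem_chart_source _ _)
    (Eventually.of_forall fun s ↦ mem_chart_source _ _) ?_, ?_⟩
  · simp only [coord_tilt]
    have h : Continuous fun s : ℝ ↦ coord p.proj p + s • ((0 : Coord n), ξ) := by
      fun_prop
    have h2 := h.tendsto 0
    rw [zero_smul, add_zero] at h2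
    exact h2.mono_left nhdsWithin_le_nhds
  · refine IsBigO.of_bound ‖((0 : Coord n), ξ)‖ (Eventually.of_forall fun s ↦ ?_)
    rw [coord_tilt, add_sub_cancel_left, norm_smul, mul_comm]

/-- Tilting the initial velocity of a geodesic inward yields geodesics that move into the interior
for a uniform time. -/
theorem exists_geodesic_tilt [T2Space M] {p : TangentBundle (𝓡∂ n) M} {δ : ℝ} (hδ : 0 < δ)
    (hp : δ ∈ g.stayTimes p) (ξ : Coord n) (hξ : 0 < ξ 0) :
    ∃ δ' > 0, ∀ᶠ s in 𝓝[>] (0 : ℝ), ∃ c, g.IsGeodesicOn c δ' ∧ c 0 = tilt p ξ s ∧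
      ∀ t ∈ Ioc 0 δ', (c t).proj ∈ (𝓡∂ n).interior M := by
  obtain ⟨-, γ, hγ, rfl⟩ := hp
  set q := (γ 0).proj
  have hsrc : (γ 0).proj ∈ (chartAt (EuclideanHalfSpace n) q).source := mem_chart_source _ _
  obtain ⟨L, -⟩ := exists_localFlow g (z₀ := coord q (γ 0)) (coord_fst_mem_target hsrc) one_pos
  set E := Real.exp (L.K * L.ε)
  set N := ‖((0 : Coord n), ξ)‖
  set B : ℝ := L.K * (N * E) with hB
  have hB0 : 0 ≤ B := by positivity
  -- `B` does not depend on s, hence neither does δ'. The last bound gives B·δ' < ξ₀, so the inward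
  -- push of the tilt dominates the quadratic error on all of [0, δ'].
  set δ' := min (min L.ε δ) (ξ 0 / (B + 1) / 2) with hδ'
  have hδ'0 : 0 < δ' := lt_min (lt_min L.ε_pos hδ) (by positivity)
  have hδ'ε : δ' ≤ L.ε := (min_le_left _ _).trans (min_le_left _ _)
  have hδ'δ : δ' ≤ δ := (min_le_left _ _).trans (min_le_right _ _)
  have hBδ : B * δ' < ξ 0 := by
    have h1 : δ' ≤ ξ 0 / (B + 1) / 2 := min_le_right _ _
    have h2 : (B + 1) * δ' < ξ 0 := by
      rw [← lt_div_iff₀' (by positivity)]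
      have : 0 < ξ 0 / (B + 1) := by positivity
      linarith
    nlinarith
  refine ⟨δ', hδ'0, ?_⟩
  have hsolγ := L.solves (hγ.mono hδ'δ) hδ'ε hsrc (half_ball_mem L)
  have hsub : Icc 0 δ' ⊆ Icc 0 L.ε := Icc_subset_Icc_right hδ'ε
  have hball : ∀ᶠ s in 𝓝[>] (0 : ℝ), coord q (tilt (γ 0) ξ s) ∈ Metric.ball (coord q (γ 0)) (L.r / 2) :=
    ((continuousAt_coord hsrc).tendsto.comp (nearIn_tilt (γ 0) ξ).tendsto).eventually
      (Metric.isOpen_ball.mem_nhds (half_ball_mem L))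
  filter_upwards [hball, self_mem_nhdsWithin] with s hs (hs0 : 0 < s)
  obtain ⟨z, hz0, hz⟩ := L.exists_sol _ hs
  have hz' : ∀ t ∈ Icc 0 δ', HasDerivWithinAt z (L.F (z t)) (Icc 0 δ') t := fun t ht ↦
    (hz t (hsub ht)).1.mono hsub
  have hdist : ∀ t ∈ Icc 0 δ', dist (z t) (coord q (γ t)) ≤ s * (N * E) := fun t ht ↦ by
    have := dist_le_of_solutions L.lip hz' (fun t ht ↦ (hsolγ t ht).2.2) t ht
    refine this.trans ?_
    rw [hz0, coord_tilt, dist_eq_norm, add_sub_cancel_left, norm_smul, Real.norm_of_nonneg hs0.le,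
      mul_assoc]
    have hexp : Real.exp (L.K * (t - 0)) ≤ E := by
      refine Real.exp_le_exp.2 ?_
      rw [sub_zero]
      exact mul_le_mul_of_nonneg_left (hsub ht).2 L.K.2
    gcongr
  have hest : ∀ t ∈ Icc 0 δ', ‖((z t).1 - (coord q (γ t)).1) - (t * s) • ξ‖ ≤
      s * B * t ^ 2 := fun t ht ↦ by
    have := norm_sub_sub_smul_le (x := fun t ↦ (z t).1 - (coord q (γ t)).1)
      (v := fun t ↦ (z t).2 - (coord q (γ t)).2)
      (a := fun t ↦ (L.F (z t)).2 - (L.F (coord q (γ t))).2) (h := δ') (B := s * B)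
      (fun t ht ↦ by
        have h1 := hasDerivWithinAt_fst (hz' t ht)
        have h2 := hasDerivWithinAt_fst (hsolγ t ht).2.2
        rw [L.fst_eq] at h1 h2
        exact h1.sub h2)
      (fun t ht ↦ (hasDerivWithinAt_snd (hz' t ht)).sub (hasDerivWithinAt_snd (hsolγ t ht).2.2))
      (fun t ht ↦ by
        have h1 := L.lip.dist_le_mul (z t) (coord q (γ t))
        have h2 := norm_snd_le (L.F (z t) - L.F (coord q (γ t)))
        rw [dist_eq_norm] at h1
        refine h2.trans (h1.trans ?_)
        have := hdist t ht
        rw [hB]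
        calc (L.K : ℝ) * dist (z t) (coord q (γ t)) ≤ L.K * (s * (N * E)) := by gcongr
          _ = _ := by ring) ht
    have e0 : z 0 - coord q (γ 0) = s • ((0 : Coord n), ξ) := by
      rw [hz0, coord_tilt, add_sub_cancel_left]
    have e1 : (z 0).1 - (coord q (γ 0)).1 = 0 := by
      rw [← Prod.fst_sub, e0]; simp
    have e2 : (z 0).2 - (coord q (γ 0)).2 = s • ξ := by
      rw [← Prod.snd_sub, e0]; simp
    rw [e1, e2, sub_zero, smul_smul] at this
    exact this
  -- The untilted geodesic has nonnegative first coordinate, so it is enough to bound the difference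
  -- below. Its leading term is s·t·ξ₀ and its error s·B·t²; both carry the factor s.
  have hpos : ∀ t ∈ Icc 0 δ', s * t * (ξ 0 - B * t) ≤ (z t).1 0 := fun t ht ↦ by
    have h2 := (PiLp.norm_apply_le (((z t).1 - (coord q (γ t)).1) - (t * s) • ξ) 0).trans
      (hest t ht)
    have h3 := mem_range_iff.1 (coord_fst_mem_range q (γ t))
    simp only [PiLp.sub_apply, PiLp.smul_apply, smul_eq_mul, Real.norm_eq_abs] at h2
    have h4 := (abs_le.1 h2).1
    nlinarith
  have hfac : ∀ t ∈ Icc 0 δ', 0 < ξ 0 - B * t := fun t ht ↦ by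
    have : B * t ≤ B * δ' := by gcongr; exact ht.2
    linarith
  have hgeo := L.isGeodesicOn (z := z) (h := δ') (fun t ht ↦ ⟨hz' t ht, (hz t (hsub ht)).2⟩)
    (fun t ht ↦ mem_range_iff.2 (le_trans
      (mul_nonneg (mul_nonneg hs0.le ht.1) (hfac t ht).le) (hpos t ht)))
  refine ⟨_, hgeo, ?_, fun t ht ↦ ?_⟩
  · rw [hz0]
    exact ofCoord_coord (P := tilt (γ 0) ξ s) hsrc
  · have htI : t ∈ Icc 0 δ' := ⟨ht.1.le, ht.2⟩
    have hzpos : 0 < (z t).1 0 := lt_of_lt_of_le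
      (mul_pos (mul_pos hs0 ht.1) (hfac t htI)) (hpos t htI)
    have hmem := L.mem_target _ (hz t (hsub htI)).2 (mem_range_iff.2 hzpos.le)
    rw [mem_interior_iff_coord (ofCoord_proj_mem hmem), coord_ofCoord hmem]
    exact hzpos

/-! ### Vectors at the boundary -/

theorem normalCoord_apply (x : M) (v : Coord n) : normalCoord x (tangentOf x v) = v 0 := by
  have h1 := coord_snd (q := x) (P := (⟨x, tangentOf x v⟩ : TangentBundle (𝓡∂ n) M))
    (mem_chart_source _ _)
  have h2 := coord_self (⟨x, tangentOf x v⟩ : TangentBundle (𝓡∂ n) M)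
  exact congrArg (fun w : Coord n ↦ w 0) (h1.symm.trans h2)

theorem normalCoord_ne_zero (x : M) : ∃ v : TangentSpace (𝓡∂ n) x, normalCoord x v ≠ 0 := by
  refine ⟨tangentOf x (EuclideanSpace.single (0 : Fin n) (1 : ℝ)), ?_⟩
  rw [normalCoord_apply]
  simp

/-- The vector that represents the normal coordinate is spacelike. -/
theorem exists_normal (hb : g.TimelikeBoundary) {x : M} (hx : x ∈ (𝓡∂ n).boundary M) :
    ∃ m : TangentSpace (𝓡∂ n) x, (∀ w, g.inner x m w = normalCoord x w) ∧ 0 < g.inner x m m := by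
  have hinj : Function.Injective (g.inner x).toLinearMap := by
    rw [injective_iff_map_eq_zero]
    intro m hm
    exact (g.lorentzian x).eq_zero (g.symm x) fun w ↦ by
      rw [show g.inner x m = 0 from hm]; rfl
  have : FiniteDimensional ℝ (TangentSpace (𝓡∂ n) x) :=
    inferInstanceAs (FiniteDimensional ℝ (Coord n))
  obtain ⟨m, hm⟩ : ∃ m, g.inner x m = normalCoord x := by
    let B : Coord n →ₗ[ℝ] (Coord n →L[ℝ] ℝ) := (g.inner x).toLinearMap
    have hfin : Module.finrank ℝ (Coord n) = Module.finrank ℝ (Coord n →L[ℝ] ℝ) := by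
      rw [← (LinearMap.toContinuousLinearMap (𝕜 := ℝ) (E := Coord n) (F' := ℝ)).finrank_eq]
      exact (Subspace.dual_finrank_eq (K := ℝ) (V := Coord n)).symm
    exact (LinearMap.injective_iff_surjective_of_finrank_eq_finrank hfin (f := B)).1 hinj _
  have hmw : ∀ w, g.inner x m w = normalCoord x w := fun w ↦ by rw [hm]
  refine ⟨m, hmw, ?_⟩
  by_contra! hle
  have hm0 : m ≠ 0 := by
    rintro rfl
    obtain ⟨v, hv⟩ := normalCoord_ne_zero (n := n) x
    exact hv (by rw [← hmw, map_zero]; rfl)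
  obtain ⟨u, huV, hu, -⟩ := hb x hx
  have hum : g.inner x u m = 0 := by
    rw [g.symm, hmw]
    exact huV
  obtain ⟨u₀, -, hu₀, hpos⟩ := g.lorentzian x
  have hu0 : u ≠ 0 := by rintro rfl; simp at hu
  have hne : g.inner x u₀ u ≠ 0 := fun h ↦ by
    have := hpos u trivial h hu0
    linarith
  -- If `m` were not spacelike, it would span with the timelike boundary vector `u`, orthogonal to
  -- it, a plane on which the metric is nonpositive. The vector `w` of this plane is orthogonal to
  -- `u₀`, where the metric is positive, so it must vanish; but then `m` is zero.
  set w := g.inner x u₀ m • u - g.inner x u₀ u • m with hw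
  have hw0 : w = 0 := by
    by_contra hw0
    have h1 : g.inner x u₀ w = 0 := by
      rw [hw, map_sub, map_smul, map_smul, smul_eq_mul, smul_eq_mul]; ring
    have h2 := hpos w trivial h1 hw0
    have h3 : g.inner x w w = g.inner x u₀ m ^ 2 * g.inner x u u +
        g.inner x u₀ u ^ 2 * g.inner x m m := by
      have hmu : g.inner x m u = 0 := by rw [g.symm, hum]
      rw [hw]
      simp only [map_sub, map_smul, sub_apply, smul_apply,
        smul_eq_mul, hum, hmu]
      ring
    nlinarith [sq_nonneg (g.inner x u₀ m), sq_nonneg (g.inner x u₀ u)]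
  have h4 : g.inner x u₀ m • u = g.inner x u₀ u • m := sub_eq_zero.1 hw0
  have h5 : g.inner x u₀ m * g.inner x u u = 0 := by
    have := congrArg (g.inner x u) h4
    rwa [map_smul, map_smul, hum, smul_zero, smul_eq_mul] at this
  have h6 : g.inner x u₀ m = 0 := (mul_eq_zero.1 h5).resolve_right hu.ne
  rw [h6, zero_smul] at h4
  exact hm0 ((smul_eq_zero.1 h4.symm).resolve_left hne)

theorem exists_isOutwardUnitNormal (hb : g.TimelikeBoundary) {x : M}
    (hx : x ∈ (𝓡∂ n).boundary M) : ∃ ν, g.IsOutwardUnitNormal x ν := by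
  obtain ⟨m, hm, hpos⟩ := exists_normal hb hx
  set r := Real.sqrt (g.inner x m m)
  have hr : 0 < r := Real.sqrt_pos.2 hpos
  have hr2 : g.inner x m m = r ^ 2 := (Real.sq_sqrt hpos.le).symm
  refine ⟨(-r⁻¹) • m, ?_, ?_, fun w hw ↦ ?_⟩
  · rw [map_smul, ← hm, hr2, smul_eq_mul]
    have : 0 < r⁻¹ * r ^ 2 := by positivity
    linarith
  · rw [map_smul, map_smul, smul_apply, hr2, smul_eq_mul, smul_eq_mul]
    field_simp
  · rw [map_smul, smul_apply, hm, show normalCoord x w = 0 from hw, smul_zero]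

theorem inner_outwardNormal {x : M} {ν : TangentSpace (𝓡∂ n) x} (hν : g.IsOutwardUnitNormal x ν)
    (v : TangentSpace (𝓡∂ n) x) : g.inner x v ν * normalCoord x ν = normalCoord x v := by
  obtain ⟨h1, h2, h3⟩ := hν
  have h4 : g.inner x ν (v - (normalCoord x v / normalCoord x ν) • ν) = 0 := by
    refine h3 _ ?_
    change normalCoord x _ = 0
    rw [map_sub, map_smul, smul_eq_mul, div_mul_cancel₀ _ h1.ne, sub_self]
  rw [map_sub, map_smul, h2, smul_eq_mul, mul_one, sub_eq_zero] at h4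
  rw [g.symm, h4, div_mul_cancel₀ _ h1.ne]

/-- By `inner_outwardNormal`, g(v, ν) and the normal coordinate of v differ by the negative factor
`normalCoord x ν`. The coordinate condition is free of the metric and easier to transport. -/
theorem mem_inward_iff (hb : g.TimelikeBoundary) {p : TangentBundle (𝓡∂ n) M} :
    p ∈ g.inward ↔ p.proj ∈ (𝓡∂ n).boundary M ∧ 0 < normalCoord p.proj p.snd := by
  refine and_congr_right fun hp ↦ ⟨?_, fun h ↦ ?_⟩
  · rintro ⟨ν, hν, h⟩
    rw [← inner_outwardNormal hν]
    exact mul_pos_of_neg_of_neg h hν.1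
  · obtain ⟨ν, hν⟩ := exists_isOutwardUnitNormal hb hp
    refine ⟨ν, hν, ?_⟩
    rw [← inner_outwardNormal hν] at h
    exact (neg_iff_neg_of_mul_pos h).2 hν.1

theorem mem_inwardClosure_iff (hb : g.TimelikeBoundary) {p : TangentBundle (𝓡∂ n) M} :
    p ∈ g.inwardClosure ↔ p.proj ∈ (𝓡∂ n).boundary M ∧ 0 ≤ normalCoord p.proj p.snd := by
  refine and_congr_right fun hp ↦ ⟨?_, fun h ↦ ?_⟩
  · rintro ⟨ν, hν, h⟩
    rw [← inner_outwardNormal hν]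
    exact mul_nonneg_of_nonpos_of_nonpos h hν.1.le
  · obtain ⟨ν, hν⟩ := exists_isOutwardUnitNormal hb hp
    refine ⟨ν, hν, ?_⟩
    rw [← inner_outwardNormal hν] at h
    by_contra! hcon
    exact absurd h (not_le.2 (mul_neg_of_pos_of_neg hcon hν.1))

theorem inward_subset_inwardClosure : g.inward ⊆ g.inwardClosure :=
  fun _ ⟨h1, ν, h2, h3⟩ ↦ ⟨h1, ν, h2, h3.le⟩

/-- A lightlike vector at the boundary can be perturbed inward such that it becomes timelike. -/
theorem exists_tilt_direction (hb : g.TimelikeBoundary) {p : TangentBundle (𝓡∂ n) M}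
    (hp : p ∈ g.lightlike) (hpb : p.proj ∈ (𝓡∂ n).boundary M) :
    ∃ ξ : Coord n, 0 < ξ 0 ∧ g.inner p.proj p.snd (tangentOf p.proj ξ) < 0 := by
  obtain ⟨m, hm, hpos⟩ := exists_normal hb hpb
  obtain ⟨w, hw, hvw⟩ : ∃ w, normalCoord p.proj w = 0 ∧ g.inner p.proj p.snd w ≠ 0 := by
    by_contra! hcon
    -- A vector orthogonal to the tangent space of the boundary is a multiple of the spacelike `m`,
    -- so it cannot be null without being zero.
    set κ := g.inner p.proj p.snd m / g.inner p.proj m m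
    have h1 : p.snd - κ • m = 0 := by
      refine (g.lorentzian p.proj).eq_zero (g.symm p.proj) fun w ↦ ?_
      have h2 := hcon (w - (normalCoord p.proj w / normalCoord p.proj m) • m) (by
        rw [map_sub, map_smul, smul_eq_mul, div_mul_cancel₀ _ (by rw [← hm]; exact hpos.ne'),
          sub_self])
      rw [map_sub, map_smul, sub_eq_zero] at h2
      rw [map_sub, map_smul, sub_apply, smul_apply, h2, hm, ← hm m, smul_eq_mul, smul_eq_mul]
      ring
    rw [sub_eq_zero] at h1
    have h3 := hp.2
    rw [h1, map_smul, map_smul, smul_apply, smul_eq_mul, smul_eq_mul] at h3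
    have h4 : κ = 0 := by
      rcases mul_eq_zero.1 h3 with h | h
      · exact h
      · exact (mul_eq_zero.1 h).resolve_right hpos.ne'
    exact hp.1 (by rw [h1, h4, zero_smul])
  -- Chosen so that m + b·w has product -1 with the given vector; adding multiples of `w` leaves the
  -- normal coordinate equal to g(m, m) > 0.
  set b := (-1 - g.inner p.proj p.snd m) / g.inner p.proj p.snd w
  obtain ⟨ξ, hξ⟩ : ∃ ξ : Coord n, tangentOf p.proj ξ = m + b • w := ⟨_, rfl⟩
  refine ⟨ξ, ?_, ?_⟩
  · rw [← normalCoord_apply p.proj, hξ, map_add, map_smul, hw, smul_zero, add_zero, ← hm]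
    exact hpos
  · rw [hξ, map_add, map_smul, smul_eq_mul, div_mul_cancel₀ _ hvw]
    linarith

theorem coord_fst_eq_zero {P : TangentBundle (𝓡∂ n) M}
    (hP : P.proj ∈ (chartAt (EuclideanHalfSpace n) q).source)
    (hb : P.proj ∈ (𝓡∂ n).boundary M) : (coord q P).1 0 = 0 := by
  have h1 := mem_range_iff.1 (coord_fst_mem_range q P)
  have h2 : ¬ 0 < (coord q P).1 0 := by
    rw [← mem_interior_iff_coord hP, ← (𝓡∂ n).compl_boundary]
    exact fun h ↦ h hb
  linarith

theorem derivWithin_nonneg_of_nonneg {f : ℝ → ℝ} {f' δ : ℝ} (hδ : 0 < δ)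
    (hf : HasDerivWithinAt f f' (Icc 0 δ) 0) (h0 : f 0 = 0) (hpos : ∀ t, 0 < t → 0 ≤ f t) :
    0 ≤ f' := by
  have hf2 : HasDerivWithinAt f f' (Ioi 0) 0 :=
    (hf.mono_of_mem_nhdsWithin (Icc_mem_nhdsGE hδ)).Ioi_of_Ici
  refine ge_of_tendsto ((hasDerivWithinAt_iff_tendsto_slope' (by simp)).1 hf2) ?_
  filter_upwards [self_mem_nhdsWithin] with t (ht : 0 < t)
  rw [slope_def_field, h0, sub_zero, sub_zero]
  exact div_nonneg (hpos t ht) ht.le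

theorem normalCoord_eq (P : TangentBundle (𝓡∂ n) M) :
    normalCoord P.proj P.snd = (coord P.proj P).2 0 := by
  have hv := normalCoord_apply P.proj (coord P.proj P).2
  rwa [show tangentOf P.proj (coord P.proj P).2 = P.snd from coord_self P] at hv

/-- The initial velocity of a geodesic that starts at the boundary points inward. -/
theorem normalCoord_nonneg_of_stayTimes [T2Space M] {p : TangentBundle (𝓡∂ n) M} {δ : ℝ}
    (hδ : 0 < δ) (hp : δ ∈ g.stayTimes p) (hpb : p.proj ∈ (𝓡∂ n).boundary M) :
    0 ≤ normalCoord p.proj p.snd := by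
  obtain ⟨-, γ, hγ, rfl⟩ := hp
  set q := (γ 0).proj
  have hsrc : (γ 0).proj ∈ (chartAt (EuclideanHalfSpace n) q).source := mem_chart_source _ _
  have hz : HasDerivWithinAt (fun t ↦ coord q (γ t)) (sprayIn g q (coord q (γ 0))) (Icc 0 δ) 0 :=
    hγ.geodesicAt ⟨le_rfl, hδ.le⟩ hsrc
  have hx : HasDerivWithinAt (fun t ↦ (coord q (γ t)).1 0) ((coord q (γ 0)).2 0) (Icc 0 δ) 0 :=
    ((EuclideanSpace.proj (0 : Fin n) : Coord n →L[ℝ] ℝ).hasFDerivAt.comp_hasDerivWithinAt 0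
      (hasDerivWithinAt_fst hz))
  rw [normalCoord_eq]
  exact derivWithin_nonneg_of_nonneg hδ hx (coord_fst_eq_zero hsrc hpb) fun t _ ↦
    mem_range_iff.1 (coord_fst_mem_range q (γ t))

end

/-! ### Points connected by a geodesic -/

section

variable {n : ℕ} [NeZero n]
  {M : Type*} [TopologicalSpace M] [ChartedSpace (EuclideanHalfSpace n) M] [IsManifold (𝓡∂ n) ∞ M]
  {g : LorentzMetric n M} {p P Q R : TangentBundle (𝓡∂ n) M} {a b t τ : ℝ}

/-- The geodesic with initial data `P` is defined on `[0, t]` and arrives at `Q` at time `t`. -/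
def Reach (g : LorentzMetric n M) (P : TangentBundle (𝓡∂ n) M) (t : ℝ)
    (Q : TangentBundle (𝓡∂ n) M) : Prop :=
  0 ≤ t ∧ ∃ c, g.IsGeodesicOn c t ∧ c 0 = P ∧ c t = Q

theorem LorentzMetric.IsGeodesicOn.reach {c : ℝ → TangentBundle (𝓡∂ n) M} {T : ℝ}
    (hc : g.IsGeodesicOn c T) (ha : 0 ≤ a) (hab : a ≤ b) (hb : b ≤ T) :
    Reach g (c a) (b - a) (c b) :=
  ⟨by linarith, _, (hc.mono hb).shift ha, by simp, by simp⟩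

theorem Reach.mem_stayTimes (h : Reach g P t Q) : t ∈ g.stayTimes P := by
  obtain ⟨h0, c, hc, hP, -⟩ := h
  exact ⟨h0, c, hc, hP⟩

theorem reach_zero (P : TangentBundle (𝓡∂ n) M) : Reach g P 0 P :=
  ⟨le_rfl, _, isGeodesicOn_zero P, rfl, rfl⟩

theorem Reach.geodesicFlow_eq [T2Space M] (h : Reach g P t Q) : g.geodesicFlow P t = Q := by
  obtain ⟨h0, c, hc, rfl, rfl⟩ := h
  exact hc.geodesicFlow_eq ⟨h0, le_rfl⟩

theorem reach_geodesicFlow [T2Space M] (h : t ∈ g.stayTimes P) :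
    Reach g P t (g.geodesicFlow P t) := by
  obtain ⟨h0, c, hc, rfl⟩ := h
  exact ⟨h0, c, hc, rfl, (hc.geodesicFlow_eq ⟨h0, le_rfl⟩).symm⟩

theorem Reach.unique [T2Space M] (h₁ : Reach g P t Q) (h₂ : Reach g P t R) : Q = R :=
  h₁.geodesicFlow_eq.symm.trans h₂.geodesicFlow_eq

theorem Reach.trans (h₁ : Reach g P a Q) (h₂ : Reach g Q b R) : Reach g P (a + b) R := by
  obtain ⟨ha, c₁, hc₁, rfl, rfl⟩ := h₁
  obtain ⟨hb, c₂, hc₂, hQ, rfl⟩ := h₂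
  refine ⟨add_nonneg ha hb, _, hc₁.concat hc₂ ha hb hQ.symm, by simp [ha], ?_⟩
  rcases hb.eq_or_lt with rfl | hb
  · simp [hQ]
  · simp [hb]

theorem Reach.reverse (h : Reach g P t Q) : Reach g (scale (-1) Q) t (scale (-1) P) := by
  obtain ⟨h0, c, hc, rfl, rfl⟩ := h
  exact ⟨h0, _, hc.reverse, by simp, by simp⟩

theorem Reach.split (h : Reach g P b Q) (ha : 0 ≤ a) (hab : a ≤ b) :
    ∃ R, Reach g P a R ∧ Reach g R (b - a) Q := by
  obtain ⟨h0, c, hc, rfl, rfl⟩ := h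
  refine ⟨c a, ?_, hc.reach ha hab le_rfl⟩
  simpa using hc.reach le_rfl ha hab

theorem Reach.right_unique [T2Space M] (h₁ : Reach g P a R) (h₂ : Reach g P b Q) (hab : a ≤ b) :
    Reach g R (b - a) Q := by
  obtain ⟨R', h3, h4⟩ := h₂.split h₁.1 hab
  rwa [h₁.unique h3]

theorem mem_stayTimes_of_le (hb : b ∈ g.stayTimes P) (ha : 0 ≤ a) (hab : a ≤ b) :
    a ∈ g.stayTimes P := by
  obtain ⟨h0, c, hc, hP⟩ := hb
  exact ⟨ha, c, hc.mono hab, hP⟩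

theorem completeTime_eq (h : IsGreatest (g.stayTimes p) τ) : g.completeTime p = τ := h.csSup_eq

/-- Maximal geodesics end at the boundary. -/
theorem exit_mem_boundary [T2Space M] (h : IsGreatest (g.stayTimes p) τ) (hQ : Reach g p τ Q) :
    Q.proj ∈ (𝓡∂ n).boundary M := by
  by_contra hcon
  obtain ⟨ε, hε, c, hc, rfl, -⟩ := exists_geodesic_interior g (P := Q)
    (by rw [← (𝓡∂ n).compl_boundary]; exact hcon)
  have := h.2 (hQ.trans (hc.reach le_rfl hε.le le_rfl)).mem_stayTimes
  linarith

/-- The times up to which the geodesic stays in the interior. -/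
def interiorTimes (g : LorentzMetric n M) (p : TangentBundle (𝓡∂ n) M) : Set ℝ :=
  {t | 0 < t ∧ ∃ c, g.IsGeodesicOn c t ∧ c 0 = p ∧
    ∀ s ∈ Ioo 0 t, (c s).proj ∈ (𝓡∂ n).interior M}

theorem interiorTimes_le (h : IsGreatest (g.stayTimes p) τ) : ∀ t ∈ interiorTimes g p, t ≤ τ := by
  rintro t ⟨h0, c, hc, hp, -⟩
  exact h.2 ⟨h0.le, c, hc, hp⟩

theorem interiorTime_mem_stayTimes (h : IsGreatest (g.stayTimes p) τ) :
    g.interiorTime p ∈ g.stayTimes p := by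
  have h0 : 0 ≤ g.interiorTime p := Real.sSup_nonneg fun t ht ↦ ht.1.le
  exact mem_stayTimes_of_le h.1 h0 (Real.sSup_le (interiorTimes_le h) h.1.1)

/-- If the end point were interior, the geodesic could be continued in the interior beyond the
supremum. Being on the boundary, the end point lies in the domain of `φ`. -/
theorem interiorScattering_mem_boundary [T2Space M] (h : IsGreatest (g.stayTimes p) τ)
    (hp : p.proj ∈ (𝓡∂ n).boundary M) : (g.interiorScattering p).proj ∈ (𝓡∂ n).boundary M := by
  by_contra hcon
  obtain ⟨hT0, γ, hγ, rfl⟩ := interiorTime_mem_stayTimes h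
  have hflow : g.interiorScattering (γ 0) = γ (g.interiorTime (γ 0)) :=
    hγ.geodesicFlow_eq ⟨hT0, le_rfl⟩
  set T := g.interiorTime (γ 0) with hT
  rw [hflow] at hcon
  -- T = 0 is also the default value `sSup ∅` when there are no interior times. In that case the end
  -- point is the starting point, which is on the boundary.
  have hTpos : 0 < T := by
    rcases hT0.eq_or_lt with h0 | h0
    · rw [← h0] at hcon
      exact absurd hp hcon
    · exact h0
  have hinterior : (γ T).proj ∈ (𝓡∂ n).interior M := by rw [← (𝓡∂ n).compl_boundary]; exact hcon
  have hbdd : BddAbove (interiorTimes g (γ 0)) := ⟨τ, interiorTimes_le h⟩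
  have hne : (interiorTimes g (γ 0)).Nonempty := by
    rw [nonempty_iff_ne_empty]
    intro he
    have : T = sSup (interiorTimes g (γ 0)) := rfl
    rw [he, Real.sSup_empty] at this
    linarith
  have hbefore : ∀ s ∈ Ioo 0 T, (γ s).proj ∈ (𝓡∂ n).interior M := by
    intro s hs
    obtain ⟨t, ht, hst⟩ := exists_lt_of_lt_csSup hne (show s < sSup (interiorTimes g (γ 0)) from hs.2)
    obtain ⟨h0, c, hc, hc0, hc1⟩ := ht
    have heq := (hc.mono (min_le_left t T)).eqOn (hγ.mono (min_le_right t T)) hc0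
      (show s ∈ Icc 0 (min t T) from ⟨hs.1.le, le_min hst.le hs.2.le⟩)
    rw [← heq]
    exact hc1 s ⟨hs.1, hst⟩
  obtain ⟨ε, hε, c, hc, hc0, hci⟩ := exists_geodesic_interior g hinterior
  have hcc := hγ.concat hc hT0 hε.le hc0.symm
  have hmem : T + ε ∈ interiorTimes g (γ 0) := by
    refine ⟨by linarith, _, hcc, by simp [hT0], fun s hs ↦ ?_⟩
    by_cases hsT : s ≤ T
    · simp only [hsT, if_true]
      rcases hsT.eq_or_lt with rfl | h1
      · exact hinterior
      · exact hbefore s ⟨hs.1, h1⟩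
    · simp only [hsT, if_false]
      exact hci _ ⟨by linarith, by linarith [hs.2]⟩
  have := le_csSup hbdd hmem
  have h2 : T = sSup (interiorTimes g (γ 0)) := rfl
  linarith

theorem le_interiorTime (h : IsGreatest (g.stayTimes p) τ) (ht : t ∈ interiorTimes g p) :
    t ≤ g.interiorTime p := le_csSup ⟨τ, interiorTimes_le h⟩ ht

theorem tangentBundle_tendsto_unique [T2Space M] {α : Type*} {l : Filter α} [l.NeBot]
    {f : α → TangentBundle (𝓡∂ n) M} (h₁ : Tendsto f l (𝓝 P)) (h₂ : Tendsto f l (𝓝 Q)) : P = Q := by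
  have hproj := (FiberBundle.continuous_proj (Coord n) (TangentSpace (𝓡∂ n) (M := M)))
  have hpe : P.proj = Q.proj :=
    tendsto_nhds_unique ((hproj.tendsto _).comp h₁) ((hproj.tendsto _).comp h₂)
  have hP : P.proj ∈ (chartAt (EuclideanHalfSpace n) P.proj).source := mem_chart_source _ _
  have hQ : Q.proj ∈ (chartAt (EuclideanHalfSpace n) P.proj).source := by rw [← hpe]; exact hP
  exact coord_injOn hP hQ (tendsto_nhds_unique ((continuousAt_coord hP).tendsto.comp h₁)
    ((continuousAt_coord hQ).tendsto.comp h₂))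

theorem energy_reverse (P : TangentBundle (𝓡∂ n) M) : energy g (scale (-1) P) = energy g P := by
  change g.inner P.proj ((-1 : ℝ) • P.snd) ((-1 : ℝ) • P.snd) = _
  rw [map_smul, map_smul, smul_apply, smul_smul]
  simp [energy]

theorem lightlike_reverse (h : P ∈ g.lightlike) : scale (-1) P ∈ g.lightlike := by
  refine ⟨?_, (energy_reverse P).trans h.2⟩
  change (-1 : ℝ) • P.snd ≠ 0
  simpa using h.1

theorem Reach.lightlike [T2Space M] (h : Reach g P t Q) (hP : P ∈ g.lightlike) :
    Q ∈ g.lightlike := by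
  obtain ⟨h0, c, hc, rfl, rfl⟩ := h
  have ht : t ∈ Icc 0 t := ⟨h0, le_rfl⟩
  exact ⟨hc.snd_ne_zero hP.1 ht, (hc.energy_eq ht).trans hP.2⟩

end

/-! ### Isometries near the boundary -/

section

variable {n : ℕ} [NeZero n]
  {M₁ : Type*} [TopologicalSpace M₁] [ChartedSpace (EuclideanHalfSpace n) M₁]
  [IsManifold (𝓡∂ n) ∞ M₁]
  {M₂ : Type*} [TopologicalSpace M₂] [ChartedSpace (EuclideanHalfSpace n) M₂]
  [IsManifold (𝓡∂ n) ∞ M₂]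
  {g₁ : LorentzMetric n M₁} {g₂ : LorentzMetric n M₂}
  {φ : PartialDiffeomorph (𝓡∂ n) (𝓡∂ n) M₁ M₂ ∞}

theorem map_mem_boundary_iff {x : M₁} (hx : x ∈ φ.source) :
    φ x ∈ (𝓡∂ n).boundary M₂ ↔ x ∈ (𝓡∂ n).boundary M₁ :=
  ((φ.isLocalDiffeomorphAt _ _ _ hx).isBoundaryPoint_iff (by simp)).symm

theorem tangentMap_reverse (P : TangentBundle (𝓡∂ n) M₁) :
    tangentMap (𝓡∂ n) (𝓡∂ n) φ (scale (-1) P) = scale (-1) (tangentMap (𝓡∂ n) (𝓡∂ n) φ P) := by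
  change (⟨φ P.proj, mfderiv (𝓡∂ n) (𝓡∂ n) φ P.proj ((-1 : ℝ) • P.snd)⟩ :
    TangentBundle (𝓡∂ n) M₂) = ⟨φ P.proj, (-1 : ℝ) • mfderiv (𝓡∂ n) (𝓡∂ n) φ P.proj P.snd⟩
  rw [map_smul]

theorem tangentMap_apply_symm {Q : TangentBundle (𝓡∂ n) M₂} (hQ : Q.proj ∈ φ.target) :
    tangentMap (𝓡∂ n) (𝓡∂ n) φ (tangentMap (𝓡∂ n) (𝓡∂ n) φ.symm Q) = Q :=
  tangentMap_symm_apply (φ := φ.symm) hQ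

theorem energy_tangentMap (hφ : IsometricOn g₁ g₂ φ) {P : TangentBundle (𝓡∂ n) M₁}
    (hP : P.proj ∈ φ.source) : energy g₂ (tangentMap (𝓡∂ n) (𝓡∂ n) φ P) = energy g₁ P :=
  hφ P.proj hP P.snd P.snd

theorem tangentMap_injOn {P Q : TangentBundle (𝓡∂ n) M₁} (hP : P.proj ∈ φ.source)
    (hQ : Q.proj ∈ φ.source)
    (h : tangentMap (𝓡∂ n) (𝓡∂ n) φ P = tangentMap (𝓡∂ n) (𝓡∂ n) φ Q) : P = Q := by
  rw [← tangentMap_symm_apply hP, h, tangentMap_symm_apply hQ]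

theorem lightlike_tangentMap (hφ : IsometricOn g₁ g₂ φ) {P : TangentBundle (𝓡∂ n) M₁}
    (hP : P.proj ∈ φ.source) (h : P ∈ g₁.lightlike) :
    tangentMap (𝓡∂ n) (𝓡∂ n) φ P ∈ g₂.lightlike := by
  refine ⟨fun h0 ↦ h.1 ?_, (energy_tangentMap hφ hP).trans h.2⟩
  have : (⟨P.proj, 0⟩ : TangentBundle (𝓡∂ n) M₁) = P := by
    refine (tangentMap_injOn (φ := φ) (P := P) (Q := ⟨P.proj, 0⟩) hP hP ?_).symm
    change (⟨φ P.proj, mfderiv (𝓡∂ n) (𝓡∂ n) φ P.proj P.snd⟩ : TangentBundle (𝓡∂ n) M₂) =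
      ⟨φ P.proj, mfderiv (𝓡∂ n) (𝓡∂ n) φ P.proj 0⟩
    rw [map_zero]
    exact congrArg _ h0
  rw [← this]

theorem IsometricOn.symm (hφ : IsometricOn g₁ g₂ φ) : IsometricOn g₂ g₁ φ.symm := by
  intro y hy v w
  have hx : φ.symm y ∈ φ.source := φ.symm.map_source hy
  rw [← hφ _ hx]
  have hφy : φ (φ.symm y) = y := φ.right_inv hy
  have hev : (fun y ↦ φ (φ.symm y)) =ᶠ[𝓝 y] id := by
    filter_upwards [φ.open_target.mem_nhds hy] with z hz using φ.right_inv hz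
  have hcomp : mfderiv (𝓡∂ n) (𝓡∂ n) (fun y ↦ φ (φ.symm y)) y =
      (mfderiv (𝓡∂ n) (𝓡∂ n) φ (φ.symm y)).comp (mfderiv (𝓡∂ n) (𝓡∂ n) φ.symm y) :=
    mfderiv_comp y ((φ.contMDiffOn_toFun.contMDiffAt (φ.open_source.mem_nhds hx)).mdifferentiableAt
      (by simp)) ((φ.contMDiffOn_invFun.contMDiffAt (φ.open_target.mem_nhds hy)).mdifferentiableAt
      (by simp))
  have hid : ∀ v : TangentSpace (𝓡∂ n) y,
      (mfderiv (𝓡∂ n) (𝓡∂ n) φ (φ.symm y)) (mfderiv (𝓡∂ n) (𝓡∂ n) φ.symm y v) = (v : Coord n) := by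
    intro v
    have h1 := DFunLike.congr_fun hcomp v
    have h2 : mfderiv (𝓡∂ n) (𝓡∂ n) (fun y ↦ φ (φ.symm y)) y = mfderiv (𝓡∂ n) (𝓡∂ n) id y :=
      hev.mfderiv_eq
    rw [h2, mfderiv_id] at h1
    exact h1.symm
  have key : ∀ z : M₂, z = y → ∀ v w : Coord n, g₂.inner z v w = g₂.inner y v w := by
    rintro _ rfl _ _; rfl
  rw [hid v, hid w]
  exact key _ hφy v w

theorem IsBoundaryNhdIsometry.symm (hφ : IsBoundaryNhdIsometry g₁ g₂ φ) :
    IsBoundaryNhdIsometry g₂ g₁ φ.symm :=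
  ⟨hφ.target, hφ.source, IsometricOn.symm hφ.isometry⟩

end

/-! ### Pairs of manifolds with the same scattering data -/

section

variable {n : ℕ} [NeZero n]
  {M₁ : Type*} [TopologicalSpace M₁] [ChartedSpace (EuclideanHalfSpace n) M₁]
  [IsManifold (𝓡∂ n) ∞ M₁]
  {M₂ : Type*} [TopologicalSpace M₂] [ChartedSpace (EuclideanHalfSpace n) M₂]
  [IsManifold (𝓡∂ n) ∞ M₂]

/-- `φ` maps `A` onto `B` and intertwines the maps `S₁` and `S₂` on `A`. -/
def Intertwines (φ : PartialDiffeomorph (𝓡∂ n) (𝓡∂ n) M₁ M₂ ∞)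
    (A : Set (TangentBundle (𝓡∂ n) M₁)) (B : Set (TangentBundle (𝓡∂ n) M₂))
    (S₁ : TangentBundle (𝓡∂ n) M₁ → TangentBundle (𝓡∂ n) M₁)
    (S₂ : TangentBundle (𝓡∂ n) M₂ → TangentBundle (𝓡∂ n) M₂) : Prop :=
  tangentMap (𝓡∂ n) (𝓡∂ n) φ '' A = B ∧
    ∀ p ∈ A, tangentMap (𝓡∂ n) (𝓡∂ n) φ (S₁ p) = S₂ (tangentMap (𝓡∂ n) (𝓡∂ n) φ p)

variable {g₁ : LorentzMetric n M₁} {g₂ : LorentzMetric n M₂}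
  {φ : PartialDiffeomorph (𝓡∂ n) (𝓡∂ n) M₁ M₂ ∞}
  {O₁ : Set (TangentBundle (𝓡∂ n) M₁)} {O₂ : Set (TangentBundle (𝓡∂ n) M₂)}

theorem Intertwines.symm {A : Set (TangentBundle (𝓡∂ n) M₁)}
    {B : Set (TangentBundle (𝓡∂ n) M₂)}
    {S₁ : TangentBundle (𝓡∂ n) M₁ → TangentBundle (𝓡∂ n) M₁}
    {S₂ : TangentBundle (𝓡∂ n) M₂ → TangentBundle (𝓡∂ n) M₂} (h : Intertwines φ A B S₁ S₂)
    (hA : ∀ p ∈ A, p.proj ∈ φ.source ∧ (S₁ p).proj ∈ φ.source) :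
    Intertwines φ.symm B A S₂ S₁ := by
  obtain ⟨rfl, h2⟩ := h
  refine ⟨?_, ?_⟩
  · rw [image_image]
    ext p
    constructor
    · rintro ⟨p, hp, rfl⟩
      change tangentMap (𝓡∂ n) (𝓡∂ n) φ.symm (tangentMap (𝓡∂ n) (𝓡∂ n) φ p) ∈ A
      rwa [tangentMap_symm_apply (hA p hp).1]
    · exact fun hp ↦ ⟨p, hp, tangentMap_symm_apply (hA p hp).1⟩
  · rintro _ ⟨p, hp, rfl⟩
    rw [← h2 p hp, tangentMap_symm_apply (hA p hp).2, tangentMap_symm_apply (hA p hp).1]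

/-- Two Lorentzian manifolds with timelike boundary and the same scattering data. -/
structure SameData (g₁ : LorentzMetric n M₁) (g₂ : LorentzMetric n M₂)
    (O₁ : Set (TangentBundle (𝓡∂ n) M₁)) (O₂ : Set (TangentBundle (𝓡∂ n) M₂))
    (φ : PartialDiffeomorph (𝓡∂ n) (𝓡∂ n) M₁ M₂ ∞) : Prop where
  timelike₁ : g₁.TimelikeBoundary
  timelike₂ : g₂.TimelikeBoundary
  nonTrapping₁ : ∀ p ∈ g₁.lightlike, g₁.IsNonTrapping p
  nonTrapping₂ : ∀ p ∈ g₂.lightlike, g₂.IsNonTrapping p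
  conicNhd₁ : g₁.IsConicNhd O₁
  conicNhd₂ : g₂.IsConicNhd O₂
  isometry : IsBoundaryNhdIsometry g₁ g₂ φ
  data : Intertwines φ (O₁ ∩ g₁.causal ∩ g₁.inward) (O₂ ∩ g₂.causal ∩ g₂.inward)
      g₁.interiorScattering g₂.interiorScattering ∨
    Intertwines φ (O₁ ∩ g₁.causal ∩ g₁.inwardClosure) (O₂ ∩ g₂.causal ∩ g₂.inwardClosure)
      g₁.completeScattering g₂.completeScattering

theorem completeScattering_mem_boundary [T2Space M₁] {p : TangentBundle (𝓡∂ n) M₁}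
    (h : g₁.IsNonTrapping p) : (g₁.completeScattering p).proj ∈ (𝓡∂ n).boundary M₁ := by
  obtain ⟨τ, hτ⟩ := h
  rw [LorentzMetric.completeScattering, completeTime_eq hτ]
  exact exit_mem_boundary hτ (reach_geodesicFlow hτ.1)

/-- Inverting the intertwining relation requires the scattered vectors to lie over the domain of
`φ`; they do, as both scattering relations end at the boundary. -/
theorem SameData.symm [T2Space M₁] (h : SameData g₁ g₂ O₁ O₂ φ) : SameData g₂ g₁ O₂ O₁ φ.symm where
  timelike₁ := h.timelike₂
  timelike₂ := h.timelike₁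
  nonTrapping₁ := h.nonTrapping₂
  nonTrapping₂ := h.nonTrapping₁
  conicNhd₁ := h.conicNhd₂
  conicNhd₂ := h.conicNhd₁
  isometry := h.isometry.symm
  data := by
    refine h.data.imp (fun hd ↦ hd.symm fun p hp ↦ ?_) (fun hd ↦ hd.symm fun p hp ↦ ?_)
    · obtain ⟨τ, hτ⟩ := h.conicNhd₁.nonTrapping p hp.1.1
      have hb := h.conicNhd₁.boundary p hp.1.1
      exact ⟨h.isometry.source hb, h.isometry.source (interiorScattering_mem_boundary hτ hb)⟩
    · exact ⟨h.isometry.source (h.conicNhd₁.boundary p hp.1.1), h.isometry.source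
        (completeScattering_mem_boundary (h.conicNhd₁.nonTrapping p hp.1.1))⟩

/-- A geodesic that starts in an inward causal direction and moves into the interior reaches
boundary points that correspond under `φ`. -/
theorem SameData.exists_match [T2Space M₁] [T2Space M₂] (h : SameData g₁ g₂ O₁ O₂ φ)
    {p : TangentBundle (𝓡∂ n) M₁} (hp : p ∈ O₁ ∩ g₁.causal ∩ g₁.inward) {δ : ℝ}
    (hinterior : δ ∈ interiorTimes g₁ p) :
    ∃ T₁ T₂ Q, δ ≤ T₁ ∧ Reach g₁ p T₁ Q ∧ Q.proj ∈ (𝓡∂ n).boundary M₁ ∧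
      Reach g₂ (tangentMap (𝓡∂ n) (𝓡∂ n) φ p) T₂ (tangentMap (𝓡∂ n) (𝓡∂ n) φ Q) := by
  obtain ⟨τ₁, hτ₁⟩ := h.conicNhd₁.nonTrapping p hp.1.1
  have hb := h.conicNhd₁.boundary p hp.1.1
  -- The two hypotheses are used only here. Each yields a matching pair of end points, at the
  -- interior or at the complete times, and both of these times in `M₁` are at least δ.
  rcases h.data with ⟨himg, hS⟩ | ⟨himg, hS⟩
  · have hm : tangentMap (𝓡∂ n) (𝓡∂ n) φ p ∈ O₂ ∩ g₂.causal ∩ g₂.inward := by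
      rw [← himg]; exact mem_image_of_mem _ hp
    obtain ⟨τ₂, hτ₂⟩ := h.conicNhd₂.nonTrapping _ hm.1.1
    refine ⟨_, g₂.interiorTime (tangentMap (𝓡∂ n) (𝓡∂ n) φ p), g₁.interiorScattering p,
      le_interiorTime hτ₁ hinterior,
      reach_geodesicFlow (interiorTime_mem_stayTimes hτ₁),
      interiorScattering_mem_boundary hτ₁ hb, ?_⟩
    rw [hS p hp]
    exact reach_geodesicFlow (interiorTime_mem_stayTimes hτ₂)
  · have hp' : p ∈ O₁ ∩ g₁.causal ∩ g₁.inwardClosure := ⟨hp.1, inward_subset_inwardClosure hp.2⟩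
    have hm : tangentMap (𝓡∂ n) (𝓡∂ n) φ p ∈ O₂ ∩ g₂.causal ∩ g₂.inwardClosure := by
      rw [← himg]; exact mem_image_of_mem _ hp'
    obtain ⟨τ₂, hτ₂⟩ := h.conicNhd₂.nonTrapping _ hm.1.1
    refine ⟨g₁.completeTime p, g₂.completeTime (tangentMap (𝓡∂ n) (𝓡∂ n) φ p), g₁.completeScattering p, ?_, ?_,
      completeScattering_mem_boundary ⟨τ₁, hτ₁⟩, ?_⟩
    · rw [completeTime_eq hτ₁]
      exact interiorTimes_le hτ₁ δ hinterior
    · exact reach_geodesicFlow (by rw [completeTime_eq hτ₁]; exact hτ₁.1)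
    · rw [hS p hp']
      exact reach_geodesicFlow (by rw [completeTime_eq hτ₂]; exact hτ₂.1)

/-! ### Comparison of travel times -/

theorem energy_tilt (p : TangentBundle (𝓡∂ n) M₁) (ξ : Coord n) (s : ℝ) :
    energy g₁ (tilt p ξ s) = energy g₁ p + s * (2 * g₁.inner p.proj p.snd (tangentOf p.proj ξ)) +
      s ^ 2 * g₁.inner p.proj (tangentOf p.proj ξ) (tangentOf p.proj ξ) := by
  change g₁.inner p.proj (p.snd + s • tangentOf p.proj ξ) (p.snd + s • tangentOf p.proj ξ) = _
  simp only [map_add, map_smul, add_apply, smul_apply, smul_eq_mul, energy,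
    g₁.symm p.proj (tangentOf p.proj ξ) p.snd]
  ring

theorem momentum_eq_zero {g : LorentzMetric n M₁} {P P' : TangentBundle (𝓡∂ n) M₁} {q : M₁}
    (h : P'.proj = P.proj) : momentum g q P P' = 0 := by
  have : (coord q P').1 = (coord q P).1 := congrArg (extChartAt (𝓡∂ n) q) h
  rw [momentum, this, sub_self, map_zero]

theorem NearIn.congr {α : Type*} {l : Filter α} {e : α → ℝ} {q : M₁}
    {P : TangentBundle (𝓡∂ n) M₁} {f f' : α → TangentBundle (𝓡∂ n) M₁} (h : NearIn l e q P f)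
    (hf : f =ᶠ[l] f') : NearIn l e q P f' :=
  ⟨h.tendsto.congr' hf, h.isBigO.congr' (hf.mono fun s hs ↦ by simp only [hs]) EventuallyEq.rfl⟩

theorem NearIn.mono {α : Type*} {l l' : Filter α} {e : α → ℝ} {q : M₁}
    {P : TangentBundle (𝓡∂ n) M₁} {f : α → TangentBundle (𝓡∂ n) M₁} (h : NearIn l e q P f)
    (hl : l' ≤ l) : NearIn l' e q P f :=
  ⟨h.tendsto.mono_left hl, h.isBigO.mono hl⟩

/-- Two geodesics whose ends correspond under `φ` correspond as long as they stay in the domain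
of `φ`, backward in time. -/
theorem tail_eq [T2Space M₂] (hφ : IsometricOn g₁ g₂ φ) {c₁ : ℝ → TangentBundle (𝓡∂ n) M₁}
    {c₂ : ℝ → TangentBundle (𝓡∂ n) M₂} {T₁ T₂ u : ℝ} (hc₁ : g₁.IsGeodesicOn c₁ T₁)
    (hc₂ : g₂.IsGeodesicOn c₂ T₂) (hend : c₂ T₂ = tangentMap (𝓡∂ n) (𝓡∂ n) φ (c₁ T₁))
    (hu0 : 0 ≤ u) (hu₁ : u ≤ T₁) (hu₂ : u ≤ T₂)
    (hsrc : ∀ t ∈ Icc 0 u, (c₁ (T₁ - t)).proj ∈ φ.source) :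
    c₂ (T₂ - u) = tangentMap (𝓡∂ n) (𝓡∂ n) φ (c₁ (T₁ - u)) := by
  have h1 := (hc₁.reverse.mono hu₁).map hφ hsrc
  have h2 := hc₂.reverse.mono hu₂
  have h3 := h2.eqOn h1 (by simp only [sub_zero, tangentMap_reverse, hend])
    (show u ∈ Icc 0 u from ⟨hu0, le_rfl⟩)
  simp only [tangentMap_reverse] at h3
  have := congrArg (scale (-1)) h3
  rwa [scale_neg_one_scale, scale_neg_one_scale] at this

/-- The energy of the tilted vector is s(2κ + sχ) with κ < 0, so it is timelike for small s > 0; its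
normal coordinate grows by s·ξ₀ > 0; and `O₁` is open around the light cone. -/
theorem SameData.eventually_tilt_mem (h : SameData g₁ g₂ O₁ O₂ φ)
    {q : TangentBundle (𝓡∂ n) M₁} (hq : q ∈ g₁.lightlike) (hqb : q.proj ∈ (𝓡∂ n).boundary M₁)
    (hv : 0 ≤ normalCoord q.proj q.snd) {ξ : Coord n} (hξ0 : 0 < ξ 0)
    (hξ : g₁.inner q.proj q.snd (tangentOf q.proj ξ) < 0) :
    ∀ᶠ s in 𝓝[>] (0 : ℝ), tilt q ξ s ∈ O₁ ∩ g₁.causal ∩ g₁.inward := by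
  obtain ⟨W, hW, hOW⟩ := h.conicNhd₁.isOpen
  have hqW : q ∈ W := by
    have := h.conicNhd₁.lightlike q hq hqb
    rw [hOW] at this
    exact this.1
  set κ := g₁.inner q.proj q.snd (tangentOf q.proj ξ)
  set χ := g₁.inner q.proj (tangentOf q.proj ξ) (tangentOf q.proj ξ)
  have hlim : Tendsto (fun s : ℝ ↦ 2 * κ + s * χ) (𝓝[>] 0) (𝓝 (2 * κ)) := by
    have : Continuous fun s : ℝ ↦ 2 * κ + s * χ := by fun_prop
    have h2 := this.tendsto 0
    rw [zero_mul, add_zero] at h2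
    exact h2.mono_left nhdsWithin_le_nhds
  filter_upwards [(nearIn_tilt q ξ).tendsto.eventually (hW.mem_nhds hqW),
    hlim.eventually (gt_mem_nhds (show 2 * κ < 0 by linarith)), self_mem_nhdsWithin]
    with s hs1 hs2 (hs3 : 0 < s)
  have hE : energy g₁ (tilt q ξ s) < 0 := by
    rw [energy_tilt, show energy g₁ q = 0 from hq.2]
    have : s * (2 * κ + s * χ) < 0 := mul_neg_of_pos_of_neg hs3 hs2
    linarith
  refine ⟨⟨by rw [hOW]; exact ⟨hs1, hqb⟩, fun h0 ↦ ?_, hE.le⟩, ?_⟩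
  · have : energy g₁ (tilt q ξ s) = 0 := by rw [energy, h0, map_zero]
    exact hE.ne this
  · rw [mem_inward_iff h.timelike₁]
    refine ⟨hqb, ?_⟩
    change 0 < normalCoord q.proj (q.snd + s • tangentOf q.proj ξ)
    rw [map_add, map_smul, normalCoord_apply, smul_eq_mul]
    have := mul_pos hs3 hξ0
    linarith

/-- A multiple of `s` that is `O(s²)` as `s ↓ 0` vanishes. -/
theorem eq_zero_of_isBigO_sq {l : Filter ℝ} [l.NeBot] (hl : l ≤ 𝓝[>] 0) {κ : ℝ}
    (h : (fun s ↦ s * κ) =O[l] fun s ↦ s ^ 2) : κ = 0 := by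
  obtain ⟨C, hC⟩ := h.bound
  have hlim : Tendsto (fun s : ℝ ↦ C * |s|) l (𝓝 0) := by
    have : Tendsto (fun s : ℝ ↦ C * |s|) (𝓝 0) (𝓝 (C * |0|)) :=
      (continuous_const.mul continuous_abs).tendsto 0
    rw [abs_zero, mul_zero] at this
    exact this.mono_left (hl.trans nhdsWithin_le_nhds)
  have hle : |κ| ≤ 0 := by
    refine ge_of_tendsto hlim ?_
    filter_upwards [hC, hl self_mem_nhdsWithin] with s h1 (h2 : 0 < s)
    rw [norm_mul, norm_pow, Real.norm_eq_abs, Real.norm_eq_abs, sq] at h1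
    have h3 : 0 < |s| := abs_pos.2 h2.ne'
    nlinarith
  exact abs_nonpos_iff.1 hle

/-- In the limit, geodesics near a lightlike one whose ends correspond have equal lengths. -/
theorem eq_time_of_tendsto [T2Space M₁] [T2Space M₂] (hφ : IsometricOn g₁ g₂ φ) {l : Filter ℝ}
    [l.NeBot] (hl : l ≤ 𝓝[>] 0) {γ₁ : ℝ → TangentBundle (𝓡∂ n) M₁}
    {γ₂ : ℝ → TangentBundle (𝓡∂ n) M₂} {τ₁ τ₂ : ℝ} (hτ₁ : 0 < τ₁) (hτ₂ : 0 < τ₂)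
    (hγ₁ : g₁.IsGeodesicOn γ₁ τ₁) (hγ₂ : g₂.IsGeodesicOn γ₂ τ₂)
    (hstart : γ₂ 0 = tangentMap (𝓡∂ n) (𝓡∂ n) φ (γ₁ 0)) (hsrc0 : (γ₁ 0).proj ∈ φ.source)
    (hend : γ₂ τ₂ = tangentMap (𝓡∂ n) (𝓡∂ n) φ (γ₁ τ₁)) (hsrcτ : (γ₁ τ₁).proj ∈ φ.source)
    (hq : γ₁ 0 ∈ g₁.lightlike) {ξ : Coord n}
    (hξ : g₁.inner (γ₁ 0).proj (γ₁ 0).snd (tangentOf (γ₁ 0).proj ξ) < 0)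
    {c₁ : ℝ → ℝ → TangentBundle (𝓡∂ n) M₁} {c₂ : ℝ → ℝ → TangentBundle (𝓡∂ n) M₂}
    {T₁ T₂ : ℝ → ℝ} (hc₁ : ∀ᶠ s in l, g₁.IsGeodesicOn (c₁ s) (T₁ s))
    (hc₂ : ∀ᶠ s in l, g₂.IsGeodesicOn (c₂ s) (T₂ s))
    (hc₁0 : ∀ᶠ s in l, tilt (γ₁ 0) ξ s = c₁ s 0)
    (hc₂0 : ∀ᶠ s in l, tangentMap (𝓡∂ n) (𝓡∂ n) φ (c₁ s 0) = c₂ s 0)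
    (hcend : ∀ᶠ s in l, c₂ s (T₂ s) = tangentMap (𝓡∂ n) (𝓡∂ n) φ (c₁ s (T₁ s)))
    (hT₁ : Tendsto T₁ l (𝓝 τ₁)) (hT₂ : Tendsto T₂ l (𝓝 τ₂)) : τ₁ = τ₂ := by
  have hs0 : ∀ P : TangentBundle (𝓡∂ n) M₁,
      P.proj ∈ (chartAt (EuclideanHalfSpace n) P.proj).source := fun P ↦ mem_chart_source _ _
  have hs0' : ∀ P : TangentBundle (𝓡∂ n) M₂,
      P.proj ∈ (chartAt (EuclideanHalfSpace n) P.proj).source := fun P ↦ mem_chart_source _ _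
  have hl0 : Tendsto (fun s : ℝ ↦ s) l (𝓝 0) := hl.trans nhdsWithin_le_nhds
  have hnear₁ : NearIn l (fun s ↦ s) (γ₁ 0).proj (γ₁ 0) (fun s ↦ c₁ s 0) :=
    ((nearIn_tilt (γ₁ 0) ξ).mono hl).congr hc₁0
  have hnear₂ : NearIn l (fun s ↦ s) (γ₂ 0).proj (γ₂ 0) (fun s ↦ c₂ s 0) := by
    rw [hstart]
    exact (hnear₁.map (φ := φ) (hs0 _) hsrc0 (hs0' _)).congr hc₂0
  have hT₁0 : ∀ᶠ s in l, 0 ≤ T₁ s := (hT₁.eventually (lt_mem_nhds hτ₁)).mono fun _ h ↦ le_of_lt h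
  have hlim₁ : Tendsto (fun s ↦ c₁ s (T₁ s)) l (𝓝 (γ₁ τ₁)) :=
    hγ₁.tendsto hc₁ hnear₁.tendsto hT₁0 hT₁ le_rfl
  -- Applied to reversed geodesics: the final pieces of `γ₁` and of the nearby `c₁ s` stay in the
  -- domain of `φ` for a time η independent of s.
  obtain ⟨η, hη, hstay⟩ := exists_uniform_stay g₁ (P := scale (-1) (γ₁ τ₁)) φ.open_source hsrcτ
  have hstay' : ∀ᶠ s in l, ∀ (c : ℝ → TangentBundle (𝓡∂ n) M₁) (h : ℝ), g₁.IsGeodesicOn c h →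
      h ≤ η → c 0 = scale (-1) (c₁ s (T₁ s)) → ∀ t ∈ Icc 0 h, (c t).proj ∈ φ.source :=
    ((tendsto_reverse _).comp hlim₁).eventually hstay
  have hstayγ := hstay.self_of_nhds
  -- The curves `c₁ s` and `c₂ s` may end before τ₁ and τ₂, so the comparison takes place at τ₁ - ε
  -- and τ₂ - ε, which all of them eventually reach.
  set ε := min (η / 2) (min (τ₁ / 2) (τ₂ / 2)) with hε
  have hε0 : 0 < ε := by positivity
  have hεη : ε < η := (min_le_left _ _).trans_lt (by linarith)
  have hετ₁ : ε < τ₁ := ((min_le_right _ _).trans (min_le_left _ _)).trans_lt (by linarith)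
  have hετ₂ : ε < τ₂ := ((min_le_right _ _).trans (min_le_right _ _)).trans_lt (by linarith)
  have hγsrc : ∀ t ∈ Icc 0 ε, (γ₁ (τ₁ - t)).proj ∈ φ.source := fun t ht ↦
    hstayγ (fun t ↦ scale (-1) (γ₁ (τ₁ - t))) ε (hγ₁.reverse.mono hετ₁.le) hεη.le (by simp) t ht
  have hR := tail_eq hφ hγ₁ hγ₂ hend hε0.le hετ₁.le hετ₂.le hγsrc
  set R := γ₁ (τ₁ - ε) with hRdef
  have hRsrc : R.proj ∈ φ.source := hγsrc ε ⟨hε0.le, le_rfl⟩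
  have hRmem : τ₁ - ε ∈ Icc 0 τ₁ := ⟨by linarith, by linarith⟩
  have hRne : R.snd ≠ 0 := hγ₁.snd_ne_zero hq.1 hRmem
  have hRnull : energy g₁ R = 0 := (hγ₁.energy_eq hRmem).trans hq.2
  -- Points at equal time before the ends correspond. Hence `c₂ s` at τ₂ - ε corresponds to `c₁ s`
  -- at τ₁ - ε + d(s), not at τ₁ - ε.
  set d : ℝ → ℝ := fun s ↦ (T₁ s - τ₁) - (T₂ s - τ₂) with hd
  have hdlim : Tendsto d l (𝓝 0) := by
    simpa using (hT₁.sub_const τ₁).sub (hT₂.sub_const τ₂)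
  have hu : Tendsto (fun s ↦ ε + (T₂ s - τ₂)) l (𝓝 ε) := by
    simpa using (hT₂.sub_const τ₂).const_add ε
  have htail : ∀ᶠ s in l, c₂ s (τ₂ - ε) =
      tangentMap (𝓡∂ n) (𝓡∂ n) φ (c₁ s (τ₁ - ε + d s)) ∧
      (c₁ s (τ₁ - ε + d s)).proj ∈ φ.source ∧ τ₁ - ε + d s ≤ T₁ s ∧ 0 ≤ τ₁ - ε + d s := by
    filter_upwards [hc₁, hc₂, hcend, hstay', hu.eventually (lt_mem_nhds hε0),
      hu.eventually (gt_mem_nhds hεη), (hT₁.sub hu).eventually (lt_mem_nhds (sub_pos.2 hετ₁)),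
      (hT₂.sub hu).eventually (lt_mem_nhds (sub_pos.2 hετ₂))]
      with s h1 h2 h3 h4 h5 h6 h7 h8
    have hsrc : ∀ t ∈ Icc 0 (ε + (T₂ s - τ₂)), (c₁ s (T₁ s - t)).proj ∈ φ.source := fun t ht ↦
      h4 (fun t ↦ scale (-1) (c₁ s (T₁ s - t))) _ (h1.reverse.mono (sub_nonneg.1 h7.le)) h6.le
        (by simp) t ht
    have h9 := tail_eq hφ h1 h2 h3 h5.le (sub_nonneg.1 h7.le) (sub_nonneg.1 h8.le) hsrc
    have e1 : T₂ s - (ε + (T₂ s - τ₂)) = τ₂ - ε := by ring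
    have e2 : T₁ s - (ε + (T₂ s - τ₂)) = τ₁ - ε + d s := by simp only [hd]; ring
    have h10 := hsrc _ ⟨h5.le, le_rfl⟩
    rw [e1, e2] at h9
    rw [e2] at h10 h7
    exact ⟨h9, h10, by linarith, h7.le⟩
  have hle₁ : ∀ᶠ s in l, τ₁ - ε ≤ T₁ s :=
    (hT₁.eventually (lt_mem_nhds (show τ₁ - ε < τ₁ by linarith))).mono fun _ h ↦ le_of_lt h
  have hle₂ : ∀ᶠ s in l, τ₂ - ε ≤ T₂ s :=
    (hT₂.eventually (lt_mem_nhds (show τ₂ - ε < τ₂ by linarith))).mono fun _ h ↦ le_of_lt h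
  obtain ⟨hnR, hmR⟩ := first_variation (sub_nonneg.2 hετ₁.le) (hγ₁.mono hRmem.2)
    (by filter_upwards [hc₁, hle₁] with s h1 h2 using h1.mono h2) hnear₁
  obtain ⟨hnR', hmR'⟩ := first_variation (sub_nonneg.2 hετ₂.le) (hγ₂.mono (by linarith))
    (by filter_upwards [hc₂, hle₂] with s h1 h2 using h1.mono h2) hnear₂
  rw [← hRdef] at hnR
  rw [hR] at hnR' hmR'
  have hnb : NearIn l (fun s ↦ s) R.proj R (fun s ↦ c₁ s (τ₁ - ε + d s)) := by
    have h1 := hnR'.map (φ := φ.symm) (q₂ := R.proj) (hs0' _) (φ.map_source hRsrc) (by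
      rw [show φ.symm (tangentMap (𝓡∂ n) (𝓡∂ n) φ R).proj = R.proj from φ.left_inv hRsrc]
      exact hs0 R)
    rw [tangentMap_symm_apply hRsrc] at h1
    refine h1.congr ?_
    filter_upwards [htail] with s hs
    rw [hs.1, tangentMap_symm_apply hs.2.1]
  have hmap := hnb.momentum_map (q₂ := φ R.proj) hφ (hs0 R) hRsrc (mem_chart_source _ _)
  have hconn : ∀ᶠ s in l, (0 ≤ d s ∧ ∃ k, g₁.IsGeodesicOn k (d s) ∧ k 0 = c₁ s (τ₁ - ε) ∧
        k (d s) = c₁ s (τ₁ - ε + d s)) ∨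
      (d s ≤ 0 ∧ ∃ k, g₁.IsGeodesicOn k (-d s) ∧ k 0 = c₁ s (τ₁ - ε + d s) ∧
        k (-d s) = c₁ s (τ₁ - ε)) := by
    filter_upwards [hc₁, htail, hle₁] with s h1 h2 h3
    rcases le_total 0 (d s) with h0 | h0
    · obtain ⟨-, k, hk⟩ := h1.reach hRmem.1 (show τ₁ - ε ≤ τ₁ - ε + d s by linarith) h2.2.2.1
      rw [add_sub_cancel_left] at hk
      exact Or.inl ⟨h0, k, hk⟩
    · obtain ⟨-, k, hk⟩ := h1.reach h2.2.2.2 (show τ₁ - ε + d s ≤ τ₁ - ε by linarith) h3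
      rw [show τ₁ - ε - (τ₁ - ε + d s) = -d s by ring] at hk
      exact Or.inr ⟨h0, k, hk⟩
  have hsub := momentum_sub_isBigO (hs0 R) hRne hRnull hl0 hnR hnb hdlim hconn
  set κ := g₁.inner (γ₁ 0).proj (γ₁ 0).snd (tangentOf (γ₁ 0).proj ξ)
  set χ := g₁.inner (γ₁ 0).proj (tangentOf (γ₁ 0).proj ξ) (tangentOf (γ₁ 0).proj ξ)
  have hsq : (fun s : ℝ ↦ (τ₁ - τ₂) / 2 * χ * s ^ 2) =O[l] fun s ↦ s ^ 2 :=
    (isBigO_refl _ _).const_mul_left _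
  -- The two first variation formulas are subtracted. The final pairings cancel through `hmap`
  -- (invariance under `φ`) and `hsub` (the shift by d(s)), the initial ones vanish, and `hsq`
  -- removes the quadratic part of the energy change.
  have hfin : (fun s ↦ s * ((τ₁ - τ₂) * κ)) =O[l] fun s ↦ s ^ 2 := by
    refine (((hmR'.sub hmR).sub hmap).sub hsub).sub hsq |>.congr' ?_ EventuallyEq.rfl
    filter_upwards [hc₁0, hc₂0, htail] with s h1 h2 h3
    have e1 : energy g₁ (c₁ s 0) = energy g₁ (γ₁ 0) + s * (2 * κ) + s ^ 2 * χ := by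
      rw [← h1]; exact energy_tilt _ _ _
    have hp1 : (c₁ s 0).proj = (γ₁ 0).proj := by rw [← h1]; rfl
    have e2 : energy g₂ (c₂ s 0) = energy g₁ (c₁ s 0) := by
      rw [← h2]; exact energy_tangentMap hφ (by rw [hp1]; exact hsrc0)
    have e3 : energy g₂ (γ₂ 0) = energy g₁ (γ₁ 0) := by
      rw [hstart]; exact energy_tangentMap hφ hsrc0
    have m1 : momentum g₁ (γ₁ 0).proj (γ₁ 0) (c₁ s 0) = 0 := momentum_eq_zero hp1
    have m2 : momentum g₂ (γ₂ 0).proj (γ₂ 0) (c₂ s 0) = 0 := by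
      refine momentum_eq_zero ?_
      rw [← h2, hstart]
      exact congrArg φ hp1
    rw [m1, m2, e2, e3, e1, h3.1]
    simp only [tangentMap]
    ring
  have h0 := eq_zero_of_isBigO_sq hl hfin
  have := (mul_eq_zero.1 h0).resolve_right hξ.ne
  linarith

/-- From every lightlike boundary vector whose geodesic stays in `M₁` for some time, some later
boundary point of the geodesic corresponds to a point of the geodesic in `M₂`, at the same time. -/
theorem SameData.exists_reach [T2Space M₁] [T2Space M₂] (h : SameData g₁ g₂ O₁ O₂ φ)
    {q : TangentBundle (𝓡∂ n) M₁} (hq : q ∈ g₁.lightlike) (hqb : q.proj ∈ (𝓡∂ n).boundary M₁)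
    {δ : ℝ} (hδ : 0 < δ) (hstay : δ ∈ g₁.stayTimes q) :
    ∃ T > 0, ∃ Q, Reach g₁ q T Q ∧ Q.proj ∈ (𝓡∂ n).boundary M₁ ∧
      Reach g₂ (tangentMap (𝓡∂ n) (𝓡∂ n) φ q) T (tangentMap (𝓡∂ n) (𝓡∂ n) φ Q) := by
  have hφ : IsometricOn g₁ g₂ φ := h.isometry.isometry
  have hqsrc := h.isometry.source hqb
  obtain ⟨ξ, hξ0, hξ⟩ := exists_tilt_direction h.timelike₁ hq hqb
  have hv := normalCoord_nonneg_of_stayTimes hδ hstay hqb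
  -- The uniform time δ' bounds the exit times of the tilted geodesics from below, so their limit
  -- does not collapse onto `q`, even if `q` is tangential.
  obtain ⟨δ', hδ', hgeo⟩ := exists_geodesic_tilt hδ hstay ξ hξ0
  have hdata : ∀ᶠ s in 𝓝[>] (0 : ℝ), ∃ T₁ T₂ c₁ c₂, δ' ≤ T₁ ∧ 0 ≤ T₂ ∧ g₁.IsGeodesicOn c₁ T₁ ∧
      g₂.IsGeodesicOn c₂ T₂ ∧ tilt q ξ s = c₁ 0 ∧ tangentMap (𝓡∂ n) (𝓡∂ n) φ (c₁ 0) = c₂ 0 ∧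
      c₂ T₂ = tangentMap (𝓡∂ n) (𝓡∂ n) φ (c₁ T₁) ∧ (c₁ T₁).proj ∈ (𝓡∂ n).boundary M₁ := by
    filter_upwards [hgeo, h.eventually_tilt_mem hq hqb hv hξ0 hξ] with s hs1 hs2
    obtain ⟨c, hc, hc0, hci⟩ := hs1
    obtain ⟨T₁, T₂, Q, hT₁, ⟨-, c₁, h1, h2, h3⟩, hQ, hT₂, c₂, h4, h5, h6⟩ := h.exists_match hs2
      ⟨hδ', c, hc, hc0, fun t ht ↦ hci t ⟨ht.1, ht.2.le⟩⟩
    exact ⟨T₁, T₂, c₁, c₂, hT₁, hT₂, h1, h4, h2.symm, by rw [h2, h5], by rw [h3, h6], by rwa [h3]⟩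
  obtain ⟨T₁, hdata⟩ := hdata.choice
  obtain ⟨T₂, hdata⟩ := hdata.choice
  obtain ⟨c₁, hdata⟩ := hdata.choice
  obtain ⟨c₂, hdata⟩ := hdata.choice
  -- The scattering data need not be continuous, so the end times need not converge as s → 0. Along
  -- an ultrafilter bounded times do converge; the bounds come from non-trapping of the limit
  -- geodesics.
  set U := Ultrafilter.of (𝓝[>] (0 : ℝ))
  have hU : (U : Filter ℝ) ≤ 𝓝[>] 0 := Ultrafilter.of_le _
  replace hdata := hdata.filter_mono hU
  have hc₁0 : ∀ᶠ s in (U : Filter ℝ), tilt q ξ s = c₁ s 0 := hdata.mono fun s hs ↦ hs.2.2.2.2.1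
  have hc₂0 : ∀ᶠ s in (U : Filter ℝ), tangentMap (𝓡∂ n) (𝓡∂ n) φ (c₁ s 0) = c₂ s 0 :=
    hdata.mono fun s hs ↦ hs.2.2.2.2.2.1
  have hlim₁ : Tendsto (fun s ↦ c₁ s 0) U (𝓝 q) :=
    ((nearIn_tilt q ξ).tendsto.mono_left hU).congr' hc₁0
  have hlim₂ : Tendsto (fun s ↦ c₂ s 0) U (𝓝 (tangentMap (𝓡∂ n) (𝓡∂ n) φ q)) :=
    ((tendsto_tangentMap hqsrc).tendsto.comp hlim₁).congr' hc₂0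
  obtain ⟨τ₁, hτ₁⟩ := h.nonTrapping₁ q hq
  obtain ⟨τ₂, hτ₂⟩ := h.nonTrapping₂ _ (lightlike_tangentMap hφ hqsrc hq)
  have hgeo₁ : ∀ᶠ s in (U : Filter ℝ), g₁.IsGeodesicOn (c₁ s) (T₁ s) :=
    hdata.mono fun s hs ↦ hs.2.2.1
  have hgeo₂ : ∀ᶠ s in (U : Filter ℝ), g₂.IsGeodesicOn (c₂ s) (T₂ s) :=
    hdata.mono fun s hs ↦ hs.2.2.2.1
  have hlimit : ∀ (T : ℝ → ℝ) (a b : ℝ), (∀ᶠ s in (U : Filter ℝ), a ≤ T s) →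
      (∀ᶠ s in (U : Filter ℝ), T s < b) → ∃ t, a ≤ t ∧ Tendsto T U (𝓝 t) := by
    intro T a b ha hb
    have hmem : ∀ᶠ s in (U : Filter ℝ), T s ∈ Icc a b := by
      filter_upwards [ha, hb] with s h1 h2 using ⟨h1, h2.le⟩
    obtain ⟨t, ht, hle⟩ := (isCompact_Icc (a := a) (b := b)).ultrafilter_le_nhds (U.map T)
      (le_principal_iff.2 hmem)
    exact ⟨t, ht.1, hle⟩
  obtain ⟨t₁, ht₁, hT₁⟩ := hlimit T₁ δ' (τ₁ + 1) (hdata.mono fun s hs ↦ hs.1)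
    (eventually_le_of_isGreatest_stayTimes one_pos hτ₁ hgeo₁ hlim₁)
  obtain ⟨t₂, ht₂, hT₂⟩ := hlimit T₂ 0 (τ₂ + 1) (hdata.mono fun s hs ↦ hs.2.1)
    (eventually_le_of_isGreatest_stayTimes one_pos hτ₂ hgeo₂ hlim₂)
  obtain ⟨hm₁, hend₁⟩ := tendsto_geodesicFlow hτ₁ hgeo₁ hlim₁
    (hdata.mono fun s hs ↦ hδ'.le.trans hs.1) hT₁
  obtain ⟨hm₂, hend₂⟩ := tendsto_geodesicFlow hτ₂ hgeo₂ hlim₂ (hdata.mono fun s hs ↦ hs.2.1) hT₂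
  have ht₁0 : 0 < t₁ := hδ'.trans_le ht₁
  have hproj := (FiberBundle.continuous_proj (Coord n) (TangentSpace (𝓡∂ n) (M := M₁)))
  have hQb : (g₁.geodesicFlow q t₁).proj ∈ (𝓡∂ n).boundary M₁ :=
    ((𝓡∂ n).isClosed_boundary (n := ∞) (by simp)).mem_of_tendsto
      ((hproj.tendsto _).comp hend₁) (hdata.mono fun s hs ↦ hs.2.2.2.2.2.2.2)
  have hQsrc := h.isometry.source hQb
  have hcend : ∀ᶠ s in (U : Filter ℝ),
      c₂ s (T₂ s) = tangentMap (𝓡∂ n) (𝓡∂ n) φ (c₁ s (T₁ s)) :=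
    hdata.mono fun s hs ↦ hs.2.2.2.2.2.2.1
  have hQ : g₂.geodesicFlow (tangentMap (𝓡∂ n) (𝓡∂ n) φ q) t₂ =
      tangentMap (𝓡∂ n) (𝓡∂ n) φ (g₁.geodesicFlow q t₁) :=
    tangentBundle_tendsto_unique hend₂ (((tendsto_tangentMap hQsrc).tendsto.comp hend₁).congr'
      (hcend.mono fun s hs ↦ hs.symm))
  have hr₁ := reach_geodesicFlow hm₁
  have hr₂ := reach_geodesicFlow hm₂
  rw [hQ] at hr₂
  -- If t₂ = 0, the end vectors agree with the initial ones and the geodesic of `q` returns to `q`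
  -- at time t₁ > 0. It could then be prolonged beyond its maximal time.
  have ht₂0 : 0 < t₂ := by
    refine lt_of_le_of_ne ht₂ fun h0 ↦ ?_
    rw [← h0] at hr₂
    have h1 := tangentMap_injOn hQsrc hqsrc (hr₂.unique (reach_zero _))
    rw [h1] at hr₁
    have := hτ₁.2 (hr₁.trans (reach_geodesicFlow hτ₁.1)).mem_stayTimes
    linarith
  obtain ⟨-, γ₁, hγ₁, rfl, hγ₁t⟩ := hr₁
  obtain ⟨-, γ₂, hγ₂, hγ₂0, hγ₂t⟩ := id hr₂
  have heq : t₁ = t₂ := eq_time_of_tendsto hφ hU ht₁0 ht₂0 hγ₁ hγ₂ hγ₂0 hqsrc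
    (by rw [hγ₂t, hγ₁t]) (by rw [hγ₁t]; exact hQsrc) hq hξ hgeo₁ hgeo₂ hc₁0 hc₂0 hcend hT₁ hT₂
  subst heq
  exact ⟨t₁, ht₁0, _, reach_geodesicFlow hm₁, hQb, hr₂⟩

/-- All boundary points on a geodesic that cannot be continued into the past correspond. -/
theorem SameData.reach_of_maximal [T2Space M₁] [T2Space M₂] (h : SameData g₁ g₂ O₁ O₂ φ)
    {p Q : TangentBundle (𝓡∂ n) M₁} (hp : p ∈ g₁.lightlike)
    (hmax : ∀ t ∈ g₁.stayTimes (scale (-1) p), t = 0) {t : ℝ} (hQ : Reach g₁ p t Q)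
    (hQb : Q.proj ∈ (𝓡∂ n).boundary M₁) :
    Reach g₂ (tangentMap (𝓡∂ n) (𝓡∂ n) φ p) t (tangentMap (𝓡∂ n) (𝓡∂ n) φ Q) := by
  have hφ : IsometricOn g₁ g₂ φ := h.isometry.isometry
  obtain ⟨ht0, c, hc, rfl, rfl⟩ := hQ
  have hreach : ∀ a b, 0 ≤ a → a ≤ b → b ≤ t → Reach g₁ (c a) (b - a) (c b) := fun a b h1 h2 h3 ↦
    hc.reach h1 h2 h3
  refine real_induction (P := fun s ↦ (c s).proj ∈ (𝓡∂ n).boundary M₁ →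
    Reach g₂ (tangentMap (𝓡∂ n) (𝓡∂ n) φ (c 0)) s (tangentMap (𝓡∂ n) (𝓡∂ n) φ (c s)))
    (fun _ ↦ reach_zero _) ?_ ?_ t ⟨ht0, le_rfl⟩ hQb
  · intro s hs hP hsb
    have hrs : Reach g₁ (c 0) s (c s) := by simpa using hreach 0 s le_rfl hs.1.le hs.2
    -- Applied to the reversed velocity at time s, the step leads to an earlier boundary point,
    -- where the claim is already known. No lower bound on `T` is needed.
    obtain ⟨T, hT, Q', hQ', hQ'b, hQ'2⟩ := h.exists_reach (q := scale (-1) (c s))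
      (lightlike_reverse (hrs.lightlike hp)) hsb hs.1 hrs.reverse.mem_stayTimes
    -- Here it matters that the geodesic cannot be continued into the past: the backward step cannot
    -- pass the starting point.
    have hTs : T ≤ s := by
      by_contra! hlt
      have := hmax _ (hrs.reverse.right_unique hQ' hlt.le).mem_stayTimes
      linarith
    have hr1 := hreach (s - T) s (by linarith) (by linarith) hs.2
    rw [sub_sub_cancel] at hr1
    have hQeq : Q' = scale (-1) (c (s - T)) := hQ'.unique hr1.reverse
    subst hQeq
    have h1 := hP (s - T) ⟨by linarith, by linarith⟩ hQ'b
    rw [tangentMap_reverse, tangentMap_reverse] at hQ'2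
    have h2 := hQ'2.reverse
    rw [scale_neg_one_scale, scale_neg_one_scale] at h2
    simpa using h1.trans h2
  · intro s hs hP
    have hproj := (FiberBundle.continuous_proj (Coord n) (TangentSpace (𝓡∂ n) (M := M₁)))
    have hsI : s ∈ Icc 0 t := ⟨hs.1, hs.2.le⟩
    -- After a boundary point the geodesic stays for a while in the domain of `φ` and is carried
    -- over by the isometry. After an interior point there are no boundary points for a while, so
    -- there is nothing to prove.
    by_cases hsb : (c s).proj ∈ (𝓡∂ n).boundary M₁
    · have hev : ∀ᶠ u in 𝓝[Icc 0 t] s, (c u).proj ∈ φ.source :=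
        (hproj.continuousAt.comp_continuousWithinAt (hc.1 s hsI)).eventually
          (φ.open_source.mem_nhds (h.isometry.source hsb))
      obtain ⟨η, hη, hη'⟩ := Metric.mem_nhdsWithin_iff.1 hev
      refine ⟨s + η / 2, by linarith, fun u hu hut _ ↦ ?_⟩
      have hk := ((hc.mono hut).shift hs.1).map hφ (fun r hr ↦ hη' ⟨by
        rw [Metric.mem_ball, Real.dist_eq, add_sub_cancel_right, abs_of_nonneg hr.1]
        linarith [hr.2, hu.2], by linarith [hr.1, hs.1], by linarith [hr.2]⟩)
      have h1 := hk.reach le_rfl (show 0 ≤ u - s by linarith [hu.1]) le_rfl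
      simp only [zero_add, sub_zero, sub_add_cancel] at h1
      simpa using (hP s ⟨hs.1, le_rfl⟩ hsb).trans h1
    · have hev : ∀ᶠ u in 𝓝[Icc 0 t] s, (c u).proj ∉ (𝓡∂ n).boundary M₁ :=
        (hproj.continuousAt.comp_continuousWithinAt (hc.1 s hsI)).eventually
          (((𝓡∂ n).isClosed_boundary (n := ∞) (by simp)).isOpen_compl.mem_nhds hsb)
      obtain ⟨η, hη, hη'⟩ := Metric.mem_nhdsWithin_iff.1 hev
      refine ⟨s + η / 2, by linarith, fun u hu hut hub ↦ absurd hub (hη' ⟨?_, ?_⟩)⟩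
      · rw [Metric.mem_ball, Real.dist_eq, abs_of_pos (sub_pos.2 hu.1)]
        linarith [hu.2]
      · exact ⟨hs.1.trans hu.1.le, hut⟩

/-- Follow the geodesic back to where it entered the manifold. Both `p` and `Q` are boundary points
on this maximal geodesic, so `reach_of_maximal` applies to each; the two resulting geodesics in `M₂`
are subtracted by uniqueness. -/
theorem SameData.reach [T2Space M₁] [T2Space M₂] (h : SameData g₁ g₂ O₁ O₂ φ)
    {p Q : TangentBundle (𝓡∂ n) M₁} (hp : p ∈ g₁.lightlike) (hpb : p.proj ∈ (𝓡∂ n).boundary M₁)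
    {t : ℝ} (hQ : Reach g₁ p t Q) (hQb : Q.proj ∈ (𝓡∂ n).boundary M₁) :
    Reach g₂ (tangentMap (𝓡∂ n) (𝓡∂ n) φ p) t (tangentMap (𝓡∂ n) (𝓡∂ n) φ Q) := by
  obtain ⟨τ, hτ⟩ := h.nonTrapping₁ _ (lightlike_reverse hp)
  have hR := reach_geodesicFlow hτ.1
  set R := g₁.geodesicFlow (scale (-1) p) τ
  have hback := hR.reverse
  rw [scale_neg_one_scale] at hback
  have hmax : ∀ t ∈ g₁.stayTimes (scale (-1) (scale (-1) R)), t = 0 := fun t ht ↦ by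
    rw [scale_neg_one_scale] at ht
    have h1 := hτ.2 (hR.trans (reach_geodesicFlow ht)).mem_stayTimes
    linarith [ht.1]
  have hp' : scale (-1) R ∈ g₁.lightlike := lightlike_reverse (hR.lightlike (lightlike_reverse hp))
  have h1 := h.reach_of_maximal hp' hmax hback hpb
  have h2 := h.reach_of_maximal hp' hmax (hback.trans hQ) hQb
  simpa using h1.right_unique h2 (by linarith [hQ.1])

/-- Exit points are boundary points. So the geodesic in `M₂` lasts at least as long as the one in
`M₁`, and conversely by symmetry; at the common exit time the end vectors correspond. -/
theorem SameData.scattering [T2Space M₁] [T2Space M₂] (h : SameData g₁ g₂ O₁ O₂ φ)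
    {p : TangentBundle (𝓡∂ n) M₁} (hp : p ∈ g₁.lightlike) (hpb : p.proj ∈ (𝓡∂ n).boundary M₁) :
    tangentMap (𝓡∂ n) (𝓡∂ n) φ (g₁.completeScattering p) =
        g₂.completeScattering (tangentMap (𝓡∂ n) (𝓡∂ n) φ p) ∧
      g₁.completeTime p = g₂.completeTime (tangentMap (𝓡∂ n) (𝓡∂ n) φ p) := by
  have hφ : IsometricOn g₁ g₂ φ := h.isometry.isometry
  have hsrc := h.isometry.source hpb
  have hp₂ := lightlike_tangentMap hφ hsrc hp
  have hpb₂ : (tangentMap (𝓡∂ n) (𝓡∂ n) φ p).proj ∈ (𝓡∂ n).boundary M₂ :=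
    (map_mem_boundary_iff hsrc).2 hpb
  obtain ⟨τ₁, hτ₁⟩ := h.nonTrapping₁ p hp
  obtain ⟨τ₂, hτ₂⟩ := h.nonTrapping₂ _ hp₂
  have hr₁ := reach_geodesicFlow hτ₁.1
  have hr₂ := reach_geodesicFlow hτ₂.1
  have h1 := h.reach hp hpb hr₁ (exit_mem_boundary hτ₁ hr₁)
  have h2 := h.symm.reach hp₂ hpb₂ hr₂ (exit_mem_boundary hτ₂ hr₂)
  rw [tangentMap_symm_apply hsrc] at h2
  have heq : τ₁ = τ₂ := le_antisymm (hτ₂.2 h1.mem_stayTimes) (hτ₁.2 h2.mem_stayTimes)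
  rw [LorentzMetric.completeScattering, LorentzMetric.completeScattering, completeTime_eq hτ₁,
    completeTime_eq hτ₂]
  subst heq
  exact ⟨h1.geodesicFlow_eq.symm, rfl⟩

/-! ### Inward vectors -/

/-- A map that preserves the half space and maps a boundary point to a boundary point maps inward
vectors to inward vectors. -/
theorem normalCoord_tangentMap_nonneg {p : TangentBundle (𝓡∂ n) M₁} (hsrc : p.proj ∈ φ.source)
    (hpb : p.proj ∈ (𝓡∂ n).boundary M₁) (hv : 0 ≤ normalCoord p.proj p.snd) :
    0 ≤ normalCoord (φ p.proj) (tangentMap (𝓡∂ n) (𝓡∂ n) φ p).snd := by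
  set x := p.proj
  have h1 : p.proj ∈ (chartAt (EuclideanHalfSpace n) x).source := mem_chart_source _ _
  have h3 : φ p.proj ∈ (chartAt (EuclideanHalfSpace n) (φ x)).source := mem_chart_source _ _
  have hdom : (coord x p).1 ∈ coordDomain φ x (φ x) := coordDomain_mem φ h1 hsrc h3
  have hcoord := coord_tangentMap φ h1 hsrc h3
  rw [normalCoord_eq] at hv
  rw [show φ x = (tangentMap (𝓡∂ n) (𝓡∂ n) φ p).proj from rfl, normalCoord_eq]
  change 0 ≤ (coord (φ x) (tangentMap (𝓡∂ n) (𝓡∂ n) φ p)).2 0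
  have h0 := coord_fst_eq_zero (P := tangentMap (𝓡∂ n) (𝓡∂ n) φ p) h3
    ((map_mem_boundary_iff hsrc).2 hpb)
  rw [hcoord] at h0 ⊢
  have hΨ := ((contDiffWithinAt_coordMap φ hdom).differentiableWithinAt (by simp)).hasFDerivWithinAt
  have hline : HasDerivWithinAt (fun t : ℝ ↦ (coord x p).1 + t • (coord x p).2) (coord x p).2
      (Icc 0 1) 0 := by
    simpa using ((hasDerivWithinAt_id (0 : ℝ) (Icc 0 1)).smul_const (coord x p).2).const_add
      (coord x p).1
  have hx0 := coord_fst_eq_zero h1 hpb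
  -- A straight segment with inward or tangential direction stays in the half space, and so does its
  -- image. Starting at height 0, the image has a nonnegative initial derivative of its first
  -- coordinate.
  have hmaps : MapsTo (fun t : ℝ ↦ (coord x p).1 + t • (coord x p).2) (Icc 0 1)
      (range (𝓡∂ n)) := fun t ht ↦ by
    rw [mem_range_iff]
    simp only [PiLp.add_apply, PiLp.smul_apply, smul_eq_mul, hx0, zero_add]
    exact mul_nonneg ht.1 hv
  have hcomp := HasFDerivWithinAt.comp_hasDerivWithinAt_of_eq
    (f := fun t : ℝ ↦ (coord x p).1 + t • (coord x p).2) 0 hΨ hline hmaps (by simp)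
  have hcomp0 := (EuclideanSpace.proj (0 : Fin n) : Coord n →L[ℝ] ℝ).hasFDerivAt.comp_hasDerivWithinAt
    0 hcomp
  refine derivWithin_nonneg_of_nonneg one_pos hcomp0 ?_ fun t _ ↦ ?_
  · simpa using h0
  · exact mem_range_iff.1 (coordMap_mem_range φ _)

theorem SameData.image_subset (h : SameData g₁ g₂ O₁ O₂ φ) {p : TangentBundle (𝓡∂ n) M₁}
    (hp : p ∈ g₁.lightlike ∩ g₁.inwardClosure) :
    tangentMap (𝓡∂ n) (𝓡∂ n) φ p ∈ g₂.lightlike ∩ g₂.inwardClosure := by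
  obtain ⟨hpb, hv⟩ := (mem_inwardClosure_iff h.timelike₁).1 hp.2
  have hsrc := h.isometry.source hpb
  exact ⟨lightlike_tangentMap h.isometry.isometry hsrc hp.1, (mem_inwardClosure_iff h.timelike₂).2
    ⟨(map_mem_boundary_iff hsrc).2 hpb, normalCoord_tangentMap_nonneg hsrc hpb hv⟩⟩

end

end LorentzScattering

end

/-! ### The main theorem -/

open LorentzScattering in
theorem lemma6p5 {n : ℕ} [NeZero n]
    {M₁ : Type*} [TopologicalSpace M₁] [T2Space M₁] [SecondCountableTopology M₁]
    [ChartedSpace (EuclideanHalfSpace n) M₁] [IsManifold (𝓡∂ n) ∞ M₁]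
    {M₂ : Type*} [TopologicalSpace M₂] [T2Space M₂] [SecondCountableTopology M₂]
    [ChartedSpace (EuclideanHalfSpace n) M₂] [IsManifold (𝓡∂ n) ∞ M₂]
    (g₁ : LorentzMetric n M₁) (g₂ : LorentzMetric n M₂)
    (hb₁ : g₁.TimelikeBoundary) (hb₂ : g₂.TimelikeBoundary)
    (hnt₁ : ∀ p ∈ g₁.lightlike, g₁.IsNonTrapping p)
    (hnt₂ : ∀ p ∈ g₂.lightlike, g₂.IsNonTrapping p)
    -- conic neighbourhoods of the boundary light cones
    (O₁ : Set (TangentBundle (𝓡∂ n) M₁)) (O₂ : Set (TangentBundle (𝓡∂ n) M₂))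
    (hO₁ : g₁.IsConicNhd O₁) (hO₂ : g₂.IsConicNhd O₂)
    -- the metrics agree near the boundary
    (φ : PartialDiffeomorph (𝓡∂ n) (𝓡∂ n) M₁ M₂ ∞) (hφ : IsBoundaryNhdIsometry g₁ g₂ φ)
    (hdata :
      -- the interior scattering relations agree on inward causal directions near the light cone
      (tangentMap (𝓡∂ n) (𝓡∂ n) φ '' (O₁ ∩ g₁.causal ∩ g₁.inward) =
          O₂ ∩ g₂.causal ∩ g₂.inward ∧
        ∀ p ∈ O₁ ∩ g₁.causal ∩ g₁.inward,
          tangentMap (𝓡∂ n) (𝓡∂ n) φ (g₁.interiorScattering p) =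
            g₂.interiorScattering (tangentMap (𝓡∂ n) (𝓡∂ n) φ p)) ∨
      -- or the complete ones agree on inward or tangential causal directions near the light cone
      (tangentMap (𝓡∂ n) (𝓡∂ n) φ '' (O₁ ∩ g₁.causal ∩ g₁.inwardClosure) =
          O₂ ∩ g₂.causal ∩ g₂.inwardClosure ∧
        ∀ p ∈ O₁ ∩ g₁.causal ∩ g₁.inwardClosure,
          tangentMap (𝓡∂ n) (𝓡∂ n) φ (g₁.completeScattering p) =
            g₂.completeScattering (tangentMap (𝓡∂ n) (𝓡∂ n) φ p))) :
    tangentMap (𝓡∂ n) (𝓡∂ n) φ '' (g₁.lightlike ∩ g₁.inwardClosure) =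
        g₂.lightlike ∩ g₂.inwardClosure ∧
      ∀ p ∈ g₁.lightlike ∩ g₁.inwardClosure,
        tangentMap (𝓡∂ n) (𝓡∂ n) φ (g₁.completeScattering p) =
            g₂.completeScattering (tangentMap (𝓡∂ n) (𝓡∂ n) φ p) ∧
          g₁.completeTime p = g₂.completeTime (tangentMap (𝓡∂ n) (𝓡∂ n) φ p) := by
  have h : SameData g₁ g₂ O₁ O₂ φ := ⟨hb₁, hb₂, hnt₁, hnt₂, hO₁, hO₂, hφ, hdata⟩
  refine ⟨Set.Subset.antisymm ?_ fun q hq ↦ ?_, fun p hp ↦ h.scattering hp.1 hp.2.1⟩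
  · rintro _ ⟨p, hp, rfl⟩
    exact h.image_subset hp
  -- Surjectivity is the inclusion already proved, applied with the two manifolds exchanged: the
  -- preimage is the image under `φ.symm`.
  · exact ⟨_, h.symm.image_subset hq, tangentMap_apply_symm (hφ.target hq.2.1)⟩
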